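/- Let $G$ be a finite connected graph (loops and parallel edges allowed) with non-negative edge weights $w$, cellularly embedded on a closed connected orientable surface of genus $g\ge 1$ (punctures of the surface, if any, are recorded as "boundary" faces). For a set $A$ of faces, $\partial A$ is the set of edges having a face of $A$ on one side and a face outside $A$ on the other. Sets of edges $X,Y$ are *homologous* if $X\oplus Y=\partial A$ for some set $A$ of faces. The $\mathbb Z_2$-chain of a walk is the set of edges it traverses an odd number of times, walks are homologous if their chains are, and the length of a walk is its weight counted with multiplicity. For faces $a,b$, an *$ab$-separating subgraph* is a set $S=\partial A$ with $a\in A$, $b\notin A$; it is *minimum* if it has minimum weight among all of these. A simple cycle $C$ is *tight* if no closed walk homologous to $C$ (constant walks included) is shorter; a simple $x$-to-$y$ path is *tight* if no $x$-to-$y$ walk homologous to it is shorter. For a set $X$ of edges, $G\mathbin{|\!\!|}X$ is the embedded graph obtained by cutting the surface along $X$: every edge of $X$ gets two copies, each inheriting the weight, every face of $G$ remains a face, and each resulting puncture becomes an additional boundary face. A set $S$ of edges of $G$ is called a minimum $ab$-separating subgraph of $G\mathbin{|\!\!|}X$ if one can choose one copy of each edge of $S$ so that the chosen copies form a minimum $ab$-separating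 subgraph of $G\mathbin{|\!\!|}X$. A *tight cycle-path pair* $(C,P)$ consists of a tight cycle $C$ of $G$ and a tight path $P$ of $G\mathbin{|\!\!|}C$ from a vertex of one copy of $C$ to a vertex of the other copy, such that $G\mathbin{|\!\!|}(C\cup P)$ is connected, has genus $g-1$ and has exactly one boundary face more than $G$. A set $H_1$ of edges *crosses* a set $H_2$ if, after contracting some subset of $H_1\cap H_2$, there is a vertex around which four edge-ends $e_1,e_2,e_1',e_2'$ occur in this cyclic order with $e_1,e_1'\in H_1$ and $e_2,e_2'\in H_2$. Let $a,b$ be faces of $G$ and let $S$ be a minimum $ab$-separating subgraph of $G$. Then at least one of the following holds. (1) There is a tight cycle $C\subsetneq S$ such that $S\setminus C$ is a minimum $ab$-separating subgraph of $G\mathbin{|\!\!|}C$. (2) There is a tight cycle-path pair $(C,P)$ in $G$ such that neither $C$ nor $P$ crosses $S$, and $S$ is a minimum $ab$-separating subgraph of $G\mathbin{|\!\!|}(C\cup P)$. -/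

import Mathlib

theorem firstReturn_exists {D : Type*} [Finite D] (f : Equiv.Perm D) (s : Set D) (x : s) :
    ∃ n : ℕ, (f ^ (n + 1)) (x : D) ∈ s := by
  refine ⟨orderOf f - 1, ?_⟩
  have h : orderOf f - 1 + 1 = orderOf f := Nat.sub_add_cancel (orderOf_pos f)
  rw [h, pow_orderOf_eq_one]
  exact x.2

open Classical in
/-- The first of `f x, f (f x), …` that lies in `s`. -/
noncomputable def firstReturnFun {D : Type*} [Finite D] (f : Equiv.Perm D) (s : Set D) (x : s) :
    s :=
  ⟨(f ^ (Nat.find (firstReturn_exists f s x) + 1)) (x : D),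
    Nat.find_spec (firstReturn_exists f s x)⟩

open Classical in
theorem firstReturnFun_injective {D : Type*} [Finite D] (f : Equiv.Perm D) (s : Set D) :
    Function.Injective (firstReturnFun f s) := by
  have key : ∀ x y : s, Nat.find (firstReturn_exists f s x) ≤ Nat.find (firstReturn_exists f s y) →
      firstReturnFun f s x = firstReturnFun f s y → x = y := by
    intro x y hle hxy
    have h : (f ^ (Nat.find (firstReturn_exists f s x) + 1)) (x : D) =
        (f ^ (Nat.find (firstReturn_exists f s y) + 1)) (y : D) := congrArg Subtype.val hxy
    have hmin := fun k => Nat.find_min (firstReturn_exists f s y) (m := k)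
    generalize Nat.find (firstReturn_exists f s x) = n at *
    generalize Nat.find (firstReturn_exists f s y) = m at *
    obtain ⟨k, rfl⟩ := Nat.exists_eq_add_of_le hle
    have e : n + k + 1 = (n + 1) + k := by omega
    rw [e, pow_add f (n + 1) k, Equiv.Perm.mul_apply] at h
    have h' : (x : D) = (f ^ k) (y : D) := (f ^ (n + 1)).injective h
    cases k with
    | zero => exact Subtype.ext (by simpa using h')
    | succ j => exact absurd (h' ▸ x.2) (hmin j (by omega))
  intro x y hxy
  rcases le_total (Nat.find (firstReturn_exists f s x))
    (Nat.find (firstReturn_exists f s y)) with h | h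
  · exact key x y h hxy
  · exact (key y x h hxy.symm).symm

/-- The permutation that `f` induces on the subset `s` by first return. -/
noncomputable def firstReturn {D : Type*} [Finite D] (f : Equiv.Perm D) (s : Set D) :
    Equiv.Perm s :=
  Equiv.ofBijective (firstReturnFun f s)
    (Finite.injective_iff_bijective.mp (firstReturnFun_injective f s))

/-- A graph (loops and parallel edges allowed) cellularly embedded in a closed oriented surface,
given by its rotation system.  `D` is the set of darts (edges with a direction); `opp d` is the
reversal of `d`; `rot d` is the next dart around the tail of `d`.  Vertices, edges and faces are the
cycles of `rot`, `opp` and `rot * opp`.  A puncture of the surface is recorded as a face, the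
boundary face of the puncture. -/
structure EmbeddedGraph (D : Type*) where
  rot : Equiv.Perm D
  opp : Equiv.Perm D
  opp_opp : ∀ d, opp (opp d) = d
  opp_ne : ∀ d, opp d ≠ d

namespace EmbeddedGraph

variable {D : Type*}

/-- The next dart along the face on the chosen side of a dart. -/
def facePerm (G : EmbeddedGraph D) : Equiv.Perm D := G.rot * G.opp

def Vertex (G : EmbeddedGraph D) : Type _ := Quotient (Equiv.Perm.SameCycle.setoid G.rot)

def Edge (G : EmbeddedGraph D) : Type _ := Quotient (Equiv.Perm.SameCycle.setoid G.opp)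

def Face (G : EmbeddedGraph D) : Type _ := Quotient (Equiv.Perm.SameCycle.setoid G.facePerm)

/-- The tail of a dart. -/
def tail (G : EmbeddedGraph D) (d : D) : G.Vertex :=
  Quotient.mk (Equiv.Perm.SameCycle.setoid G.rot) d

/-- The head of a dart. -/
def head (G : EmbeddedGraph D) (d : D) : G.Vertex := G.tail (G.opp d)

/-- The edge that carries a dart. -/
def edge (G : EmbeddedGraph D) (d : D) : G.Edge :=
  Quotient.mk (Equiv.Perm.SameCycle.setoid G.opp) d

/-- The face on the chosen side of a dart; the face on the other side is `face (opp d)`. -/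
def face (G : EmbeddedGraph D) (d : D) : G.Face :=
  Quotient.mk (Equiv.Perm.SameCycle.setoid G.facePerm) d

theorem edge_opp (G : EmbeddedGraph D) (d : D) : G.edge (G.opp d) = G.edge d :=
  Quotient.sound (s := Equiv.Perm.SameCycle.setoid G.opp)
    (Equiv.Perm.sameCycle_apply_left.mpr (Equiv.Perm.SameCycle.refl _ _))

/-! ### Walks, cycles and paths -/

/-- `G.IsWalk u p v`: the list of darts `p` is a walk from `u` to `v`. -/
def IsWalk (G : EmbeddedGraph D) : G.Vertex → List D → G.Vertex → Prop
  | u, [], v => u = v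
  | u, d :: p, v => G.tail d = u ∧ IsWalk G (G.head d) p v

/-- A closed walk; this is a cycle in the topological sense. The constant walk is allowed. -/
def IsClosedWalk (G : EmbeddedGraph D) (c : List D) : Prop :=
  c = [] ∨ ∃ u, G.IsWalk u c u

/-- A simple cycle: a nonconstant closed walk that visits each vertex and each edge at most once. -/
def IsSimpleCycle (G : EmbeddedGraph D) (c : List D) : Prop :=
  c ≠ [] ∧ G.IsClosedWalk c ∧ (c.map G.tail).Nodup ∧ (c.map G.edge).Nodup

/-- A simple path from `u` to `v`. -/
def IsPath (G : EmbeddedGraph D) (u : G.Vertex) (p : List D) (v : G.Vertex) : Prop :=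
  G.IsWalk u p v ∧ (u :: p.map G.head).Nodup

/-- The set of edges of a walk. -/
def edgeSet (G : EmbeddedGraph D) (p : List D) : Set G.Edge := {e | e ∈ p.map G.edge}

open Classical in
/-- The `ℤ₂`-chain of a walk: the set of edges that it traverses an odd number of times. -/
def chain (G : EmbeddedGraph D) (p : List D) : Set G.Edge := {e | Odd ((p.map G.edge).count e)}

/-- The length of a walk, counted with multiplicity. -/
def walkWeight (G : EmbeddedGraph D) (w : G.Edge → ℝ) (p : List D) : ℝ :=
  (p.map fun d => w (G.edge d)).sum

/-- The weight of a set of edges. -/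
noncomputable def weight (G : EmbeddedGraph D) (w : G.Edge → ℝ) (S : Set G.Edge) : ℝ :=
  ∑ᶠ e ∈ S, w e

/-! ### Genus -/

def Connected (G : EmbeddedGraph D) : Prop :=
  Nonempty D ∧ ∀ u v : G.Vertex, ∃ p, G.IsWalk u p v

/-- The surface is connected and has genus `g`. -/
def HasGenus (G : EmbeddedGraph D) (g : ℕ) : Prop :=
  G.Connected ∧
    (Nat.card G.Vertex : ℤ) - (Nat.card G.Edge : ℤ) + (Nat.card G.Face : ℤ) = 2 - 2 * (g : ℤ)

/-! ### Homology and separating subgraphs -/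

/-- `∂ A`: the edges that have a face of `A` on one side and a face outside `A` on the other. -/
def boundary (G : EmbeddedGraph D) (A : Set G.Face) : Set G.Edge :=
  {e | ∃ d, G.edge d = e ∧ G.face d ∈ A ∧ G.face (G.opp d) ∉ A}

/-- A set of edges is null-homologous if it is the boundary of a union of faces. -/
def IsNullHomologous (G : EmbeddedGraph D) (X : Set G.Edge) : Prop :=
  ∃ A : Set G.Face, X = G.boundary A

/-- Two sets of edges are homologous if their symmetric difference is null-homologous. -/
def Homologous (G : EmbeddedGraph D) (X Y : Set G.Edge) : Prop :=
  G.IsNullHomologous (symmDiff X Y)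

/-- `S` is an `ab`-separating subgraph: it is the boundary of a union of faces that contains `a`
but not `b`. -/
def IsSeparating (G : EmbeddedGraph D) (a b : G.Face) (S : Set G.Edge) : Prop :=
  ∃ A : Set G.Face, a ∈ A ∧ b ∉ A ∧ S = G.boundary A

/-- `S` is an `ab`-separating subgraph of minimum weight. -/
def IsMinSeparating (G : EmbeddedGraph D) (w : G.Edge → ℝ) (a b : G.Face) (S : Set G.Edge) :
    Prop :=
  G.IsSeparating a b S ∧ ∀ S', G.IsSeparating a b S' → G.weight w S ≤ G.weight w S'

/-! ### Tight cycles and tight paths -/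

/-- A tight (simple) cycle: no closed walk in its `ℤ₂`-homology class is shorter. -/
def IsTightCycle (G : EmbeddedGraph D) (w : G.Edge → ℝ) (c : List D) : Prop :=
  G.IsSimpleCycle c ∧
    ∀ c', G.IsClosedWalk c' → G.Homologous (G.chain c) (G.chain c') →
      G.walkWeight w c ≤ G.walkWeight w c'

/-- A tight (simple) path from `x` to `y`: no walk from `x` to `y` in its `ℤ₂`-homology class is
shorter. -/
def IsTightPath (G : EmbeddedGraph D) (w : G.Edge → ℝ) (x : G.Vertex) (p : List D)
    (y : G.Vertex) : Prop :=
  G.IsPath x p y ∧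
    ∀ q, G.IsWalk x q y → G.Homologous (G.chain p) (G.chain q) →
      G.walkWeight w p ≤ G.walkWeight w q

/-! ### Crossing -/

/-- The darts of the edges outside `T`. -/
def dartsOff (G : EmbeddedGraph D) (T : Set G.Edge) : Set D := {d | G.edge d ∉ T}

/-- The darts of the edges in `T`. -/
def dartsOn (G : EmbeddedGraph D) (T : Set G.Edge) : Set D := {d | G.edge d ∈ T}

/-- Reversal on the darts of the edges outside `T`. -/
def oppOff (G : EmbeddedGraph D) (T : Set G.Edge) : Equiv.Perm (G.dartsOff T) where
  toFun d := ⟨G.opp d, fun h => d.2 (G.edge_opp d ▸ h)⟩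
  invFun d := ⟨G.opp d, fun h => d.2 (G.edge_opp d ▸ h)⟩
  left_inv d := Subtype.ext (G.opp_opp d)
  right_inv d := Subtype.ext (G.opp_opp d)

/-- The rotation of the embedded graph obtained by contracting the edges of `T`.  Contraction
removes the darts of `T` from the face cycles and keeps everything else, so a face cycle of the
contraction is a first-return cycle of `facePerm`, and the rotation is the face permutation composed
with reversal. -/
noncomputable def contractRot [Finite D] (G : EmbeddedGraph D) (T : Set G.Edge) :
    Equiv.Perm (G.dartsOff T) :=
  firstReturn G.facePerm (G.dartsOff T) * G.oppOff T

/-- `H₁` crosses `H₂`: after contracting some subset `T` of `H₁ ∩ H₂` there is a vertex around which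
darts `d, ρⁱ d, ρʲ d, ρᵏ d` occur in this cyclic order, alternating between `H₁` and `H₂`. -/
def Crosses [Finite D] (G : EmbeddedGraph D) (H₁ H₂ : Set G.Edge) : Prop :=
  ∃ T : Set G.Edge, T ⊆ H₁ ∩ H₂ ∧ ∃ (d : G.dartsOff T) (i j k : ℕ), 0 < i ∧ i < j ∧ j < k ∧
    (∀ m, 0 < m → m ≤ k → (G.contractRot T ^ m) d ≠ d) ∧
    G.edge d ∈ H₁ ∧ G.edge ((G.contractRot T ^ i) d) ∈ H₂ ∧
    G.edge ((G.contractRot T ^ j) d) ∈ H₁ ∧ G.edge ((G.contractRot T ^ k) d) ∈ H₂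

/-! ### Cutting along a set of edges -/

/-- The darts after cutting along `X`.  An edge of `X` with darts `d`, `opp d` is replaced by two
copies.  `inl d` is the dart `d`, still on its old face; it belongs to one copy.  `inr d` is the
dart with the same direction as `d` on the other copy, and it lies on a boundary face. -/
abbrev CutDart (G : EmbeddedGraph D) (X : Set G.Edge) : Type _ := D ⊕ G.dartsOn X

theorem opp_mem_dartsOn (G : EmbeddedGraph D) (X : Set G.Edge) {d : D} (h : d ∈ G.dartsOn X) :
    G.opp d ∈ G.dartsOn X :=
  show G.edge (G.opp d) ∈ X from (G.edge_opp d).symm ▸ (h : G.edge d ∈ X)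

/-- The dart of `G` of which a dart of the cut graph is a copy. -/
def cutDartProj (G : EmbeddedGraph D) (X : Set G.Edge) : G.CutDart X → D
  | Sum.inl d => d
  | Sum.inr d => d

open Classical in
/-- Reversal after cutting: `inl d` and `inr (opp d)` form one copy of an edge of `X`. -/
noncomputable def cutOppFun (G : EmbeddedGraph D) (X : Set G.Edge) : G.CutDart X → G.CutDart X
  | Sum.inl d =>
    if h : d ∈ G.dartsOn X then Sum.inr ⟨G.opp d, G.opp_mem_dartsOn X h⟩ else Sum.inl (G.opp d)
  | Sum.inr d => Sum.inl (G.opp d)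

theorem cutOppFun_involutive (G : EmbeddedGraph D) (X : Set G.Edge) :
    Function.Involutive (G.cutOppFun X) := by
  rintro (d | ⟨d, hd⟩)
  · by_cases h : d ∈ G.dartsOn X
    · simp [cutOppFun, h, G.opp_opp]
    · have h' : G.opp d ∉ G.dartsOn X := fun h' => h (G.opp_opp d ▸ G.opp_mem_dartsOn X h')
      simp [cutOppFun, h, h', G.opp_opp]
  · have h' := G.opp_mem_dartsOn X hd
    simp [cutOppFun, h', G.opp_opp]

open Classical in
/-- The rotation after cutting.  If `x, y` are consecutive darts of `X` around a vertex of `G`, then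
the sector from `x` to `y` becomes a vertex with rotation `inr x, inl (rot x), …, inl y`. -/
noncomputable def cutRotFun [Finite D] (G : EmbeddedGraph D) (X : Set G.Edge) :
    G.CutDart X → G.CutDart X
  | Sum.inl d =>
    if h : d ∈ G.dartsOn X then Sum.inr (firstReturn G.rot⁻¹ (G.dartsOn X) ⟨d, h⟩)
    else Sum.inl (G.rot d)
  | Sum.inr d => Sum.inl (G.rot d)

theorem cutRotFun_injective [Finite D] (G : EmbeddedGraph D) (X : Set G.Edge) :
    Function.Injective (G.cutRotFun X) := by
  rintro (d | ⟨d, hd⟩) (e | ⟨e, he⟩) h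
  · by_cases h1 : d ∈ G.dartsOn X <;> by_cases h2 : e ∈ G.dartsOn X
    · simp only [cutRotFun, h1, h2, dite_true] at h
      have h3 := (firstReturn G.rot⁻¹ (G.dartsOn X)).injective (Sum.inr_injective h)
      exact congrArg Sum.inl (congrArg Subtype.val h3)
    · simp [cutRotFun, h1, h2] at h
    · simp [cutRotFun, h1, h2] at h
    · simp only [cutRotFun, h1, h2, dite_false] at h
      exact congrArg Sum.inl (G.rot.injective (Sum.inl_injective h))
  · by_cases h1 : d ∈ G.dartsOn X
    · simp [cutRotFun, h1] at h
    · simp only [cutRotFun, h1, dite_false] at h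
      have h3 := G.rot.injective (Sum.inl_injective h)
      exact absurd (h3 ▸ he) h1
  · by_cases h1 : e ∈ G.dartsOn X
    · simp [cutRotFun, h1] at h
    · simp only [cutRotFun, h1, dite_false] at h
      have h3 := G.rot.injective (Sum.inl_injective h)
      exact absurd (h3 ▸ hd) h1
  · have h3 := G.rot.injective (Sum.inl_injective h)
    exact congrArg Sum.inr (Subtype.ext h3)

/-- The embedded graph obtained by cutting `G` along the edges of `X`, the resulting punctures being
recorded as boundary faces. -/
noncomputable def cut [Finite D] (G : EmbeddedGraph D) (X : Set G.Edge) :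
    EmbeddedGraph (G.CutDart X) where
  rot := Equiv.ofBijective (G.cutRotFun X)
    (Finite.injective_iff_bijective.mp (G.cutRotFun_injective X))
  opp := (G.cutOppFun_involutive X).toPerm
  opp_opp := G.cutOppFun_involutive X
  opp_ne := by
    rintro (d | ⟨d, hd⟩)
    · by_cases h : d ∈ G.dartsOn X
      · simp [cutOppFun, h]
      · simpa [cutOppFun, h] using G.opp_ne d
    · simp [cutOppFun]

theorem cutDartProj_opp [Finite D] (G : EmbeddedGraph D) (X : Set G.Edge) (x : G.CutDart X) :
    G.cutDartProj X ((G.cut X).opp x) = G.opp (G.cutDartProj X x) := by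
  rcases x with d | ⟨d, hd⟩
  · by_cases h : d ∈ G.dartsOn X <;> simp [cut, cutOppFun, cutDartProj, h]
  · simp [cut, cutOppFun, cutDartProj]

theorem cut_facePerm_inl [Finite D] (G : EmbeddedGraph D) (X : Set G.Edge) (d : D) :
    (G.cut X).facePerm (Sum.inl d) = Sum.inl (G.facePerm d) := by
  by_cases h : d ∈ G.dartsOn X
  · simp [facePerm, cut, cutOppFun, cutRotFun, h]
  · have h' : G.opp d ∉ G.dartsOn X := fun h' => h (G.opp_opp d ▸ G.opp_mem_dartsOn X h')
    simp [facePerm, cut, cutOppFun, cutRotFun, h, h']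

/-- A map that intertwines two permutations preserves the relation of lying on one cycle. -/
theorem sameCycle_map {A B : Type*} (p : Equiv.Perm A) (q : Equiv.Perm B) (t : A → B)
    (h : ∀ x, t (p x) = q (t x)) {x y : A} (hxy : p.SameCycle x y) : q.SameCycle (t x) (t y) := by
  have hn : ∀ (n : ℕ) (z : A), t ((p ^ n) z) = (q ^ n) (t z) := by
    intro n
    induction n with
    | zero => intro z; rfl
    | succ n ih => intro z; rw [pow_succ, pow_succ, Equiv.Perm.mul_apply, Equiv.Perm.mul_apply,
        ih, h]
  obtain ⟨i, rfl⟩ := hxy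
  obtain ⟨n, rfl | rfl⟩ := i.eq_nat_or_neg
  · exact ⟨n, by rw [zpow_natCast, zpow_natCast, hn]⟩
  · refine ⟨-n, ?_⟩
    rw [zpow_neg, zpow_neg, zpow_natCast, zpow_natCast, Equiv.Perm.inv_eq_iff_eq, ← hn]
    exact congrArg t (Equiv.apply_symm_apply (p ^ n) x).symm

/-- The edge of `G` of which an edge of the cut graph is a copy. -/
noncomputable def cutEdgeProj [Finite D] (G : EmbeddedGraph D) (X : Set G.Edge) :
    (G.cut X).Edge → G.Edge :=
  Quotient.map' (s₁ := Equiv.Perm.SameCycle.setoid (G.cut X).opp)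
    (s₂ := Equiv.Perm.SameCycle.setoid G.opp) (G.cutDartProj X)
    fun _ _ h => sameCycle_map _ _ _ (G.cutDartProj_opp X) h

/-- A face of `G`, as a face of the cut graph. -/
noncomputable def cutFace [Finite D] (G : EmbeddedGraph D) (X : Set G.Edge) :
    G.Face → (G.cut X).Face :=
  Quotient.map' (s₁ := Equiv.Perm.SameCycle.setoid G.facePerm)
    (s₂ := Equiv.Perm.SameCycle.setoid (G.cut X).facePerm) (Sum.inl : D → G.CutDart X)
    fun _ _ h => sameCycle_map _ _ _ (fun d => (G.cut_facePerm_inl X d).symm) h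

/-- A boundary face that arises by cutting along `X`. -/
def IsCutBoundaryFace [Finite D] (G : EmbeddedGraph D) (X : Set G.Edge) (f : (G.cut X).Face) :
    Prop :=
  f ∉ Set.range (G.cutFace X)

/-- The vertex `v` lies on the face `f`. -/
def Incident (G : EmbeddedGraph D) (v : G.Vertex) (f : G.Face) : Prop :=
  ∃ d, G.tail d = v ∧ G.face d = f

/-- The set `S` of edges of `G` is a minimum `ab`-separating subgraph of the graph cut along `X`,
whose edges inherit the weights of `G`: choosing one copy of each edge of `S` in a suitable way
gives a minimum `ab`-separating subgraph there. (Only the edges of `S ∩ X` have two copies.) -/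
def IsMinSeparatingInCut [Finite D] (G : EmbeddedGraph D) (w : G.Edge → ℝ) (X : Set G.Edge)
    (a b : G.Face) (S : Set G.Edge) : Prop :=
  ∃ S' : Set (G.cut X).Edge, Set.BijOn (G.cutEdgeProj X) S' S ∧
    (G.cut X).IsMinSeparating (w ∘ G.cutEdgeProj X) (G.cutFace X a) (G.cutFace X b) S'

/-- The set of edges of `G` traversed by a walk in the graph cut along `X`. -/
def cutWalkEdgeSet [Finite D] (G : EmbeddedGraph D) (X : Set G.Edge) (p : List (G.CutDart X)) :
    Set G.Edge :=
  G.cutEdgeProj X '' (G.cut X).edgeSet p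

/-- A tight cycle-path pair: `C` is a tight cycle of `G`, `P` is a tight path of the graph cut along
`C` that leads from one copy of `C` to the other, and cutting along `C ∪ P` lowers the genus by one
and creates exactly one boundary face. -/
def IsTightCyclePathPair [Finite D] (G : EmbeddedGraph D) (w : G.Edge → ℝ) (C : List D)
    (P : List (G.CutDart (G.edgeSet C))) : Prop :=
  G.IsTightCycle w C ∧
  (∃ (f₁ f₂ : (G.cut (G.edgeSet C)).Face) (x y : (G.cut (G.edgeSet C)).Vertex),
    G.IsCutBoundaryFace (G.edgeSet C) f₁ ∧ G.IsCutBoundaryFace (G.edgeSet C) f₂ ∧ f₁ ≠ f₂ ∧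
    (G.cut (G.edgeSet C)).Incident x f₁ ∧ (G.cut (G.edgeSet C)).Incident y f₂ ∧
    (G.cut (G.edgeSet C)).IsTightPath (w ∘ G.cutEdgeProj (G.edgeSet C)) x P y) ∧
  (∃ g : ℕ, G.HasGenus (g + 1) ∧
    (G.cut (G.edgeSet C ∪ G.cutWalkEdgeSet (G.edgeSet C) P)).HasGenus g) ∧
  ∃! f, G.IsCutBoundaryFace (G.edgeSet C ∪ G.cutWalkEdgeSet (G.edgeSet C) P) f

end EmbeddedGraph

set_option linter.unusedSectionVars false

/-! Write S = ∂A with a in A and b outside A, and orient every edge of S so that A lies on its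
chosen side (`rim`). At each vertex as many rim darts leave as enter, so the rim contains a directed
simple cycle c, and if c is not all of S then the rest of the rim contains a second, disjoint one.

If S is not a single cycle, one of these two cycles has at most half the weight of S. Call it C. It
is tight (`isTightCycle_of_light`): a closed walk c' homologous to C with C ⊕ c' = ∂B gives a
separating subgraph, namely S ⊕ ∂B if B does not separate a from b and ∂B if it does, and minimality
of S bounds the weight of C in both cases. Cutting along C leaves S \ C minimum
(`isMinSeparatingInCut_diff`), which is alternative (1).

If S is a single cycle, alternative (2) holds. As the genus is positive, the Euler characteristic
forces an even edge set that bounds no set of faces (`exists_even_not_null`). Splitting it along S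
yields such a set on one closed side of S (`exists_even_side_not_null`); exchanging a and b if
needed, this is the side of A. Let C be a lightest non-null-homologous simple cycle in this side,
and P a lightest path in this side of the graph cut along C that joins the two copies of C. Such a
path exists because otherwise C would be null-homologous (`exists_walk_side`).

Both are tight in the whole surface by an exchange argument: since S is minimum, whatever leaves the
side of A can be pushed back into it without gaining weight (`weight_boundary_inter_side_le`,
`exists_push`). Neither crosses S, because all their edges touch faces of A (`not_crosses_of_side`).
The graph C ∪ P has one more edge than vertices, and cutting along it makes a single boundary face
(`IsHandle.ncard_dartsOn`, `IsHandle.face_eq`), so the Euler characteristic rises by two and the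
genus drops by one. Adding the new boundary face to A keeps S minimum
(`isMinSeparatingInCut_of_side`). -/

/-! ### First-return permutations -/

theorem Equiv.Perm.SameCycle.map_eq {D β : Type*} {f : Equiv.Perm D} (φ : D → β)
    (h : ∀ d, φ (f d) = φ d) {x y : D} (hxy : f.SameCycle x y) : φ x = φ y := by
  have := EmbeddedGraph.sameCycle_map f (1 : Equiv.Perm β) φ (fun d => by simp [h]) hxy
  simpa using this

theorem firstReturn_spec {D : Type*} [Finite D] (f : Equiv.Perm D) (s : Set D) (x : s) :
    ∃ n : ℕ, (firstReturn f s x : D) = (f ^ (n + 1)) (x : D) ∧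
      ∀ m < n, (f ^ (m + 1)) (x : D) ∉ s := by
  classical
  exact ⟨Nat.find (firstReturn_exists f s x), rfl,
    fun m hm => Nat.find_min (firstReturn_exists f s x) hm⟩

theorem firstReturn_sameCycle {D : Type*} [Finite D] (f : Equiv.Perm D) (s : Set D) (x : s) :
    f.SameCycle (x : D) (firstReturn f s x) := by
  obtain ⟨n, hn, -⟩ := firstReturn_spec f s x
  rw [hn]
  exact Equiv.Perm.sameCycle_pow_right.2 (Equiv.Perm.SameCycle.refl _ _)

/-- The orbit of `x` then has period n + 1, and the iterates strictly between two visits to `x` miss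
`s`. -/
theorem eq_of_firstReturn_eq_self {D : Type*} [Finite D] (f : Equiv.Perm D) (s : Set D) (x : s)
    (hx : firstReturn f s x = x) {y : D} (hy : y ∈ s) (hxy : f.SameCycle (x : D) y) :
    y = x := by
  obtain ⟨n, hn, hmin⟩ := firstReturn_spec f s x
  rw [hx] at hn
  obtain ⟨k, rfl⟩ := hxy.exists_nat_pow_eq
  have hp : ∀ j : ℕ, (f ^ ((n + 1) * j)) (x : D) = x := by
    intro j
    induction j with
    | zero => simp
    | succ j ih => rw [Nat.mul_succ, pow_add, Equiv.Perm.mul_apply, ← hn, ih]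
  have hk : (f ^ k) (x : D) = (f ^ (k % (n + 1))) (x : D) := by
    conv_lhs => rw [← Nat.mod_add_div k (n + 1)]
    rw [pow_add, Equiv.Perm.mul_apply, hp]
  rw [hk] at hy ⊢
  have hlt := Nat.mod_lt k (Nat.succ_pos n)
  rcases hr : k % (n + 1) with _ | r
  · simp
  · rw [hr] at hy hlt
    exact absurd hy (hmin r (by omega))

/-! ### Parity of finite sets -/

theorem ncard_symmDiff_parity {α : Type*} [Finite α] (s t : Set α) :
    ((symmDiff s t).ncard : ZMod 2) = s.ncard + t.ncard := by
  have h1 := Set.ncard_inter_add_ncard_sdiff_eq_ncard s t s.toFinite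
  have h2 := Set.ncard_inter_add_ncard_sdiff_eq_ncard t s t.toFinite
  have h3 : (symmDiff s t).ncard = (s \ t).ncard + (t \ s).ncard := by
    rw [Set.symmDiff_def]
    exact Set.ncard_union_eq (Set.disjoint_left.2 fun x hx hx' => hx.2 hx'.1)
      (Set.toFinite _) (Set.toFinite _)
  rw [Set.inter_comm] at h2
  rw [h3, ← h1, ← h2]
  push_cast
  linear_combination (-((s ∩ t).ncard : ZMod 2)) * (CharTwo.two_eq_zero (R := ZMod 2))

theorem ncard_parity_of_involution {α : Type*} [Finite α] (s : Set α) (f : α → α)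
    (hf : ∀ x ∈ s, f x ∈ s) (hff : ∀ x, f (f x) = x) (hne : ∀ x, f x ≠ x) :
    (s.ncard : ZMod 2) = 0 := by
  classical
  have := Fintype.ofFinite α
  rw [Set.ncard_eq_toFinset_card', Finset.cast_card]
  exact Finset.sum_involution (fun x _ => f x) (fun _ _ => CharTwo.add_self_eq_zero _)
    (fun x _ _ => hne x) (fun x hx => by simpa using hf x (by simpa using hx)) (fun x _ => hff x)

/-! ### Incidences, weights, and chains modulo two -/

namespace EmbeddedGraph

variable {D : Type*}

instance (G : EmbeddedGraph D) [Finite D] : Finite G.Vertex :=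
  inferInstanceAs (Finite (Quotient _))
instance (G : EmbeddedGraph D) [Finite D] : Finite G.Edge :=
  inferInstanceAs (Finite (Quotient _))
instance (G : EmbeddedGraph D) [Finite D] : Finite G.Face :=
  inferInstanceAs (Finite (Quotient _))

section Basic

variable (G : EmbeddedGraph D)

theorem tail_eq_iff {d d' : D} : G.tail d = G.tail d' ↔ G.rot.SameCycle d d' :=
  ⟨fun h => Quotient.exact (s := Equiv.Perm.SameCycle.setoid G.rot) h,
    fun h => Quotient.sound (s := Equiv.Perm.SameCycle.setoid G.rot) h⟩

theorem face_eq_iff {d d' : D} : G.face d = G.face d' ↔ G.facePerm.SameCycle d d' :=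
  ⟨fun h => Quotient.exact (s := Equiv.Perm.SameCycle.setoid G.facePerm) h,
    fun h => Quotient.sound (s := Equiv.Perm.SameCycle.setoid G.facePerm) h⟩

theorem edge_eq_iff {d d' : D} : G.edge d = G.edge d' ↔ d' = d ∨ d' = G.opp d := by
  refine ⟨fun h => ?_, ?_⟩
  · have h1 : G.opp.SameCycle d d' :=
      Quotient.exact (s := Equiv.Perm.SameCycle.setoid G.opp) h
    have h2 := h1.map_eq (fun x => x = d ∨ x = G.opp d) (fun x => propext
      ⟨by
        rintro (h | h)
        · right; rw [← h, G.opp_opp]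
        · left; exact G.opp.injective h, by
        rintro (h | h)
        · right; rw [h]
        · left; rw [h, G.opp_opp]⟩)
    exact (iff_of_eq h2).1 (Or.inl rfl)
  · rintro (rfl | rfl)
    · rfl
    · exact (G.edge_opp d).symm

theorem exists_tail (v : G.Vertex) : ∃ d, G.tail d = v := Quotient.exists_rep v
theorem exists_edge (e : G.Edge) : ∃ d, G.edge d = e := Quotient.exists_rep e
theorem exists_face (f : G.Face) : ∃ d, G.face d = f := Quotient.exists_rep f

theorem tail_rot (d : D) : G.tail (G.rot d) = G.tail d :=
  G.tail_eq_iff.2 (Equiv.Perm.sameCycle_apply_left.2 (Equiv.Perm.SameCycle.refl _ _))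

theorem tail_rot_pow (n : ℕ) (d : D) : G.tail ((G.rot ^ n) d) = G.tail d :=
  G.tail_eq_iff.2 (Equiv.Perm.sameCycle_pow_left.2 (Equiv.Perm.SameCycle.refl _ _))

theorem face_facePerm (d : D) : G.face (G.facePerm d) = G.face d :=
  G.face_eq_iff.2 (Equiv.Perm.sameCycle_apply_left.2 (Equiv.Perm.SameCycle.refl _ _))

theorem facePerm_apply (d : D) : G.facePerm d = G.rot (G.opp d) := rfl

/-- The sector between `d` and `rot d` belongs to one face. This turns arguments around a vertex
into arguments about faces. -/
theorem face_rot (d : D) : G.face (G.rot d) = G.face (G.opp d) := by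
  rw [← G.face_facePerm (G.opp d), facePerm_apply, G.opp_opp]

theorem tail_facePerm (d : D) : G.tail (G.facePerm d) = G.head d := G.tail_rot _

theorem head_opp (d : D) : G.head (G.opp d) = G.tail d := by rw [head, G.opp_opp]

theorem tail_opp (d : D) : G.tail (G.opp d) = G.head d := rfl

/-- A property of darts that is invariant along faces, as a set of faces. -/
def faceSet (p : D → Prop) : Set G.Face := {f | ∃ d, G.face d = f ∧ p d}

variable {G}

theorem face_mem_faceSet {p : D → Prop} (hp : ∀ d, p (G.facePerm d) ↔ p d) {d : D} :
    G.face d ∈ G.faceSet p ↔ p d := by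
  refine ⟨fun ⟨d', h, h'⟩ => ?_, fun h => ⟨d, rfl, h⟩⟩
  exact (iff_of_eq ((G.face_eq_iff.1 h).map_eq p fun d => propext (hp d))).1 h'

theorem edge_mem_boundary {A : Set G.Face} {d : D} :
    G.edge d ∈ G.boundary A ↔ ¬ (G.face d ∈ A ↔ G.face (G.opp d) ∈ A) := by
  constructor
  · rintro ⟨d', h, h1, h2⟩
    rcases G.edge_eq_iff.1 h with rfl | rfl
    · tauto
    · rw [G.opp_opp]; tauto
  · intro h
    by_cases h1 : G.face d ∈ A
    · exact ⟨d, rfl, h1, by tauto⟩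
    · exact ⟨G.opp d, G.edge_opp d, by tauto, by rwa [G.opp_opp]⟩

theorem edgeSet_ext {X Y : Set G.Edge} (h : ∀ d, G.edge d ∈ X ↔ G.edge d ∈ Y) : X = Y := by
  ext e
  obtain ⟨d, rfl⟩ := G.exists_edge e
  exact h d

theorem boundary_compl (A : Set G.Face) : G.boundary Aᶜ = G.boundary A :=
  edgeSet_ext fun d => by simp only [edge_mem_boundary, Set.mem_compl_iff]; tauto

theorem boundary_symmDiff (A B : Set G.Face) :
    G.boundary (symmDiff A B) = symmDiff (G.boundary A) (G.boundary B) :=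
  edgeSet_ext fun d => by simp only [edge_mem_boundary, Set.mem_symmDiff]; tauto

theorem IsNullHomologous.symmDiff {X Y : Set G.Edge} (hX : G.IsNullHomologous X)
    (hY : G.IsNullHomologous Y) : G.IsNullHomologous (symmDiff X Y) := by
  obtain ⟨A, rfl⟩ := hX
  obtain ⟨B, rfl⟩ := hY
  exact ⟨_, (boundary_symmDiff A B).symm⟩

theorem IsSeparating.symm {a b : G.Face} {S : Set G.Edge} (h : G.IsSeparating a b S) :
    G.IsSeparating b a S := by
  obtain ⟨A, ha, hb, rfl⟩ := h
  exact ⟨Aᶜ, hb, fun h => h ha, (boundary_compl A).symm⟩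

theorem IsMinSeparating.symm {w : G.Edge → ℝ} {a b : G.Face} {S : Set G.Edge}
    (h : G.IsMinSeparating w a b S) : G.IsMinSeparating w b a S :=
  ⟨h.1.symm, fun S' h' => h.2 S' h'.symm⟩

end Basic

/-! ### Weights -/

section Weight

variable [Finite D] {G : EmbeddedGraph D} {w : G.Edge → ℝ}

theorem weight_nonneg (hw : ∀ e, 0 ≤ w e) (X : Set G.Edge) : 0 ≤ G.weight w X :=
  finsum_nonneg fun e => finsum_nonneg fun _ => hw e

theorem weight_union {X Y : Set G.Edge} (h : Disjoint X Y) :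
    G.weight w (X ∪ Y) = G.weight w X + G.weight w Y :=
  finsum_mem_union h X.toFinite Y.toFinite

theorem weight_inter_add_diff (X Y : Set G.Edge) :
    G.weight w (X ∩ Y) + G.weight w (X \ Y) = G.weight w X :=
  finsum_mem_inter_add_sdiff Y X.toFinite

theorem weight_mono (hw : ∀ e, 0 ≤ w e) {X Y : Set G.Edge} (h : X ⊆ Y) :
    G.weight w X ≤ G.weight w Y := by
  rw [← weight_inter_add_diff Y X, Set.inter_eq_right.2 h]
  linarith [weight_nonneg hw (Y \ X)]

theorem weight_union_le (hw : ∀ e, 0 ≤ w e) (X Y : Set G.Edge) :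
    G.weight w (X ∪ Y) ≤ G.weight w X + G.weight w Y := by
  rw [← Set.union_sdiff_self, weight_union Set.disjoint_sdiff_right]
  linarith [weight_mono hw (Set.sdiff_subset : Y \ X ⊆ Y)]

theorem weight_symmDiff_le (hw : ∀ e, 0 ≤ w e) (X Y : Set G.Edge) :
    G.weight w (symmDiff X Y) ≤ G.weight w X + G.weight w Y :=
  (weight_mono hw symmDiff_le_sup).trans (weight_union_le hw X Y)

theorem weight_singleton (e : G.Edge) : G.weight w {e} = w e := finsum_mem_singleton

variable {D' : Type*} [Finite D'] {H : EmbeddedGraph D'}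

theorem weight_image_of_injOn {f : H.Edge → G.Edge} {Y : Set H.Edge} (hf : Set.InjOn f Y) :
    G.weight w (f '' Y) = H.weight (w ∘ f) Y :=
  finsum_mem_image hf

theorem weight_image_le (hw : ∀ e, 0 ≤ w e) (f : H.Edge → G.Edge) (Y : Set H.Edge) :
    G.weight w (f '' Y) ≤ H.weight (w ∘ f) Y := by
  obtain ⟨Z, hZ, hb⟩ := Set.SurjOn.exists_bijOn_subset (Set.surjOn_image f Y)
  rw [← hb.image_eq, weight_image_of_injOn hb.injOn]
  exact weight_mono (fun e => hw (f e)) hZ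

end Weight

/-! ### Chains of walks and degrees modulo two -/

section Walk

variable (G : EmbeddedGraph D)

theorem chain_nil : G.chain [] = ∅ := by ext e; simp [chain]

theorem chain_cons (d : D) (p : List D) : G.chain (d :: p) = symmDiff {G.edge d} (G.chain p) := by
  classical
  ext e
  simp only [chain, List.map_cons, List.count_cons, Set.mem_ofPred_eq, Set.mem_symmDiff,
    Set.mem_singleton_iff, beq_iff_eq]
  by_cases h : G.edge d = e
  · simp [h, Nat.odd_add_one]
  · simp [h, Ne.symm h]

theorem chain_subset (p : List D) : G.chain p ⊆ G.edgeSet p := by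
  classical
  intro e he
  simp only [chain, Set.mem_ofPred_eq] at he
  exact List.count_pos_iff.1 he.pos

theorem chain_eq_edgeSet {p : List D} (h : (p.map G.edge).Nodup) : G.chain p = G.edgeSet p := by
  classical
  refine (G.chain_subset p).antisymm fun e he => ?_
  have : (p.map G.edge).count e = 1 := List.count_eq_one_of_mem h he
  simp only [chain, Set.mem_ofPred_eq]
  convert odd_one

theorem edgeSet_nil : G.edgeSet [] = ∅ := by ext; simp [edgeSet]

theorem edgeSet_cons (d : D) (p : List D) : G.edgeSet (d :: p) = insert (G.edge d) (G.edgeSet p) := by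
  ext e; simp [edgeSet, eq_comm]

theorem mem_edgeSet {p : List D} {e : G.Edge} : e ∈ G.edgeSet p ↔ ∃ d ∈ p, G.edge d = e := by
  simp [edgeSet]

variable {G}

theorem weight_chain_le [Finite D] {w : G.Edge → ℝ} (hw : ∀ e, 0 ≤ w e) (p : List D) :
    G.weight w (G.chain p) ≤ G.walkWeight w p := by
  induction p with
  | nil => simp [chain_nil, weight, walkWeight]
  | cons d p ih =>
    rw [chain_cons]
    have := weight_symmDiff_le hw {G.edge d} (G.chain p)
    rw [weight_singleton] at this
    simp only [walkWeight, List.map_cons, List.sum_cons] at ih ⊢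
    linarith

theorem walkWeight_eq [Finite D] {w : G.Edge → ℝ} {p : List D} (h : (p.map G.edge).Nodup) :
    G.walkWeight w p = G.weight w (G.edgeSet p) := by
  induction p with
  | nil => simp [edgeSet_nil, weight, walkWeight]
  | cons d p ih =>
    rw [List.map_cons, List.nodup_cons] at h
    rw [edgeSet_cons, Set.insert_eq, weight_union (Set.disjoint_singleton_left.2 h.1),
      weight_singleton, ← ih h.2]
    simp [walkWeight]

theorem isWalk_append {u v : G.Vertex} {p q : List D} :
    G.IsWalk u (p ++ q) v ↔ ∃ x, G.IsWalk u p x ∧ G.IsWalk x q v := by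
  induction p generalizing u with
  | nil => simp [IsWalk]
  | cons d p ih =>
    simp only [List.cons_append, IsWalk, ih]
    constructor
    · rintro ⟨h, x, h1, h2⟩; exact ⟨x, ⟨h, h1⟩, h2⟩
    · rintro ⟨x, ⟨h, h1⟩, h2⟩; exact ⟨h, x, h1, h2⟩

/-- The indicator of a vertex, modulo two. -/
noncomputable def pt (u : G.Vertex) : G.Vertex → ZMod 2 := by
  classical exact Pi.single u 1

variable (G) in
/-- The degree of each vertex in a set of edges, modulo two. -/
noncomputable def deg (Y : Set G.Edge) (v : G.Vertex) : ZMod 2 :=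
  ({d | G.tail d = v ∧ G.edge d ∈ Y} : Set D).ncard

theorem deg_empty : G.deg ∅ = 0 := by
  funext v; simp [deg]

variable [Finite D]

theorem deg_symmDiff (X Y : Set G.Edge) : G.deg (symmDiff X Y) = G.deg X + G.deg Y := by
  funext v
  rw [Pi.add_apply, deg, deg, deg, ← ncard_symmDiff_parity]
  congr 2
  ext d
  simp only [Set.mem_ofPred_eq, Set.mem_symmDiff]
  tauto

/-- The darts of ∂A at a vertex are the symmetric difference of those with A on the chosen side and
those with A on the other side, and `rot` maps the second set bijectively onto the first. -/
theorem deg_boundary (A : Set G.Face) : G.deg (G.boundary A) = 0 := by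
  funext v
  have h : ({d | G.tail d = v ∧ G.edge d ∈ G.boundary A} : Set D) =
      symmDiff {d | G.tail d = v ∧ G.face d ∈ A} {d | G.tail d = v ∧ G.face (G.opp d) ∈ A} := by
    ext d
    simp only [Set.mem_ofPred_eq, Set.mem_symmDiff, edge_mem_boundary]
    tauto
  have h2 : (G.rot '' {d | G.tail d = v ∧ G.face (G.opp d) ∈ A}) =
      {d | G.tail d = v ∧ G.face d ∈ A} := by
    ext d
    constructor
    · rintro ⟨x, ⟨h1, h2⟩, rfl⟩
      exact ⟨by rw [tail_rot, h1], by rwa [face_rot]⟩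
    · rintro ⟨h1, h2⟩
      refine ⟨G.rot.symm d, ⟨?_, ?_⟩, by simp⟩
      · rw [← G.tail_rot]; simpa using h1
      · rw [← G.face_rot]; simpa using h2
  rw [deg, h, ncard_symmDiff_parity, ← h2, Set.ncard_image_of_injective _ G.rot.injective]
  exact CharTwo.add_self_eq_zero _

/-- Degrees count darts, not edges, so a loop counts twice and both sides vanish for it. -/
theorem deg_singleton (d : D) : G.deg {G.edge d} = pt (G.tail d) + pt (G.head d) := by
  classical
  funext v
  have h : ({x | G.tail x = v ∧ G.edge x ∈ ({G.edge d} : Set G.Edge)} : Set D) =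
      symmDiff {x | x = d ∧ G.tail d = v} {x | x = G.opp d ∧ G.head d = v} := by
    ext x
    simp only [Set.mem_ofPred_eq, Set.mem_symmDiff, Set.mem_singleton_iff]
    rw [eq_comm (a := G.edge x), edge_eq_iff]
    have := G.opp_ne d
    constructor
    · rintro ⟨h, rfl | rfl⟩
      · exact Or.inl ⟨⟨rfl, h⟩, fun h' => this h'.1.symm⟩
      · exact Or.inr ⟨⟨rfl, h⟩, fun h' => this h'.1⟩
    · rintro (⟨⟨rfl, h⟩, -⟩ | ⟨⟨rfl, h⟩, -⟩)
      · exact ⟨h, Or.inl rfl⟩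
      · exact ⟨h, Or.inr rfl⟩
  have h1 : ∀ (x : D) (u : G.Vertex),
      ((({y | y = x ∧ u = v} : Set D).ncard : ℕ) : ZMod 2) = pt u v := by
    intro x u
    by_cases huv : u = v
    · subst huv; simp [pt]
    · simp [pt, huv, Ne.symm huv]
  rw [deg, h, ncard_symmDiff_parity, h1, h1, Pi.add_apply]

theorem pt_add_self (u : G.Vertex) : pt u + pt u = 0 := by
  funext v; exact CharTwo.add_self_eq_zero _

theorem deg_chain {u v : G.Vertex} {p : List D} (h : G.IsWalk u p v) :
    G.deg (G.chain p) = pt u + pt v := by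
  induction p generalizing u with
  | nil => cases h; rw [chain_nil, deg_empty, pt_add_self]
  | cons d p ih =>
    obtain ⟨rfl, h⟩ := h
    rw [chain_cons, deg_symmDiff, deg_singleton, ih h, add_assoc, ← add_assoc (pt (G.head d)),
      pt_add_self, zero_add]

theorem deg_chain_closed {p : List D} (h : G.IsClosedWalk p) : G.deg (G.chain p) = 0 := by
  rcases h with rfl | ⟨u, h⟩
  · rw [chain_nil, deg_empty]
  · rw [deg_chain h, pt_add_self]

/-- The handshake lemma on a set `K` of vertices that is closed under the edges of `Y`. -/
theorem sum_deg_eq_zero (Y : Set G.Edge) (K : Finset G.Vertex)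
    (hK : ∀ d, G.edge d ∈ Y → G.tail d ∈ K → G.head d ∈ K) : ∑ v ∈ K, G.deg Y v = 0 := by
  classical
  have := Fintype.ofFinite D
  have h : ∑ v ∈ K, G.deg Y v = (({d | G.tail d ∈ K ∧ G.edge d ∈ Y} : Set D).ncard : ZMod 2) := by
    rw [Set.ncard_eq_toFinset_card', Finset.card_eq_sum_card_fiberwise (f := G.tail) (t := K),
      Nat.cast_sum]
    · refine Finset.sum_congr rfl fun v hv => ?_
      rw [deg, Set.ncard_eq_toFinset_card']
      congr 2
      ext d
      simp only [Set.mem_toFinset, Set.mem_ofPred_eq, Finset.mem_filter]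
      constructor
      · rintro ⟨rfl, h⟩; exact ⟨⟨hv, h⟩, rfl⟩
      · rintro ⟨⟨-, h⟩, rfl⟩; exact ⟨rfl, h⟩
    · intro d hd
      simp at hd
      exact hd.1
  rw [h]
  exact ncard_parity_of_involution _ G.opp
    (fun d hd => ⟨hK d hd.2 hd.1, by rw [edge_opp]; exact hd.2⟩) G.opp_opp G.opp_ne

end Walk

end EmbeddedGraph

/-! ### Simple cycles and paths inside edge sets, and ℤ₂-homology -/

namespace EmbeddedGraph

variable {D : Type*} {G : EmbeddedGraph D}

/-! ### Paths and cycles in sets of darts -/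

theorem isWalk_map_range (s : ℕ → D) (hs : ∀ k, G.tail (s (k + 1)) = G.head (s k)) (n : ℕ) :
    G.IsWalk (G.tail (s 0)) ((List.range n).map s) (G.tail (s n)) := by
  induction n with
  | zero => exact rfl
  | succ n ih =>
    rw [List.range_succ, List.map_append, isWalk_append]
    exact ⟨_, ih, rfl, (hs n).symm⟩

/-- A finite set of darts in which every dart has a successor that does not backtrack contains a
simple cycle. -/
theorem exists_isSimpleCycle [Finite D] {M : Set D} (hM : M.Nonempty)
    (h : ∀ d ∈ M, ∃ d' ∈ M, G.tail d' = G.head d ∧ d' ≠ G.opp d) :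
    ∃ c, G.IsSimpleCycle c ∧ ∀ d ∈ c, d ∈ M := by
  classical
  choose! nx h1 h2 h3 using h
  obtain ⟨d₀, hd₀⟩ := hM
  let s : ℕ → D := fun n => nx^[n] d₀
  have hsM : ∀ n, s n ∈ M := by
    intro n
    induction n with
    | zero => exact hd₀
    | succ n ih => simp only [s, Function.iterate_succ_apply'] at ih ⊢; exact h1 _ ih
  have hsn : ∀ n, s (n + 1) = nx (s n) := fun n => Function.iterate_succ_apply' _ _ _
  -- The least `j` at which the orbit of successors revisits a tail: the darts from index i up to j
  -- - 1 then have distinct tails and close up.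
  have hex : ∃ j, ∃ i < j, G.tail (s i) = G.tail (s j) := by
    obtain ⟨i, j, hij, he⟩ := Finite.exists_ne_map_eq_of_infinite fun n => G.tail (s n)
    rcases lt_or_gt_of_ne hij with hlt | hlt
    · exact ⟨j, i, hlt, he⟩
    · exact ⟨i, j, hlt, he.symm⟩
  obtain ⟨i, hij, he⟩ := Nat.find_spec hex
  have hmin := fun k => Nat.find_min hex (m := k)
  generalize Nat.find hex = j at *
  have hinj : ∀ k < j, ∀ l < j, G.tail (s k) = G.tail (s l) → k = l := by
    intro k hk l hl hkl
    by_contra hne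
    rcases lt_or_gt_of_ne hne with hlt | hlt
    · exact hmin l hl ⟨k, hlt, hkl⟩
    · exact hmin k hk ⟨l, hlt, hkl.symm⟩
  obtain ⟨n, rfl⟩ := Nat.exists_eq_add_of_lt hij
  let t : ℕ → D := fun k => s (i + k)
  have htt : ∀ k, G.tail (t (k + 1)) = G.head (t k) := by
    intro k
    change G.tail (s (i + k + 1)) = _
    rw [hsn]; exact h2 _ (hsM _)
  have htinj : ∀ k < n + 1, ∀ l < n + 1, G.tail (t k) = G.tail (t l) → k = l := by
    intro k hk l hl hkl
    have := hinj (i + k) (by omega) (i + l) (by omega) hkl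
    omega
  have htn : ∀ k, t (k + 1) ≠ G.opp (t k) := by
    intro k
    change s (i + k + 1) ≠ _
    rw [hsn]; exact h3 _ (hsM _)
  have hclosed : G.tail (t (n + 1)) = G.tail (t 0) := he.symm
  refine ⟨(List.range (n + 1)).map t, ⟨by simp, Or.inr ⟨G.tail (t 0), ?_⟩, ?_, ?_⟩, ?_⟩
  · have := isWalk_map_range t htt (n + 1)
    rwa [hclosed] at this
  · rw [List.map_map]
    refine List.Nodup.map_on (fun k hk l hl hkl => ?_) List.nodup_range
    exact htinj k (List.mem_range.1 hk) l (List.mem_range.1 hl) hkl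
  · rw [List.map_map]
    -- If two of the darts share an edge without being equal, the later one is the reversal of the
    -- earlier one and leaves its head. Distinctness of tails makes it the immediate successor, and
    -- successors do not backtrack.
    have key : ∀ k < n + 1, ∀ l < n + 1, k < l → G.edge (t k) ≠ G.edge (t l) := by
      intro k hk l hl hkl hE
      rcases G.edge_eq_iff.1 hE with h' | h'
      · have := htinj k hk l hl (by rw [h'])
        omega
      · have hlt : l = k + 1 := htinj l hl (k + 1) (by omega) (by rw [htt, h']; rfl)
        subst hlt
        exact htn k h'
    refine List.Nodup.map_on (fun k hk l hl hkl => ?_) List.nodup_range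
    have hk := List.mem_range.1 hk
    have hl := List.mem_range.1 hl
    by_contra hne
    rcases lt_or_gt_of_ne hne with hlt | hlt
    · exact key k hk l hl hlt hkl
    · exact key l hl k hk hlt hkl.symm
  · intro d hd
    obtain ⟨k, -, rfl⟩ := List.mem_map.1 hd
    exact hsM _

/-- A dart of `Y` with no continuation in `Y` other than its reversal would end at a vertex of
degree one. -/
theorem exists_isSimpleCycle_of_even [Finite D] {Y : Set G.Edge} (hne : Y.Nonempty)
    (hY : G.deg Y = 0) : ∃ c, G.IsSimpleCycle c ∧ G.edgeSet c ⊆ Y := by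
  obtain ⟨e, he⟩ := hne
  obtain ⟨d, rfl⟩ := G.exists_edge e
  obtain ⟨c, hc, hcM⟩ := exists_isSimpleCycle (G := G) (M := {d | G.edge d ∈ Y}) ⟨d, he⟩ (by
    intro d hd
    by_contra! hcon
    have h1 : ({x | G.tail x = G.head d ∧ G.edge x ∈ Y} : Set D) = {G.opp d} := by
      ext x
      constructor
      · rintro ⟨h1, h2⟩; exact hcon x h2 h1
      · rintro rfl; exact ⟨rfl, by rw [edge_opp]; exact hd⟩
    have h2 := congrFun hY (G.head d)
    rw [deg, h1, Set.ncard_singleton, Pi.zero_apply, Nat.cast_one] at h2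
    exact one_ne_zero h2)
  refine ⟨c, hc, fun e he => ?_⟩
  obtain ⟨d, hd, rfl⟩ := (G.mem_edgeSet).1 he
  exact hcM d hd

theorem IsSimpleCycle.chain_eq {c : List D} (hc : G.IsSimpleCycle c) : G.chain c = G.edgeSet c :=
  G.chain_eq_edgeSet hc.2.2.2

/-- Removing a null-homologous cycle changes neither evenness nor the homology class and lowers the
number of edges, so a nontrivial cycle must appear eventually. -/
theorem exists_isSimpleCycle_of_even_of_not_null [Finite D] {Y : Set G.Edge}
    (hY : G.deg Y = 0) (hn : ¬ G.IsNullHomologous Y) :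
    ∃ c, G.IsSimpleCycle c ∧ G.edgeSet c ⊆ Y ∧ ¬ G.IsNullHomologous (G.edgeSet c) := by
  induction hk : Y.ncard using Nat.strong_induction_on generalizing Y with
  | _ k ih =>
    subst hk
    have hne : Y.Nonempty := by
      rw [Set.nonempty_iff_ne_empty]
      rintro rfl
      refine hn ⟨∅, edgeSet_ext fun d => by simp [edge_mem_boundary]⟩
    obtain ⟨c, hc, hcY⟩ := exists_isSimpleCycle_of_even hne hY
    by_cases hcn : G.IsNullHomologous (G.edgeSet c)
    · have hss : symmDiff Y (G.edgeSet c) = Y \ G.edgeSet c := symmDiff_of_ge hcY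
      have hcne : (G.edgeSet c).Nonempty := by
        obtain ⟨d, hd⟩ := List.exists_mem_of_ne_nil _ hc.1
        exact ⟨_, G.mem_edgeSet.2 ⟨d, hd, rfl⟩⟩
      have hlt : (Y \ G.edgeSet c).ncard < Y.ncard := by
        apply Set.ncard_lt_ncard _ Y.toFinite
        obtain ⟨e, he⟩ := hcne
        exact ⟨Set.sdiff_subset, fun h => (h (hcY he)).2 he⟩
      obtain ⟨c', h1, h2, h3⟩ := ih _ hlt (Y := Y \ G.edgeSet c) (by
        rw [← hss, deg_symmDiff, hY, ← hc.chain_eq, deg_chain_closed hc.2.1, add_zero]) (by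
        intro h
        apply hn
        have := h.symmDiff hcn
        rwa [← hss, symmDiff_symmDiff_cancel_right] at this) rfl
      exact ⟨c', h1, h2.trans Set.sdiff_subset, h3⟩
    · exact ⟨c, hc, hcY, hcn⟩

theorem IsWalk.map_tail_append {u v : G.Vertex} {p : List D} (h : G.IsWalk u p v) :
    p.map G.tail ++ [v] = u :: p.map G.head := by
  induction p generalizing u with
  | nil => cases h; rfl
  | cons d p ih =>
    obtain ⟨rfl, h⟩ := h
    simp [ih h]

theorem IsWalk.exists_isPath {u v : G.Vertex} {p : List D} (h : G.IsWalk u p v) :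
    ∃ q, G.IsPath u q v ∧ q.Sublist p := by
  induction p generalizing u with
  | nil => exact ⟨[], ⟨h, by simp⟩, List.Sublist.refl _⟩
  | cons d p ih =>
    obtain ⟨hd, h⟩ := h
    obtain ⟨q, hq, hqp⟩ := ih h
    by_cases hu : u ∈ G.head d :: q.map G.head
    · rcases List.mem_cons.1 hu with rfl | hu
      · exact ⟨q, hq, hqp.cons d⟩
      · obtain ⟨d', hd', rfl⟩ := List.mem_map.1 hu
        obtain ⟨q₁, q₂, rfl⟩ := List.append_of_mem hd'
        obtain ⟨x, -, -, hx⟩ := isWalk_append.1 hq.1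
        refine ⟨q₂, ⟨hx, ?_⟩, ?_⟩
        · have := hq.2
          rw [List.map_append, List.map_cons] at this
          exact (List.nodup_append.1 (List.nodup_cons.1 this).2).2.1
        · exact ((List.sublist_cons_self d' q₂).trans (List.sublist_append_right q₁ _)).trans
            (hqp.cons d)
    · exact ⟨d :: q, ⟨⟨hd, hq.1⟩, by
        rw [List.map_cons]; exact List.nodup_cons.2 ⟨hu, hq.2⟩⟩, hqp.cons_cons d⟩

theorem IsPath.nodup_edge {u v : G.Vertex} {p : List D} (h : G.IsPath u p v) :
    (p.map G.edge).Nodup := by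
  induction p generalizing u with
  | nil => simp
  | cons d p ih =>
    obtain ⟨⟨rfl, hw⟩, hn⟩ := h
    rw [List.map_cons, List.nodup_cons] at hn
    rw [List.map_cons, List.nodup_cons]
    refine ⟨fun hmem => ?_, ih ⟨hw, hn.2⟩⟩
    obtain ⟨d', hd', he⟩ := List.mem_map.1 hmem
    rcases G.edge_eq_iff.1 he.symm with rfl | rfl
    · exact (List.nodup_cons.1 hn.2).1 (List.mem_map_of_mem hd')
    · refine hn.1 (List.mem_cons_of_mem _ (List.mem_map.2 ⟨_, hd', ?_⟩))
      exact G.head_opp d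

theorem walkWeight_mono {w : G.Edge → ℝ} (hw : ∀ e, 0 ≤ w e) {p q : List D} (h : p.Sublist q) :
    G.walkWeight w p ≤ G.walkWeight w q :=
  (h.map _).sum_le_sum (by
    intro x hx
    obtain ⟨d, -, rfl⟩ := List.mem_map.1 hx
    exact hw _)

/-- Otherwise the set of vertices reachable from `x` within `Y` contains x but not y, so its degree
sum is odd, against the handshake lemma. -/
theorem exists_isPath_of_deg [Finite D] {Y : Set G.Edge} {x y : G.Vertex}
    (hY : G.deg Y = pt x + pt y) : ∃ p, G.IsPath x p y ∧ G.edgeSet p ⊆ Y := by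
  classical
  have := Fintype.ofFinite G.Vertex
  have key : ∃ p, G.IsWalk x p y ∧ G.edgeSet p ⊆ Y := by
    by_contra hcon
    let K : Finset G.Vertex := {v | ∃ p, G.IsWalk x p v ∧ G.edgeSet p ⊆ Y}
    have hx : x ∈ K := by
      simp only [K, Finset.mem_filter, Finset.mem_univ, true_and]
      exact ⟨[], rfl, by simp [edgeSet_nil]⟩
    have hy : y ∉ K := by simpa only [K, Finset.mem_filter, Finset.mem_univ, true_and] using hcon
    have h0 := sum_deg_eq_zero Y K (by
      intro d hd ht
      simp only [K, Finset.mem_filter, Finset.mem_univ, true_and] at ht ⊢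
      obtain ⟨p, hp, hpY⟩ := ht
      refine ⟨p ++ [d], isWalk_append.2 ⟨_, hp, rfl, rfl⟩, ?_⟩
      intro e he
      obtain ⟨d', hd', rfl⟩ := G.mem_edgeSet.1 he
      rcases List.mem_append.1 hd' with h | h
      · exact hpY (G.mem_edgeSet.2 ⟨_, h, rfl⟩)
      · rw [List.mem_singleton.1 h]; exact hd)
    rw [hY] at h0
    have h1 : ∀ u : G.Vertex, ∑ v ∈ K, pt u v = if u ∈ K then (1 : ZMod 2) else 0 := by
      intro u
      simp [pt, Finset.sum_pi_single']
    simp only [Pi.add_apply, Finset.sum_add_distrib, h1, hx, hy] at h0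
    exact absurd h0 (by decide)
  obtain ⟨p, hp, hpY⟩ := key
  obtain ⟨q, hq, hqp⟩ := hp.exists_isPath
  refine ⟨q, hq, fun e he => hpY ?_⟩
  obtain ⟨d, hd, rfl⟩ := G.mem_edgeSet.1 he
  exact G.mem_edgeSet.2 ⟨d, hqp.subset hd, rfl⟩

/-! ### Directed cycles as sets of darts -/

/-- Two consecutive darts of `M`. -/
def Step (G : EmbeddedGraph D) (M : Set D) (x y : D) : Prop := x ∈ M ∧ y ∈ M ∧ G.head x = G.tail y

/-- `M` is the set of darts of a simple cycle, traversed in one direction. -/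
structure DiCycle (G : EmbeddedGraph D) (M : Set D) : Prop where
  nonempty : M.Nonempty
  opp_notMem : ∀ d ∈ M, G.opp d ∉ M
  tail_inj : Set.InjOn G.tail M
  head_inj : Set.InjOn G.head M
  next : ∀ d ∈ M, ∃ d' ∈ M, G.head d = G.tail d'
  prev : ∀ d ∈ M, ∃ d' ∈ M, G.head d' = G.tail d
  conn : ∀ d ∈ M, ∀ d' ∈ M, Relation.ReflTransGen (G.Step M) d d'

theorem IsWalk.head_eq_or_next {u v : G.Vertex} {p : List D} (h : G.IsWalk u p v) {d : D}
    (hd : d ∈ p) : G.head d = v ∨ ∃ d' ∈ p, G.head d = G.tail d' := by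
  induction p generalizing u with
  | nil => simp at hd
  | cons x p ih =>
    obtain ⟨-, h⟩ := h
    rcases List.mem_cons.1 hd with rfl | hd
    · cases p with
      | nil => exact Or.inl h
      | cons y p => exact Or.inr ⟨y, by simp, h.1.symm⟩
    · rcases ih h hd with h' | ⟨d', h1, h2⟩
      · exact Or.inl h'
      · exact Or.inr ⟨d', List.mem_cons_of_mem _ h1, h2⟩

theorem IsWalk.tail_eq_or_prev {u v : G.Vertex} {p : List D} (h : G.IsWalk u p v) {d : D}
    (hd : d ∈ p) : G.tail d = u ∨ ∃ d' ∈ p, G.head d' = G.tail d := by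
  induction p generalizing u with
  | nil => simp at hd
  | cons x p ih =>
    obtain ⟨hx, h⟩ := h
    rcases List.mem_cons.1 hd with rfl | hd
    · exact Or.inl hx
    · rcases ih h hd with h' | ⟨d', h1, h2⟩
      · exact Or.inr ⟨x, by simp, h'.symm⟩
      · exact Or.inr ⟨d', List.mem_cons_of_mem _ h1, h2⟩

theorem IsWalk.step_from_first {u v : G.Vertex} {x : D} {p : List D} (h : G.IsWalk u (x :: p) v)
    {M : Set D} (hM : ∀ d ∈ x :: p, d ∈ M) {d : D} (hd : d ∈ x :: p) :
    Relation.ReflTransGen (G.Step M) x d := by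
  induction p generalizing u x with
  | nil => rw [List.mem_singleton.1 hd]
  | cons y p ih =>
    rcases List.mem_cons.1 hd with rfl | hd
    · exact Relation.ReflTransGen.refl
    · obtain ⟨-, h⟩ := h
      refine Relation.ReflTransGen.head ⟨hM x (by simp), hM y (by simp), h.1.symm⟩
        (ih h (fun d hd => hM d (List.mem_cons_of_mem _ hd)) hd)

theorem IsWalk.step_to_last {u v : G.Vertex} {p : List D} (h : G.IsWalk u p v)
    {M : Set D} (hM : ∀ d ∈ p, d ∈ M) {d : D} (hd : d ∈ p) :
    ∃ l, p.getLast? = some l ∧ G.head l = v ∧ Relation.ReflTransGen (G.Step M) d l := by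
  induction p generalizing u d with
  | nil => simp at hd
  | cons x p ih =>
    obtain ⟨-, h⟩ := h
    cases p with
    | nil =>
      rw [List.mem_singleton.1 hd]
      exact ⟨x, rfl, h, Relation.ReflTransGen.refl⟩
    | cons y p =>
      have hM' : ∀ d ∈ y :: p, d ∈ M := fun d hd => hM d (List.mem_cons_of_mem _ hd)
      rcases List.mem_cons.1 hd with rfl | hd
      · obtain ⟨l, h1, h2, h3⟩ := ih h hM' (List.mem_cons_self (a := y))
        exact ⟨l, by simpa using h1, h2, Relation.ReflTransGen.head
          ⟨hM d (by simp), hM y (by simp), h.1.symm⟩ h3⟩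
      · obtain ⟨l, h1, h2, h3⟩ := ih h hM' hd
        exact ⟨l, by simpa using h1, h2, h3⟩

theorem IsSimpleCycle.diCycle {c : List D} (hc : G.IsSimpleCycle c) : G.DiCycle {d | d ∈ c} := by
  obtain ⟨hne, hcl, ht, he⟩ := hc
  obtain ⟨u, hu⟩ : ∃ u, G.IsWalk u c u := hcl.resolve_left hne
  -- In a closed walk the heads are the tails shifted cyclically, so distinct tails give distinct
  -- heads.
  have hperm : (c.map G.head).Perm (c.map G.tail) := by
    have h := hu.map_tail_append
    have h2 : (u :: c.map G.head).Perm (u :: c.map G.tail) := by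
      rw [← h]; exact List.perm_append_singleton _ _
    exact h2.cons_inv
  have hh : (c.map G.head).Nodup := hperm.nodup_iff.2 ht
  obtain ⟨x, p, rfl⟩ := List.exists_cons_of_ne_nil hne
  have hx : G.tail x = u := hu.1
  have hlast : ∃ l ∈ x :: p, G.head l = u := by
    obtain ⟨l, h1, h2, -⟩ := hu.step_to_last (M := Set.univ) (by simp) (List.mem_cons_self (a := x))
    exact ⟨l, List.mem_of_getLast? h1, h2⟩
  refine ⟨⟨x, List.mem_cons_self⟩, ?_, ?_, ?_, ?_, ?_, ?_⟩
  · intro d hd hd'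
    exact G.opp_ne d (List.inj_on_of_nodup_map he hd' hd (G.edge_opp d))
  · intro d hd d' hd' h; exact List.inj_on_of_nodup_map ht hd hd' h
  · intro d hd d' hd' h; exact List.inj_on_of_nodup_map hh hd hd' h
  · intro d hd
    rcases hu.head_eq_or_next hd with h | h
    · exact ⟨x, List.mem_cons_self, by rw [h, hx]⟩
    · exact h
  · intro d hd
    rcases hu.tail_eq_or_prev hd with h | h
    · obtain ⟨l, hl, hl'⟩ := hlast
      exact ⟨l, hl, by rw [h, hl']⟩
    · exact h
  · intro d hd d' hd'
    obtain ⟨l, h1, h2, h3⟩ := hu.step_to_last (M := {d | d ∈ x :: p}) (fun _ h => h) hd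
    exact (h3.tail ⟨List.mem_of_getLast? h1, List.mem_cons_self, by rw [h2, hx]⟩).trans
      (hu.step_from_first (fun _ h => h) hd')

theorem step_reverse {M M' : Set D} (h : ∀ d, d ∈ M → G.opp d ∈ M') {x y : D}
    (hxy : Relation.ReflTransGen (G.Step M) x y) :
    Relation.ReflTransGen (G.Step M') (G.opp y) (G.opp x) := by
  induction hxy with
  | refl => exact Relation.ReflTransGen.refl
  | tail _ hs ih =>
    exact Relation.ReflTransGen.head ⟨h _ hs.2.1, h _ hs.1, by
      rw [head_opp, tail_opp, hs.2.2]⟩ ih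

theorem DiCycle.reverse {M : Set D} (hM : G.DiCycle M) : G.DiCycle {d | G.opp d ∈ M} := by
  have hmem : ∀ d, d ∈ M → G.opp d ∈ {d | G.opp d ∈ M} := fun d hd => by
    change G.opp (G.opp d) ∈ M; rwa [G.opp_opp]
  have hhead : ∀ d, G.head d = G.tail (G.opp d) := fun _ => rfl
  refine ⟨?_, ?_, ?_, ?_, ?_, ?_, ?_⟩
  · obtain ⟨d, hd⟩ := hM.nonempty
    exact ⟨_, hmem d hd⟩
  · intro d hd; exact hM.opp_notMem _ hd
  · intro d hd d' hd' h
    exact G.opp.injective (hM.head_inj hd hd' (by rw [head_opp, head_opp, h]))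
  · intro d hd d' hd' h
    exact G.opp.injective (hM.tail_inj hd hd' h)
  · intro d hd
    obtain ⟨d', h1, h2⟩ := hM.prev _ hd
    exact ⟨G.opp d', hmem _ h1, by rw [tail_opp, h2, tail_opp]⟩
  · intro d hd
    obtain ⟨d', h1, h2⟩ := hM.next _ hd
    exact ⟨G.opp d', hmem _ h1, by rw [head_opp, ← h2, head_opp]⟩
  · intro d hd d' hd'
    have := step_reverse hmem (hM.conn _ hd' _ hd)
    rwa [G.opp_opp, G.opp_opp] at this

theorem DiCycle.induction {M : Set D} (hM : G.DiCycle M) {p : D → Prop} {d₀ : D} (h₀ : d₀ ∈ M)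
    (hp : p d₀) (hs : ∀ d ∈ M, ∀ d' ∈ M, G.head d = G.tail d' → p d → p d') :
    ∀ d ∈ M, p d := by
  intro d hd
  have := hM.conn d₀ h₀ d hd
  clear hd
  induction this with
  | refl => exact hp
  | tail _ h ih => exact hs _ h.1 _ h.2.1 h.2.2 ih

/-! ### Existence of homologically nontrivial even subgraphs -/

/-- A rank count over ℤ₂ for faces → edges → vertices. The degree sum of any edge set vanishes, so
`d1` has rank at most V - 1 and its kernel has dimension at least E - V + 1. The set of all faces
has empty boundary, so `d2` has rank at most F - 1. As V - E + F < 2, the kernel is not contained in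
the range of `d2`. -/
theorem exists_even_not_null [Finite D] (h : (Nat.card G.Vertex : ℤ) - Nat.card G.Edge +
    Nat.card G.Face < 2) (hD : Nonempty D) :
    ∃ Y : Set G.Edge, G.deg Y = 0 ∧ ¬ G.IsNullHomologous Y := by
  classical
  have := Fintype.ofFinite D
  have := Fintype.ofFinite G.Vertex
  have := Fintype.ofFinite G.Edge
  have := Fintype.ofFinite G.Face
  have : Nonempty G.Vertex := hD.map G.tail
  have : Nonempty G.Face := hD.map G.face
  let d1 : (G.Edge → ZMod 2) →ₗ[ZMod 2] (G.Vertex → ZMod 2) :=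
    { toFun := fun z v => ∑ d with G.tail d = v, z (G.edge d)
      map_add' := fun z z' => by funext v; simp [Finset.sum_add_distrib]
      map_smul' := fun a z => by funext v; simp [Finset.mul_sum] }
  -- The value of `d2` does not depend on the chosen dart, since its formula is symmetric in the two
  -- sides of the edge.
  let rep : G.Edge → D := fun e => (G.exists_edge e).choose
  have hrep : ∀ e, G.edge (rep e) = e := fun e => (G.exists_edge e).choose_spec
  let d2 : (G.Face → ZMod 2) →ₗ[ZMod 2] (G.Edge → ZMod 2) :=
    { toFun := fun a e => a (G.face (rep e)) + a (G.face (G.opp (rep e)))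
      map_add' := fun z z' => by funext v; simp only [Pi.add_apply]; ring
      map_smul' := fun a z => by funext v; simp [mul_add] }
  let sm : (G.Vertex → ZMod 2) →ₗ[ZMod 2] ZMod 2 :=
    { toFun := fun f => ∑ v, f v
      map_add' := fun z z' => by simp [Finset.sum_add_distrib]
      map_smul' := fun a z => by simp [Finset.mul_sum] }
  have hsm : LinearMap.range sm = ⊤ := by
    rw [LinearMap.range_eq_top]
    intro t
    obtain ⟨v⟩ := ‹Nonempty G.Vertex›
    exact ⟨Pi.single v t, by simp [sm]⟩
  have hle : LinearMap.range d1 ≤ LinearMap.ker sm := by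
    rintro _ ⟨z, rfl⟩
    rw [LinearMap.mem_ker]
    change ∑ v, ∑ d with G.tail d = v, z (G.edge d) = 0
    -- Summed over all vertices, every edge is counted once for each of its two darts.
    rw [Finset.sum_fiberwise (s := Finset.univ) (g := G.tail) (f := fun d => z (G.edge d))]
    exact Finset.sum_involution (fun x _ => G.opp x)
      (fun d _ => by rw [edge_opp]; exact CharTwo.add_self_eq_zero _)
      (fun x _ _ => G.opp_ne x) (fun _ _ => Finset.mem_univ _) (fun x _ => G.opp_opp x)
  have e1 := LinearMap.finrank_range_add_finrank_ker d1
  have e2 := LinearMap.finrank_range_add_finrank_ker d2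
  have e3 := LinearMap.finrank_range_add_finrank_ker sm
  rw [hsm, finrank_top] at e3
  have e4 := Submodule.finrank_mono hle
  have e5 : 0 < Module.finrank (ZMod 2) (LinearMap.ker d2) := by
    refine Module.finrank_pos_iff_exists_ne_zero.2 ⟨⟨fun _ => 1, ?_⟩, ?_⟩
    · rw [LinearMap.mem_ker]; funext e; exact CharTwo.add_self_eq_zero _
    · intro h0
      have := congrFun (congrArg Subtype.val h0) (Classical.arbitrary G.Face)
      exact one_ne_zero (α := ZMod 2) this
  simp only [Module.finrank_fintype_fun_eq_card, Module.finrank_self] at e1 e2 e3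
  simp only [Nat.card_eq_fintype_card] at h
  have hnot : ¬ LinearMap.ker d1 ≤ LinearMap.range d2 := by
    intro hk
    have := Submodule.finrank_mono hk
    omega
  obtain ⟨z, hz1, hz2⟩ := SetLike.not_le_iff_exists.1 hnot
  refine ⟨{e | z e = 1}, ?_, ?_⟩
  · funext v
    have := congrFun (LinearMap.mem_ker.1 hz1) v
    rw [Pi.zero_apply] at this ⊢
    rw [← this, deg, Set.ncard_eq_toFinset_card', Finset.cast_card]
    change _ = ∑ d with G.tail d = v, z (G.edge d)
    have hb : ∀ t : ZMod 2, (if t = 1 then 1 else 0) = t := by decide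
    rw [← Finset.sum_congr rfl (fun d _ => hb (z (G.edge d))), ← Finset.sum_filter,
      Finset.filter_filter]
    refine Finset.sum_congr ?_ fun _ _ => rfl
    ext d; simp
  · rintro ⟨A, hA⟩
    apply hz2
    refine ⟨fun f => if f ∈ A then 1 else 0, ?_⟩
    funext e
    change (if _ then (1 : ZMod 2) else 0) + (if _ then 1 else 0) = z e
    have h1 : z e = 1 ↔ ¬ (G.face (rep e) ∈ A ↔ G.face (G.opp (rep e)) ∈ A) := by
      rw [← edge_mem_boundary, ← hA, hrep]; rfl
    have hb : ∀ t : ZMod 2, t = 0 ∨ t = 1 := by decide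
    by_cases ha : G.face (rep e) ∈ A <;> by_cases hb' : G.face (G.opp (rep e)) ∈ A <;>
      rcases hb (z e) with h2 | h2 <;> simp only [ha, hb', h2, if_true, if_false] at h1 ⊢ <;>
      revert h1 <;> decide

end EmbeddedGraph

/-! ### Cycles in a minimum separating subgraph, and separation after cutting -/

namespace EmbeddedGraph

variable {D : Type*} {G : EmbeddedGraph D}

/-! ### The two sides of a separating subgraph -/

/-- The darts with a face of `A` on their chosen side and a face outside `A` on the other side. -/
def rim (G : EmbeddedGraph D) (A : Set G.Face) : Set D := {d | G.face d ∈ A ∧ G.face (G.opp d) ∉ A}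

/-- The edges that have a face of `A` on at least one side. -/
def side (G : EmbeddedGraph D) (A : Set G.Face) : Set G.Edge := {e | ∃ d, G.edge d = e ∧ G.face d ∈ A}

theorem edge_mem_side {A : Set G.Face} {d : D} :
    G.edge d ∈ G.side A ↔ G.face d ∈ A ∨ G.face (G.opp d) ∈ A := by
  constructor
  · rintro ⟨d', h, h'⟩
    rcases G.edge_eq_iff.1 h with rfl | rfl
    · exact Or.inl h'
    · rw [G.opp_opp]; exact Or.inr h'
  · rintro (h | h)
    · exact ⟨d, rfl, h⟩
    · exact ⟨G.opp d, G.edge_opp d, h⟩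

theorem edge_mem_boundary_iff_rim {A : Set G.Face} {d : D} :
    G.edge d ∈ G.boundary A ↔ d ∈ G.rim A ∨ G.opp d ∈ G.rim A := by
  rw [edge_mem_boundary]
  simp only [rim, Set.mem_ofPred_eq, G.opp_opp]
  tauto

theorem edge_mem_boundary_of_rim {A : Set G.Face} {d : D} (h : d ∈ G.rim A) :
    G.edge d ∈ G.boundary A := edge_mem_boundary_iff_rim.2 (Or.inl h)

theorem opp_notMem_rim {A : Set G.Face} {d : D} (h : d ∈ G.rim A) : G.opp d ∉ G.rim A :=
  fun h' => h.2 h'.1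

theorem rim_compl (A : Set G.Face) : G.rim Aᶜ = {d | G.opp d ∈ G.rim A} := by
  ext d
  simp only [rim, Set.mem_ofPred_eq, Set.mem_compl_iff, not_not, G.opp_opp]
  tauto

theorem boundary_subset_side (A : Set G.Face) : G.boundary A ⊆ G.side A := by
  rintro _ ⟨d, rfl, h, -⟩
  exact ⟨d, rfl, h⟩

/-- Let U and V be the darts at `v` with A on the chosen side and on the other side. Rotation maps V
onto U, so U \ V and V \ U have equal size; the former are the rim darts that leave `v`, the latter
the reversals of those that enter. -/
theorem rim_balanced [Finite D] (A : Set G.Face) (v : G.Vertex) :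
    ({d | d ∈ G.rim A ∧ G.tail d = v} : Set D).ncard =
      ({d | d ∈ G.rim A ∧ G.head d = v} : Set D).ncard := by
  let U : Set D := {d | G.tail d = v ∧ G.face d ∈ A}
  let V : Set D := {d | G.tail d = v ∧ G.face (G.opp d) ∈ A}
  have h2 : G.rot '' V = U := by
    ext d
    constructor
    · rintro ⟨x, ⟨h1, h2⟩, rfl⟩
      exact ⟨by rw [tail_rot, h1], by rwa [face_rot]⟩
    · rintro ⟨h1, h2⟩
      refine ⟨G.rot.symm d, ⟨?_, ?_⟩, by simp⟩
      · rw [← G.tail_rot]; simpa using h1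
      · rw [← G.face_rot]; simpa using h2
  have h3 : U.ncard = V.ncard := by rw [← h2, Set.ncard_image_of_injective _ G.rot.injective]
  have h4 := Set.ncard_inter_add_ncard_sdiff_eq_ncard U V U.toFinite
  have h5 := Set.ncard_inter_add_ncard_sdiff_eq_ncard V U V.toFinite
  rw [Set.inter_comm] at h5
  have h6 : (U \ V).ncard = (V \ U).ncard := by omega
  have h7 : ({d | d ∈ G.rim A ∧ G.tail d = v} : Set D) = U \ V := by
    ext d; simp only [rim, U, V, Set.mem_ofPred_eq, Set.mem_sdiff]; tauto
  have h8 : G.opp '' ({d | d ∈ G.rim A ∧ G.head d = v} : Set D) = V \ U := by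
    ext d
    constructor
    · rintro ⟨x, ⟨⟨h1, h2⟩, h3⟩, rfl⟩
      exact ⟨⟨h3, by rwa [G.opp_opp]⟩, fun h => h2 h.2⟩
    · rintro ⟨⟨h1, h2⟩, h3⟩
      refine ⟨G.opp d, ⟨⟨h2, ?_⟩, ?_⟩, G.opp_opp d⟩
      · rw [G.opp_opp]; exact fun h => h3 ⟨h1, h⟩
      · rw [head_opp, h1]
  rw [h7, h6, ← h8, Set.ncard_image_of_injective _ G.opp.injective]

/-- If every rim dart leaving the head of `d` lies in `M`, there is only one, as tails are distinct
on `M`. By balance only one rim dart enters there, and the predecessor in `M` of the leaving dart is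
one; so it is `d` itself, which is not in `M`. The empty `M` gives a first cycle in the rim, a cycle
as `M` gives a second one disjoint from it. -/
theorem rim_diff_next [Finite D] {A : Set G.Face} {M : Set D} (hM : M ⊆ G.rim A)
    (ht : Set.InjOn G.tail M) (hp : ∀ d ∈ M, ∃ d' ∈ M, G.head d' = G.tail d) {d : D}
    (hd : d ∈ G.rim A \ M) : ∃ d' ∈ G.rim A \ M, G.tail d' = G.head d ∧ d' ≠ G.opp d := by
  by_contra! hcon
  have hcon' : ∀ d' ∈ G.rim A, G.tail d' = G.head d → d' ∈ M := by
    intro d' hd' h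
    by_contra hn
    exact opp_notMem_rim hd.1 (hcon d' ⟨hd', hn⟩ h ▸ hd')
  have hb := rim_balanced A (G.head d)
  have h1 : 0 < ({x | x ∈ G.rim A ∧ G.head x = G.head d} : Set D).ncard :=
    (Set.ncard_pos (Set.toFinite _)).2 ⟨d, hd.1, rfl⟩
  obtain ⟨m, hm, hmt⟩ := (Set.ncard_pos (Set.toFinite _)).1 (hb ▸ h1)
  have hmM := hcon' m hm hmt
  have h2 : ({x | x ∈ G.rim A ∧ G.tail x = G.head d} : Set D) = {m} := by
    ext x
    constructor
    · rintro ⟨h3, h4⟩; exact ht (hcon' x h3 h4) hmM (by rw [h4, hmt])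
    · rintro rfl; exact ⟨hm, hmt⟩
  rw [h2, Set.ncard_singleton] at hb
  obtain ⟨z, hz⟩ := Set.ncard_eq_one.1 hb.symm
  obtain ⟨m', hm', hmh⟩ := hp m hmM
  have e1 : d ∈ ({z} : Set D) := hz ▸ ⟨hd.1, rfl⟩
  have e2 : m' ∈ ({z} : Set D) := hz ▸ ⟨hM hm', by rw [hmh, hmt]⟩
  exact hd.2 ((e1.trans e2.symm : d = m') ▸ hm')

theorem edgeSet_subset_boundary {A : Set G.Face} {c : List D} (hc : ∀ d ∈ c, d ∈ G.rim A) :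
    G.edgeSet c ⊆ G.boundary A := by
  intro e he
  obtain ⟨d, hd, rfl⟩ := G.mem_edgeSet.1 he
  exact edge_mem_boundary_of_rim (hc d hd)

theorem mem_of_edge_mem_edgeSet {A : Set G.Face} {c : List D} (hc : ∀ d ∈ c, d ∈ G.rim A) {d : D}
    (hd : d ∈ G.rim A) (he : G.edge d ∈ G.edgeSet c) : d ∈ c := by
  obtain ⟨x, hx, h⟩ := G.mem_edgeSet.1 he
  rcases G.edge_eq_iff.1 h with rfl | rfl
  · exact hx
  · exact absurd hd (opp_notMem_rim (hc x hx))

/-- A nonempty boundary is a simple cycle, or it contains a proper simple subcycle of at most half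
its weight. -/
theorem exists_cycle_of_boundary [Finite D] {w : G.Edge → ℝ} (hw : ∀ e, 0 ≤ w e)
    {A : Set G.Face} (hne : (G.boundary A).Nonempty) :
    ∃ c, G.IsSimpleCycle c ∧ (∀ d ∈ c, d ∈ G.rim A) ∧ (G.edgeSet c = G.boundary A ∨
      (G.edgeSet c ⊂ G.boundary A ∧
        G.weight w (G.edgeSet c) ≤ G.weight w (G.boundary A \ G.edgeSet c))) := by
  obtain ⟨_, d, rfl, hd⟩ := hne
  obtain ⟨c, hc, hcr⟩ := exists_isSimpleCycle (G := G) (M := G.rim A) ⟨d, hd⟩ (by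
    intro d hd
    obtain ⟨d', h1, h2⟩ := rim_diff_next (A := A) (M := ∅) (by simp) (by simp) (by simp) ⟨hd, by simp⟩
    exact ⟨d', h1.1, h2⟩)
  by_cases heq : G.edgeSet c = G.boundary A
  · exact ⟨c, hc, hcr, Or.inl heq⟩
  have hsub := edgeSet_subset_boundary hcr
  have hss : G.edgeSet c ⊂ G.boundary A := hsub.ssubset_of_ne heq
  by_cases hle : G.weight w (G.edgeSet c) ≤ G.weight w (G.boundary A \ G.edgeSet c)
  · exact ⟨c, hc, hcr, Or.inr ⟨hss, hle⟩⟩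
  obtain ⟨e, ⟨x, rfl, hx⟩, hxc⟩ := Set.exists_of_ssubset hss
  have hdi := hc.diCycle
  -- Here `c` weighs more than the rest of the boundary, so any cycle in that rest has the required
  -- weight bound.
  obtain ⟨c', hc', hcr'⟩ := exists_isSimpleCycle (G := G) (M := G.rim A \ {d | d ∈ c})
    ⟨x, hx, fun h => hxc (G.mem_edgeSet.2 ⟨x, h, rfl⟩)⟩
    (fun d hd => rim_diff_next hcr hdi.tail_inj hdi.prev hd)
  have hr' : ∀ d ∈ c', d ∈ G.rim A := fun d hd => (hcr' d hd).1
  have hdisj : Disjoint (G.edgeSet c) (G.edgeSet c') := by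
    rw [Set.disjoint_left]
    intro e he he'
    obtain ⟨d, hd, rfl⟩ := G.mem_edgeSet.1 he'
    exact (hcr' d hd).2 (mem_of_edge_mem_edgeSet hcr (hr' d hd) he)
  have h1 : G.edgeSet c ⊆ G.boundary A \ G.edgeSet c' :=
    fun e he => ⟨hsub he, Set.disjoint_left.1 hdisj he⟩
  have h2 : G.edgeSet c' ⊆ G.boundary A \ G.edgeSet c :=
    fun e he => ⟨edgeSet_subset_boundary hr' he, Set.disjoint_right.1 hdisj he⟩
  refine ⟨c', hc', hr', Or.inr ⟨(edgeSet_subset_boundary hr').ssubset_of_ne ?_, ?_⟩⟩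
  · intro h
    obtain ⟨d, hd⟩ := List.exists_mem_of_ne_nil _ hc.1
    have hm := h1 (G.mem_edgeSet.2 ⟨d, hd, rfl⟩)
    exact hm.2 (h ▸ hm.1)
  · have := weight_mono hw h1
    have := weight_mono hw h2
    linarith

/-! ### A light cycle inside a minimum separating subgraph -/

/-- Let c ⊕ c' = ∂B. If B does not separate a from b, then S ⊕ ∂B = (S \ c) ⊕ c' is still
separating, so replacing c by c' in S cannot pay off. If B does separate them, c ⊕ c' itself is
separating, so c' weighs at least S \ c, which weighs at least c. -/
theorem isTightCycle_of_light [Finite D] {w : G.Edge → ℝ} (hw : ∀ e, 0 ≤ w e) {a b : G.Face}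
    {S : Set G.Edge} (hS : G.IsMinSeparating w a b S) {c : List D} (hc : G.IsSimpleCycle c)
    (hcS : G.edgeSet c ⊆ S) (hle : G.weight w (G.edgeSet c) ≤ G.weight w (S \ G.edgeSet c)) :
    G.IsTightCycle w c := by
  refine ⟨hc, fun c' hc' hh => ?_⟩
  have hwc' := weight_chain_le hw c'
  rw [walkWeight_eq hc.2.2.2]
  rw [hc.chain_eq] at hh
  refine le_trans ?_ hwc'
  obtain ⟨B, hB⟩ := hh
  obtain ⟨⟨A, ha, hb, hA⟩, hmin⟩ := hS
  have hsplit : G.weight w (G.edgeSet c) + G.weight w (S \ G.edgeSet c) = G.weight w S := by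
    rw [← weight_inter_add_diff S (G.edgeSet c), Set.inter_eq_right.2 hcS]
  by_cases hab : a ∈ B ↔ b ∈ B
  · have h1 : G.IsSeparating a b (symmDiff S (symmDiff (G.edgeSet c) (G.chain c'))) := by
      rw [hB, hA, ← boundary_symmDiff]
      by_cases haB : a ∈ B
      · refine (show G.IsSeparating b a _ from ⟨_, ?_, ?_, rfl⟩).symm
        · exact Or.inr ⟨hab.1 haB, hb⟩
        · rintro (h | h)
          · exact h.2 haB
          · exact h.2 ha
      · refine ⟨_, Or.inl ⟨ha, haB⟩, ?_, rfl⟩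
        rintro (h | h)
        · exact hb h.1
        · exact haB (hab.2 h.1)
    have h2 := hmin _ h1
    rw [← symmDiff_assoc, symmDiff_of_ge hcS] at h2
    have h3 := weight_symmDiff_le hw (S \ G.edgeSet c) (G.chain c')
    change G.weight w (symmDiff (S \ G.edgeSet c) (G.chain c')) ≤ _ at h3
    have h2' : G.weight w S ≤ G.weight w (symmDiff (S \ G.edgeSet c) (G.chain c')) := h2
    linarith
  · have h1 : G.IsSeparating a b (symmDiff (G.edgeSet c) (G.chain c')) := by
      by_cases haB : a ∈ B
      · exact ⟨B, haB, by tauto, hB⟩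
      · exact IsSeparating.symm ⟨B, by tauto, haB, hB⟩
    have h2 := hmin _ h1
    have h3 := weight_symmDiff_le hw (G.edgeSet c) (G.chain c')
    linarith

/-! ### The cut graph -/

section Cut

variable [Finite D] (G) (X : Set G.Edge)

open Classical in
/-- The copy of the dart `d` of `G` from which the sector that follows `d` starts. -/
noncomputable def cutBase (d : D) : G.CutDart X :=
  if h : d ∈ G.dartsOn X then Sum.inr ⟨d, h⟩ else Sum.inl d

variable {G X}

theorem cutBase_of_mem {d : D} (h : d ∈ G.dartsOn X) : G.cutBase X d = Sum.inr ⟨d, h⟩ := by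
  simp [cutBase, h]

theorem cutBase_of_notMem {d : D} (h : d ∉ G.dartsOn X) : G.cutBase X d = Sum.inl d := by
  simp [cutBase, h]

theorem mem_dartsOn {d : D} : d ∈ G.dartsOn X ↔ G.edge d ∈ X := Iff.rfl

theorem opp_mem_dartsOn_iff {d : D} : G.opp d ∈ G.dartsOn X ↔ d ∈ G.dartsOn X := by
  rw [mem_dartsOn, mem_dartsOn, edge_opp]

theorem cut_opp_inl (d : D) : (G.cut X).opp (Sum.inl d) = G.cutBase X (G.opp d) := by
  by_cases h : d ∈ G.dartsOn X
  · rw [cutBase_of_mem (G.opp_mem_dartsOn X h)]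
    simp [cut, cutOppFun, h]
  · rw [cutBase_of_notMem (by rwa [opp_mem_dartsOn_iff])]
    simp [cut, cutOppFun, h]

theorem cut_opp_inr (d : G.dartsOn X) : (G.cut X).opp (Sum.inr d) = Sum.inl (G.opp d) := rfl

theorem cut_rot_base (d : D) : (G.cut X).rot (G.cutBase X d) = Sum.inl (G.rot d) := by
  by_cases h : d ∈ G.dartsOn X
  · rw [cutBase_of_mem h]; rfl
  · rw [cutBase_of_notMem h]
    simp [cut, cutRotFun, h]

theorem cut_rot_inl_of_mem {d : D} (h : d ∈ G.dartsOn X) :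
    (G.cut X).rot (Sum.inl d) = Sum.inr (firstReturn G.rot⁻¹ (G.dartsOn X) ⟨d, h⟩) := by
  simp [cut, cutRotFun, h]

theorem cut_facePerm_inr (d : G.dartsOn X) : (G.cut X).facePerm (Sum.inr d) =
    Sum.inr (firstReturn G.rot⁻¹ (G.dartsOn X) ⟨G.opp d, G.opp_mem_dartsOn X d.2⟩) := by
  rw [facePerm_apply, cut_opp_inr, cut_rot_inl_of_mem]

theorem exists_cut_edge (e : (G.cut X).Edge) : ∃ d : D, (G.cut X).edge (Sum.inl d) = e := by
  obtain ⟨y, rfl⟩ := (G.cut X).exists_edge e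
  rcases y with d | d
  · exact ⟨d, rfl⟩
  · exact ⟨G.opp d, by rw [← cut_opp_inr, edge_opp]⟩

theorem cutFace_mem_boundary {B : Set (G.cut X).Face} {d : D} (hd : d ∉ G.dartsOn X) :
    (G.cut X).edge (Sum.inl d) ∈ (G.cut X).boundary B ↔
      G.edge d ∈ G.boundary (G.cutFace X ⁻¹' B) := by
  rw [edge_mem_boundary, edge_mem_boundary, cut_opp_inl,
    cutBase_of_notMem (by rwa [opp_mem_dartsOn_iff])]
  rfl

theorem cut_edge_mem_boundary_of_mem {B : Set (G.cut X).Face} {d : D} (hd : d ∈ G.dartsOn X) :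
    (G.cut X).edge (Sum.inl d) ∈ (G.cut X).boundary B ↔
      ¬ ((G.cut X).face (Sum.inl d) ∈ B ↔
        (G.cut X).face (Sum.inr ⟨G.opp d, G.opp_mem_dartsOn X hd⟩) ∈ B) := by
  rw [edge_mem_boundary, cut_opp_inl, cutBase_of_mem (G.opp_mem_dartsOn X hd)]

/-- A face set of the cut graph, given by a face set of `G` and a set of the new darts that is
invariant along the new faces. -/
theorem face_mem_cut_faceSet {A : Set G.Face} {q : G.dartsOn X → Prop}
    (hq : ∀ d : G.dartsOn X,
      q (firstReturn G.rot⁻¹ (G.dartsOn X) ⟨G.opp d, G.opp_mem_dartsOn X d.2⟩) ↔ q d)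
    {y : G.CutDart X} :
    (G.cut X).face y ∈ (G.cut X).faceSet (Sum.elim (fun d => G.face d ∈ A) q) ↔
      Sum.elim (fun d => G.face d ∈ A) q y := by
  refine face_mem_faceSet ?_
  rintro (d | d)
  · rw [cut_facePerm_inl]
    simp only [Sum.elim_inl, face_facePerm]
  · rw [cut_facePerm_inr]
    exact hq d

/-- At a vertex of the cycle only `d'` and the reversal of `d` leave along `X`. If turning back from
the latter led to itself, it would be the only dart of `X` there. -/
theorem DiCycle.firstReturn_eq {M : Set D} (hM : G.DiCycle M)
    (hX : ∀ d, d ∈ G.dartsOn X ↔ d ∈ M ∨ G.opp d ∈ M) {d d' : D} (hd : d ∈ M) (hd' : d' ∈ M)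
    (h : G.head d = G.tail d') (hdX : G.opp d ∈ G.dartsOn X) :
    (firstReturn G.rot⁻¹ (G.dartsOn X) ⟨G.opp d, hdX⟩ : D) = d' := by
  have hsc := firstReturn_sameCycle G.rot⁻¹ (G.dartsOn X) ⟨G.opp d, hdX⟩
  rw [Equiv.Perm.sameCycle_inv, ← tail_eq_iff] at hsc
  rcases (hX _).1 (firstReturn G.rot⁻¹ (G.dartsOn X) ⟨G.opp d, hdX⟩).2 with h1 | h1
  · exact hM.tail_inj h1 hd' (by rw [← hsc, ← h]; rfl)
  · have h2 : firstReturn G.rot⁻¹ (G.dartsOn X) ⟨G.opp d, hdX⟩ = ⟨G.opp d, hdX⟩ := by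
      apply Subtype.ext
      apply G.opp.injective
      rw [G.opp_opp]
      exact hM.head_inj h1 hd (by rw [head_opp, ← hsc]; rfl)
    have h3 := eq_of_firstReturn_eq_self _ _ _ h2 ((hX d').2 (Or.inl hd'))
      (by rw [Equiv.Perm.sameCycle_inv, ← tail_eq_iff]; exact h)
    exact absurd ((show d' = G.opp d from h3) ▸ hd') (hM.opp_notMem d hd)

/-- By `cut_facePerm_inr` this first return is the step along a boundary face of the cut graph, so
membership in `M` is constant on such a face: the two copies of the cycle bound different faces. -/
theorem DiCycle.firstReturn_opp_mem_iff {M : Set D} (hM : G.DiCycle M)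
    (hX : ∀ d, d ∈ G.dartsOn X ↔ d ∈ M ∨ G.opp d ∈ M) (d : G.dartsOn X) :
    (firstReturn G.rot⁻¹ (G.dartsOn X) ⟨G.opp d, G.opp_mem_dartsOn X d.2⟩ : D) ∈ M ↔
      (d : D) ∈ M := by
  obtain ⟨d, hd⟩ := d
  rcases (hX d).1 hd with h | h
  · obtain ⟨d', h1, h2⟩ := hM.next d h
    rw [hM.firstReturn_eq hX h h1 h2]
    exact iff_of_true h1 h
  · have hX' : ∀ d, d ∈ G.dartsOn X ↔ d ∈ {d | G.opp d ∈ M} ∨ G.opp d ∈ {d | G.opp d ∈ M} := by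
      intro d
      rw [hX]
      simp only [Set.mem_ofPred_eq, G.opp_opp]
      exact or_comm
    obtain ⟨d', h1, h2⟩ := hM.reverse.next d h
    rw [hM.reverse.firstReturn_eq hX' h h1 h2]
    refine iff_of_false (fun h3 => ?_) fun h3 => hM.opp_notMem _ h3 h
    exact hM.opp_notMem _ h3 h1

theorem mem_dartsOn_edgeSet {c : List D} (d : D) :
    d ∈ G.dartsOn (G.edgeSet c) ↔ d ∈ {d | d ∈ c} ∨ G.opp d ∈ {d | d ∈ c} := by
  rw [mem_dartsOn, mem_edgeSet]
  constructor
  · rintro ⟨x, hx, h⟩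
    rcases G.edge_eq_iff.1 h with rfl | rfl
    · exact Or.inl hx
    · right; change G.opp (G.opp x) ∈ c; rwa [G.opp_opp]
  · rintro (h | h)
    · exact ⟨d, h, rfl⟩
    · exact ⟨_, h, G.edge_opp d⟩

theorem isMinSeparatingInCut_diff {w : G.Edge → ℝ} (hw : ∀ e, 0 ≤ w e) {a b : G.Face}
    {A : Set G.Face} (hS : G.IsMinSeparating w a b (G.boundary A)) (ha : a ∈ A) (hb : b ∉ A)
    {c : List D} (hc : G.IsSimpleCycle c) (hcA : ∀ d ∈ c, d ∈ G.rim A) :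
    G.IsMinSeparatingInCut w (G.edgeSet c) a b (G.boundary A \ G.edgeSet c) := by
  have hM := hc.diCycle
  have hX := mem_dartsOn_edgeSet (G := G) (c := c)
  -- The boundary face along the reversal of the cycle joins A and the one along the cycle stays
  -- outside. A dart of `c` has A on its chosen side and is paired with a new dart of the reversal,
  -- so each copy of the cycle has equal status on its two sides and leaves the boundary.
  let q : G.dartsOn (G.edgeSet c) → Prop := fun d => (d : D) ∉ c
  let A' := (G.cut (G.edgeSet c)).faceSet (Sum.elim (fun d => G.face d ∈ A) q)
  have hA' : ∀ y, (G.cut (G.edgeSet c)).face y ∈ A' ↔ Sum.elim (fun d => G.face d ∈ A) q y :=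
    fun y => face_mem_cut_faceSet fun d => not_congr (hM.firstReturn_opp_mem_iff hX d)
  have hpre : G.cutFace (G.edgeSet c) ⁻¹' A' = A := by
    ext f
    obtain ⟨d, rfl⟩ := G.exists_face f
    exact hA' _
  have hmem : ∀ d, (G.cut (G.edgeSet c)).edge (Sum.inl d) ∈ (G.cut (G.edgeSet c)).boundary A' ↔
      G.edge d ∈ G.boundary A \ G.edgeSet c := by
    intro d
    by_cases hd : d ∈ G.dartsOn (G.edgeSet c)
    · rw [cut_edge_mem_boundary_of_mem hd, hA', hA']
      refine iff_of_false (not_not.2 ?_) fun h => h.2 hd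
      change G.face d ∈ A ↔ G.opp d ∉ c
      rcases (hX d).1 hd with h | h
      · exact iff_of_true (hcA d h).1 (hM.opp_notMem d h)
      · refine iff_of_false (fun h' => ?_) (not_not.2 h)
        have := (hcA _ h).2
        rw [G.opp_opp] at this
        exact this h'
    · rw [cutFace_mem_boundary hd, hpre]
      exact ⟨fun h => ⟨h, hd⟩, fun h => h.1⟩
  have hbij : Set.BijOn (G.cutEdgeProj (G.edgeSet c)) ((G.cut (G.edgeSet c)).boundary A')
      (G.boundary A \ G.edgeSet c) := by
    refine ⟨?_, ?_, ?_⟩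
    · intro e he
      obtain ⟨d, rfl⟩ := exists_cut_edge e
      exact (hmem d).1 he
    · intro e he e' he' h
      obtain ⟨d, rfl⟩ := exists_cut_edge e
      obtain ⟨d', rfl⟩ := exists_cut_edge e'
      have hd : d ∉ G.dartsOn (G.edgeSet c) := ((hmem d).1 he).2
      rcases G.edge_eq_iff.1 (show G.edge d = G.edge d' from h) with rfl | rfl
      · rfl
      · rw [← edge_opp, cut_opp_inl, cutBase_of_notMem (by rwa [opp_mem_dartsOn_iff])]
    · intro e he
      obtain ⟨d, rfl⟩ := G.exists_edge e
      exact ⟨_, (hmem d).2 he, rfl⟩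
  refine ⟨_, hbij, ⟨A', ?_, ?_, rfl⟩, ?_⟩
  · rw [← Set.mem_preimage, hpre]; exact ha
  · rw [← Set.mem_preimage, hpre]; exact hb
  · rintro _ ⟨B, haB, hbB, rfl⟩
    rw [← weight_image_of_injOn hbij.injOn, hbij.image_eq]
    have h1 := hS.2 _ ⟨G.cutFace (G.edgeSet c) ⁻¹' B, haB, hbB, rfl⟩
    -- A competitor in the cut graph, projected to G and completed by the cycle, contains a
    -- separating subgraph of G; the cycle's weight then cancels.
    have h2 : G.boundary (G.cutFace (G.edgeSet c) ⁻¹' B) ⊆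
        G.cutEdgeProj (G.edgeSet c) '' (G.cut (G.edgeSet c)).boundary B ∪ G.edgeSet c := by
      intro e he
      obtain ⟨d, rfl⟩ := G.exists_edge e
      by_cases hd : d ∈ G.dartsOn (G.edgeSet c)
      · exact Or.inr hd
      · exact Or.inl ⟨_, (cutFace_mem_boundary hd).2 he, rfl⟩
    have h3 := weight_mono hw h2
    have h4 := weight_union_le hw
      (G.cutEdgeProj (G.edgeSet c) '' (G.cut (G.edgeSet c)).boundary B) (G.edgeSet c)
    have h5 := weight_image_le hw (G.cutEdgeProj (G.edgeSet c)) ((G.cut (G.edgeSet c)).boundary B)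
    have h6 := weight_inter_add_diff (w := w) (G.boundary A) (G.edgeSet c)
    rw [Set.inter_eq_right.2 (edgeSet_subset_boundary hcA)] at h6
    linarith

/-- Cutting inside one side of a minimum separating subgraph, with one new boundary face, keeps it
minimum separating. -/
theorem isMinSeparatingInCut_of_side {w : G.Edge → ℝ} (hw : ∀ e, 0 ≤ w e) {a b : G.Face}
    {A : Set G.Face} (hS : G.IsMinSeparating w a b (G.boundary A)) (ha : a ∈ A) (hb : b ∉ A)
    (hX : X ⊆ G.side A)
    (hf : ∀ x y : G.dartsOn X, (G.cut X).face (Sum.inr x) = (G.cut X).face (Sum.inr y)) :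
    G.IsMinSeparatingInCut w X a b (G.boundary A) := by
  -- The new boundary face is put on the side of A, so of the two copies of an edge in S ∩ X only
  -- the one incident to the face outside A is in the boundary.
  let A' := (G.cut X).faceSet (Sum.elim (fun d => G.face d ∈ A) fun _ => True)
  have hA' : ∀ y, (G.cut X).face y ∈ A' ↔ Sum.elim (fun d => G.face d ∈ A) (fun _ => True) y :=
    fun y => face_mem_cut_faceSet fun d => Iff.rfl
  have hpre : G.cutFace X ⁻¹' A' = A := by
    ext f
    obtain ⟨d, rfl⟩ := G.exists_face f
    exact hA' _
  have hmem : ∀ d, (G.cut X).edge (Sum.inl d) ∈ (G.cut X).boundary A' ↔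
      G.edge d ∈ G.boundary A ∧ (d ∈ G.dartsOn X → G.face d ∉ A) := by
    intro d
    by_cases hd : d ∈ G.dartsOn X
    · rw [cut_edge_mem_boundary_of_mem hd, hA', hA', edge_mem_boundary]
      have := edge_mem_side.1 (hX hd)
      simp only [Sum.elim_inl, Sum.elim_inr, hd, forall_const]
      tauto
    · rw [cutFace_mem_boundary hd, hpre]
      exact ⟨fun h => ⟨h, fun h' => absurd h' hd⟩, fun h => h.1⟩
  have hbij : Set.BijOn (G.cutEdgeProj X) ((G.cut X).boundary A') (G.boundary A) := by
    refine ⟨?_, ?_, ?_⟩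
    · intro e he
      obtain ⟨d, rfl⟩ := exists_cut_edge e
      exact ((hmem d).1 he).1
    · intro e he e' he' h
      obtain ⟨d, rfl⟩ := exists_cut_edge e
      obtain ⟨d', rfl⟩ := exists_cut_edge e'
      rcases G.edge_eq_iff.1 (show G.edge d = G.edge d' from h) with rfl | rfl
      · rfl
      · by_cases hd : d ∈ G.dartsOn X
        · have h1 := ((hmem _).1 he).2 hd
          have h2 := ((hmem _).1 he').2 (opp_mem_dartsOn_iff.2 hd)
          exact absurd (edge_mem_side.1 (hX hd)) (by tauto)
        · rw [← edge_opp, cut_opp_inl, cutBase_of_notMem (by rwa [opp_mem_dartsOn_iff])]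
    · rintro _ ⟨d, rfl, h1, h2⟩
      refine ⟨(G.cut X).edge (Sum.inl (G.opp d)), (hmem _).2 ⟨?_, fun _ => h2⟩, ?_⟩
      · rw [edge_opp]; exact edge_mem_boundary_of_rim ⟨h1, h2⟩
      · exact G.edge_opp d
  refine ⟨_, hbij, ⟨A', ?_, ?_, rfl⟩, ?_⟩
  · rw [← Set.mem_preimage, hpre]; exact ha
  · rw [← Set.mem_preimage, hpre]; exact hb
  · rintro _ ⟨B, haB, hbB, rfl⟩
    rw [← weight_image_of_injOn hbij.injOn, hbij.image_eq]
    refine (hS.2 _ ⟨G.cutFace X ⁻¹' B, haB, hbB, rfl⟩).trans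
      ((weight_mono hw ?_).trans (weight_image_le hw (G.cutEdgeProj X) ((G.cut X).boundary B)))
    rintro _ ⟨d, rfl, h1, h2⟩
    by_cases hd : d ∈ G.dartsOn X
    · have hd' := opp_mem_dartsOn_iff.2 hd
      have h1' : (G.cut X).face (Sum.inl d) ∈ B := h1
      have h2' : (G.cut X).face (Sum.inl (G.opp d)) ∉ B := h2
      -- The single new face borders both copies of the edge, whose old faces lie on different sides
      -- of B. Whichever side the new face is on, one copy lies in ∂B.
      by_cases hfB : (G.cut X).face (Sum.inr ⟨G.opp d, hd'⟩) ∈ B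
      · refine ⟨(G.cut X).edge (Sum.inl (G.opp d)), (cut_edge_mem_boundary_of_mem hd').2 ?_,
          G.edge_opp d⟩
        rw [hf _ ⟨G.opp d, hd'⟩]
        tauto
      · refine ⟨(G.cut X).edge (Sum.inl d), (cut_edge_mem_boundary_of_mem hd).2 ?_, rfl⟩
        tauto
    · exact ⟨_, (cutFace_mem_boundary hd).2 (edge_mem_boundary_of_rim ⟨h1, h2⟩), rfl⟩

end Cut

end EmbeddedGraph

/-! ### Crossings, splitting along a cycle, and the exchange argument -/

namespace EmbeddedGraph

variable {D : Type*} {G : EmbeddedGraph D}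

/-! ### Subgraphs on one side do not cross -/

section Crossing

variable [Finite D]

theorem contractRot_spec (T : Set G.Edge) (x : G.dartsOff T) :
    ∃ n : ℕ, (G.contractRot T x : D) = (G.facePerm ^ (n + 1)) (G.opp x) ∧
      ∀ m < n, G.edge ((G.facePerm ^ (m + 1)) (G.opp x)) ∈ T := by
  obtain ⟨n, h1, h2⟩ := firstReturn_spec G.facePerm (G.dartsOff T) (G.oppOff T x)
  exact ⟨n, h1, fun m hm => not_not.1 (h2 m hm)⟩

theorem face_contractRot (T : Set G.Edge) (x : G.dartsOff T) :
    G.face (G.contractRot T x) = G.face (G.opp x) := by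
  obtain ⟨n, h1, -⟩ := contractRot_spec T x
  rw [h1, face_eq_iff, Equiv.Perm.sameCycle_pow_left]

/-- A contracted rotation step follows a face through edges of `T` only, so it cannot leave a vertex
set that no edge of `T` leaves. -/
theorem tail_contractRot_mem {T : Set G.Edge} {U : Set G.Vertex}
    (hU : ∀ d, G.edge d ∈ T → (G.tail d ∈ U ↔ G.head d ∈ U)) (x : G.dartsOff T) :
    G.tail (G.contractRot T x) ∈ U ↔ G.tail (x : D) ∈ U := by
  obtain ⟨n, h1, h2⟩ := contractRot_spec T x
  rw [h1]
  have key : ∀ m ≤ n, (G.tail ((G.facePerm ^ (m + 1)) (G.opp x)) ∈ U ↔ G.tail (x : D) ∈ U) := by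
    intro m
    induction m with
    | zero => intro _; rw [zero_add, pow_one, tail_facePerm, head_opp]
    | succ m ih =>
      intro hm
      rw [pow_succ', Equiv.Perm.mul_apply, tail_facePerm, ← hU _ (h2 m (by omega)), ih (by omega)]
  exact key n le_rfl

/-- Contracting edges of a simple cycle leaves at most one outgoing dart of it at each vertex. -/
theorem eq_of_contractRot_pow {M : Set D} (hM : Set.InjOn G.tail M) {T : Set G.Edge}
    (hT : ∀ d, G.edge d ∈ T → d ∈ M ∨ G.opp d ∈ M) {x y : G.dartsOff T} {n : ℕ}
    (hn : (G.contractRot T ^ n) x = y) (hx : (x : D) ∈ M) (hy : (y : D) ∈ M) : x = y := by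
  let R : D → D → Prop := fun m m' => G.edge m ∈ T ∧ m' ∈ M ∧ G.head m = G.tail m'
  -- The vertices of the cycle from which contracted edges, followed forwards, lead to `x`. No edge
  -- of `T` leaves this set, and a dart outside `T` starting in it must be `x` itself.
  let U : Set G.Vertex := {v | ∃ m ∈ M, G.tail m = v ∧ Relation.ReflTransGen R m x}
  have hU' : ∀ d ∈ M, G.edge d ∈ T → (G.tail d ∈ U ↔ G.head d ∈ U) := by
    intro d hd hdT
    constructor
    · rintro ⟨m, hm, hmt, hr⟩
      obtain rfl := hM hm hd hmt
      rcases Relation.ReflTransGen.cases_head hr with h | ⟨m', ⟨-, h2, h3⟩, h4⟩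
      · exact absurd hdT (h ▸ x.2)
      · exact ⟨m', h2, h3.symm, h4⟩
    · rintro ⟨m, hm, hmt, hr⟩
      exact ⟨d, hd, rfl, Relation.ReflTransGen.head ⟨hdT, hm, hmt.symm⟩ hr⟩
  have hU : ∀ d, G.edge d ∈ T → (G.tail d ∈ U ↔ G.head d ∈ U) := by
    intro d hdT
    rcases hT d hdT with h | h
    · exact hU' d h hdT
    · have := hU' _ h (by rwa [edge_opp])
      rw [head_opp, tail_opp] at this
      exact this.symm
  have hpow : ∀ k : ℕ, G.tail ((G.contractRot T ^ k) x : D) ∈ U := by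
    intro k
    induction k with
    | zero => exact ⟨x, hx, rfl, Relation.ReflTransGen.refl⟩
    | succ k ih => rw [pow_succ', Equiv.Perm.mul_apply, tail_contractRot_mem hU]; exact ih
  obtain ⟨m, hm, hmt, hr⟩ := hn ▸ hpow n
  obtain rfl := hM hm hy hmt
  rcases Relation.ReflTransGen.cases_head hr with h | ⟨m', h, -⟩
  · exact Subtype.ext h.symm
  · exact absurd h.1 y.2

/-- Around a contracted vertex the sectors change between A and its complement only at darts of S,
and at most one rim dart leaves and at most one enters there. So the S-darts at positions i and k
have opposite orientations. If the one at i is a rim dart, all sectors from i to k lie outside A,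
and the H-dart at j touches no face of A; otherwise all sectors from 0 to i lie outside A, and the
H-dart at 0 touches none. -/
theorem not_crosses_of_side {A : Set G.Face} (hA : G.DiCycle (G.rim A)) {H : Set G.Edge}
    (hH : H ⊆ G.side A) : ¬ G.Crosses H (G.boundary A) := by
  rintro ⟨T, hT, d, i, j, k, hi, hij, hjk, hne, hd, hsi, hhj, hsk⟩
  set ρ := G.contractRot T with hρ
  have hT1 : ∀ d, G.edge d ∈ T → d ∈ G.rim A ∨ G.opp d ∈ G.rim A :=
    fun d h => edge_mem_boundary_iff_rim.1 (hT h).2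
  have hT2 : ∀ d, G.edge d ∈ T → d ∈ {d | G.opp d ∈ G.rim A} ∨ G.opp d ∈ {d | G.opp d ∈ G.rim A} := by
    intro d h
    rw [Set.mem_ofPred_eq, Set.mem_ofPred_eq, G.opp_opp]
    exact (hT1 d h).symm
  have hinj : ∀ m l, m < l → l ≤ k → (ρ ^ m) d ≠ (ρ ^ l) d := by
    intro m l hml hlk h
    obtain ⟨t, rfl⟩ := Nat.exists_eq_add_of_lt hml
    rw [show m + t + 1 = m + (t + 1) by ring, pow_add, Equiv.Perm.mul_apply] at h
    exact hne (t + 1) (by omega) (by omega) ((ρ ^ m).injective h).symm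
  have hshift : ∀ m l, m ≤ l → (ρ ^ (l - m)) ((ρ ^ m) d) = (ρ ^ l) d := by
    intro m l h
    rw [← Equiv.Perm.mul_apply, ← pow_add, Nat.sub_add_cancel h]
  have huniq1 : ∀ m l, m < l → l ≤ k → ((ρ ^ m) d : D) ∈ G.rim A → ((ρ ^ l) d : D) ∉ G.rim A :=
    fun m l h h' h1 h2 => hinj m l h h' (eq_of_contractRot_pow hA.tail_inj hT1 (hshift m l h.le) h1 h2)
  have huniq2 : ∀ m l, m < l → l ≤ k → G.opp ((ρ ^ m) d : D) ∈ G.rim A →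
      G.opp ((ρ ^ l) d : D) ∉ G.rim A :=
    fun m l h h' h1 h2 => hinj m l h h'
      (eq_of_contractRot_pow hA.reverse.tail_inj hT2 (hshift m l h.le) h1 h2)
  have hface : ∀ m, G.face ((ρ ^ (m + 1)) d : D) = G.face (G.opp ((ρ ^ m) d : D)) := by
    intro m
    rw [pow_succ', Equiv.Perm.mul_apply, hρ, face_contractRot]
  have hrim : ∀ x : D, x ∈ G.rim A ↔ G.face x ∈ A ∧ G.face (G.opp x) ∉ A := fun _ => Iff.rfl
  have hrim' : ∀ x : D, G.opp x ∈ G.rim A ↔ G.face (G.opp x) ∈ A ∧ G.face x ∉ A := by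
    intro x; rw [hrim, G.opp_opp]
  rcases edge_mem_boundary_iff_rim.1 hsi with h | h
  · have key : ∀ m, i < m → m ≤ k → G.face ((ρ ^ m) d : D) ∉ A := by
      intro m him
      induction m, him using Nat.le_induction with
      | base => intro _; rw [Nat.succ_eq_add_one, hface]; exact h.2
      | succ m him ih =>
        intro hm
        rw [hface]
        intro hin
        have h1 : G.opp ((ρ ^ m) d : D) ∈ G.rim A := (hrim' _).2 ⟨hin, ih (by omega)⟩
        rcases edge_mem_boundary_iff_rim.1 hsk with h2 | h2
        · exact huniq1 i k (by omega) le_rfl h h2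
        · exact huniq2 m k (by omega) le_rfl h1 h2
    rcases edge_mem_side.1 (hH hhj) with h1 | h1
    · exact key j hij (by omega) h1
    · rw [← hface] at h1
      exact key (j + 1) (by omega) (by omega) h1
  · rcases edge_mem_boundary_iff_rim.1 hsk with h2 | h2
    · have hno : ∀ m < k, ((ρ ^ m) d : D) ∉ G.rim A := fun m hm h1 => huniq1 m k hm le_rfl h1 h2
      have key : ∀ m ≤ i, G.face ((ρ ^ (i - m)) d : D) ∉ A := by
        intro m
        induction m with
        | zero => intro _; exact ((hrim' _).1 h).2
        | succ m ih =>
          intro hm hin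
          refine hno (i - (m + 1)) (by omega) ((hrim _).2 ⟨hin, ?_⟩)
          rw [← hface, show i - (m + 1) + 1 = i - m by omega]
          exact ih (by omega)
      rcases edge_mem_side.1 (hH hd) with h1 | h1
      · refine key i le_rfl ?_
        rw [Nat.sub_self]; exact h1
      · refine key (i - 1) (by omega) ?_
        rw [show i - (i - 1) = 0 + 1 by omega, hface]; exact h1
    · exact huniq2 i k (by omega) le_rfl h h2

end Crossing

/-! ### Splitting an even subgraph along a separating cycle -/

/-- An arc of the cycle joins each required vertex to a fixed base point, and the arcs are added
modulo two. Their number is even, so the base point cancels. -/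
theorem exists_join [Finite D] {M : Set D} (hM : G.DiCycle M) {S : Set G.Edge}
    (hMS : ∀ d ∈ M, G.edge d ∈ S) {f : G.Vertex → ZMod 2}
    (hf : ∀ v, f v ≠ 0 → ∃ d ∈ M, G.tail d = v) (hsum : ∀ [Fintype G.Vertex], ∑ v, f v = 0) :
    ∃ T ⊆ S, G.deg T = f := by
  classical
  have := Fintype.ofFinite G.Vertex
  obtain ⟨d₀, hd₀⟩ := hM.nonempty
  have hone : ∀ d ∈ M, ∃ T ⊆ S, G.deg T = pt (G.tail d) + pt (G.tail d₀) := by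
    refine hM.induction hd₀ ⟨∅, by simp, by rw [deg_empty, pt_add_self]⟩ ?_
    rintro d hd d' - h ⟨T, hTS, hT⟩
    refine ⟨symmDiff {G.edge d} T, ?_, ?_⟩
    · refine symmDiff_le_sup.trans (Set.union_subset ?_ hTS)
      exact Set.singleton_subset_iff.2 (hMS d hd)
    · rw [deg_symmDiff, deg_singleton, hT, ← h, add_comm (pt (G.tail d)) (pt (G.head d)), add_assoc,
        ← add_assoc (pt (G.tail d)), pt_add_self, zero_add]
  have hmany : ∀ s : Finset G.Vertex, (∀ v ∈ s, ∃ d ∈ M, G.tail d = v) →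
      ∃ T ⊆ S, G.deg T = ∑ v ∈ s, (pt v + pt (G.tail d₀)) := by
    intro s
    induction s using Finset.induction_on with
    | empty => intro _; exact ⟨∅, by simp, by rw [deg_empty, Finset.sum_empty]⟩
    | insert v s hv ih =>
      intro hs
      obtain ⟨T, hTS, hT⟩ := ih fun v hv => hs v (Finset.mem_insert_of_mem hv)
      obtain ⟨d, hd, rfl⟩ := hs v (Finset.mem_insert_self _ _)
      obtain ⟨T', hTS', hT'⟩ := hone d hd
      refine ⟨symmDiff T' T, symmDiff_le_sup.trans (Set.union_subset hTS' hTS), ?_⟩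
      rw [Finset.sum_insert hv, deg_symmDiff, hT, hT']
  obtain ⟨T, hTS, hT⟩ := hmany {v | f v ≠ 0} (by simpa using hf)
  refine ⟨T, hTS, hT.trans ?_⟩
  have hb : ∀ t : ZMod 2, t ≠ 0 → t = 1 := by decide
  have hsum' : ∑ v with f v ≠ 0, (1 : ZMod 2) = 0 := by
    have h1 : ∑ v with f v ≠ 0, f v = 0 := by rw [Finset.sum_filter_ne_zero, hsum]
    refine Eq.trans ?_ h1
    exact Finset.sum_congr rfl fun v hv => (hb _ (Finset.mem_filter.1 hv).2).symm
  funext u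
  rw [Finset.sum_add_distrib, Pi.add_apply, Finset.sum_apply, Finset.sum_apply]
  have e1 : ∑ v with f v ≠ 0, pt (G.tail d₀) u = (0 : ZMod 2) := by
    have h1 := congrArg (pt (G.tail d₀) u * ·) hsum'
    simpa only [Finset.mul_sum, mul_one, mul_zero] using h1
  have e2 : ∑ v with f v ≠ 0, pt v u = f u := by
    simp only [pt, Pi.single_apply, Finset.sum_ite_eq, Finset.mem_filter, Finset.mem_univ, true_and]
    by_cases h : f u = 0
    · simp [h]
    · simp [hb _ h]
  rw [e1, e2, add_zero]

theorem face_mem_iff_of_tail_eq {A : Set G.Face} {v : G.Vertex}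
    (hv : ∀ d, G.tail d = v → G.edge d ∉ G.boundary A) {d d' : D} (hd : G.tail d = v)
    (hd' : G.tail d' = v) : G.face d ∈ A ↔ G.face d' ∈ A := by
  have h := (G.tail_eq_iff.1 (hd.trans hd'.symm)).map_eq
    (fun x => G.tail x = v ∧ G.face x ∈ A) (fun x => by
      rw [tail_rot, face_rot]
      refine propext (and_congr_right fun hx => ?_)
      have := hv x hx
      rw [edge_mem_boundary, not_not] at this
      exact this.symm)
  simpa [hd, hd'] using h

/-- Let `I` be the part of `Y` strictly inside A. Around a vertex off S all sectors are in A or none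
is, so `I` has there either the degree of `Y` or degree zero; its odd vertices thus lie on the cycle
S, and some T ⊆ S makes I ⊕ T even. Then I ⊕ T and Y ⊕ I ⊕ T lie on the two sides, and not both are
null-homologous, as their sum is Y. -/
theorem exists_even_side_not_null [Finite D] {A : Set G.Face} (hA : G.DiCycle (G.rim A))
    {Y : Set G.Edge} (hY : G.deg Y = 0) (hn : ¬ G.IsNullHomologous Y) :
    (∃ Y ⊆ G.side A, G.deg Y = 0 ∧ ¬ G.IsNullHomologous Y) ∨
      ∃ Y ⊆ G.side Aᶜ, G.deg Y = 0 ∧ ¬ G.IsNullHomologous Y := by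
  let I : Set G.Edge := Y ∩ (G.side A \ G.boundary A)
  have hmemI : ∀ d, G.edge d ∈ G.side A \ G.boundary A ↔ G.face d ∈ A ∧ G.face (G.opp d) ∈ A := by
    intro d
    rw [Set.mem_sdiff, edge_mem_side, edge_mem_boundary]; tauto
  obtain ⟨T, hTS, hT⟩ := exists_join hA (S := G.boundary A) (f := G.deg I)
    (fun d hd => edge_mem_boundary_of_rim hd) (by
      intro v hv
      by_contra! hcon
      have hvS : ∀ d, G.tail d = v → G.edge d ∉ G.boundary A := by
        intro d hd hb
        rcases edge_mem_boundary_iff_rim.1 hb with h | h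
        · exact hcon d h hd
        · obtain ⟨d', h1, h2⟩ := hA.next _ h
          exact hcon d' h1 (by rw [← h2, head_opp, hd])
      obtain ⟨d₀, hd₀⟩ := G.exists_tail v
      apply hv
      by_cases hf : G.face d₀ ∈ A
      · refine Eq.trans ?_ (congrFun hY v)
        rw [deg, deg]
        congr 2
        ext d
        refine and_congr_right fun hd => ⟨fun h => h.1, fun h => ⟨h, (hmemI d).2 ?_⟩⟩
        have h1 : G.face d ∈ A := (face_mem_iff_of_tail_eq hvS hd₀ hd).1 hf
        have h2 := hvS d hd
        rw [edge_mem_boundary] at h2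
        exact ⟨h1, by tauto⟩
      · rw [deg]
        have : ({d | G.tail d = v ∧ G.edge d ∈ I} : Set D) = ∅ := by
          ext d
          refine iff_of_false ?_ (Set.notMem_empty d)
          rintro ⟨hd, h⟩
          exact hf ((face_mem_iff_of_tail_eq hvS hd₀ hd).2 ((hmemI d).1 h.2).1)
        rw [this]; simp)
    (by intro _; exact sum_deg_eq_zero I Finset.univ fun _ _ _ => Finset.mem_univ _)
  have hI1 : symmDiff I T ⊆ G.side A :=
    symmDiff_le_sup.trans (Set.union_subset (fun e he => he.2.1)
      (hTS.trans (boundary_subset_side A)))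
  have hd1 : G.deg (symmDiff I T) = 0 := by
    rw [deg_symmDiff, hT]; funext v; exact CharTwo.add_self_eq_zero (G.deg I v)
  by_cases h1 : G.IsNullHomologous (symmDiff I T)
  · right
    refine ⟨symmDiff Y (symmDiff I T), ?_, by rw [deg_symmDiff, hY, hd1, add_zero], fun h2 => hn ?_⟩
    · intro e he
      obtain ⟨d, rfl⟩ := G.exists_edge e
      by_contra hne
      have hne' : G.face d ∈ A ∧ G.face (G.opp d) ∈ A := by
        rw [edge_mem_side, Set.mem_compl_iff, Set.mem_compl_iff] at hne; tauto
      have hnT : G.edge d ∉ T := fun h => by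
        have := hTS h
        rw [edge_mem_boundary] at this; tauto
      have hI : G.edge d ∈ I ↔ G.edge d ∈ Y := ⟨fun h => h.1, fun h => ⟨h, (hmemI d).2 hne'⟩⟩
      simp only [Set.mem_symmDiff] at he
      tauto
    · have := h2.symmDiff h1
      rwa [symmDiff_symmDiff_cancel_right] at this
  · exact Or.inl ⟨_, hI1, hd1, h1⟩

/-! ### Pushing subgraphs to one side -/

/-- If face sets can be replaced by ones that agree outside `E` and are cheaper inside `E` than
outside, then an edge set homologous to a subset of `E` can be pushed into `E`. -/
theorem exists_push [Finite D] {w : G.Edge → ℝ} (hw : ∀ e, 0 ≤ w e) {E : Set G.Edge}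
    (hE : ∀ B : Set G.Face, ∃ R : Set G.Face,
      (∀ e ∉ E, e ∈ G.boundary R ↔ e ∈ G.boundary B) ∧
      G.weight w (G.boundary R ∩ E) ≤ G.weight w (G.boundary R \ E))
    {Z₀ Z₁ : Set G.Edge} (h₀ : Z₀ ⊆ E) (h : G.Homologous Z₀ Z₁) :
    ∃ R : Set G.Face, symmDiff Z₁ (G.boundary R) ⊆ E ∧
      G.weight w (symmDiff Z₁ (G.boundary R)) ≤ G.weight w Z₁ := by
  obtain ⟨B, hB⟩ := h
  obtain ⟨R, hR, hle⟩ := hE B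
  have hout : ∀ e ∉ E, e ∈ G.boundary R ↔ e ∈ Z₁ := by
    intro e he
    rw [hR e he, ← hB, Set.mem_symmDiff]
    have : e ∉ Z₀ := fun h => he (h₀ h)
    tauto
  have hsub : symmDiff Z₁ (G.boundary R) ⊆ E := by
    intro e he
    by_contra hne
    have := hout e hne
    rw [Set.mem_symmDiff] at he
    tauto
  refine ⟨R, hsub, ?_⟩
  -- Inside `E` the push adds at most ∂R ∩ E. Outside `E` it removes Z₁ \ E, which equals ∂R \ E and
  -- weighs at least as much.
  have h1 : symmDiff Z₁ (G.boundary R) ⊆ (Z₁ ∩ E) ∪ (G.boundary R ∩ E) := by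
    intro e he
    have h2 := hsub he
    rw [Set.mem_symmDiff] at he
    simp only [Set.mem_union, Set.mem_inter_iff]
    tauto
  have h2 : Z₁ \ E = G.boundary R \ E := by
    ext e
    exact ⟨fun h => ⟨(hout e h.2).2 h.1, h.2⟩, fun h => ⟨(hout e h.2).1 h.1, h.2⟩⟩
  have h3 := weight_mono hw h1
  have h4 := weight_union_le hw (Z₁ ∩ E) (G.boundary R ∩ E)
  have h5 := weight_inter_add_diff (w := w) Z₁ E
  rw [h2] at h5
  linarith

/-- Compare S with the boundary of Aᶜ \ R, which still separates b from a. Passing to it gives up S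
∩ ∂R and costs at most ∂R \ side A. As R avoids A, the edges of ∂R in the side of A all belong to S.
-/
theorem weight_boundary_inter_side_le [Finite D] {w : G.Edge → ℝ} (hw : ∀ e, 0 ≤ w e) {a b : G.Face}
    {A : Set G.Face} (hS : G.IsMinSeparating w a b (G.boundary A)) (ha : a ∈ A) (hb : b ∉ A)
    {R : Set G.Face} (hR : R ⊆ Aᶜ) (hbR : b ∉ R) :
    G.weight w (G.boundary R ∩ G.side A) ≤ G.weight w (G.boundary R \ G.side A) := by
  have h1 := hS.2 _ (IsSeparating.symm ⟨Aᶜ \ R, ⟨hb, hbR⟩, fun h => h.1 ha, rfl⟩)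
  have h2 : G.boundary (Aᶜ \ R) ⊆ (G.boundary R \ G.side A) ∪ (G.boundary A \ G.boundary R) := by
    intro e he
    obtain ⟨d, rfl⟩ := G.exists_edge e
    have r1 := @hR (G.face d)
    have r2 := @hR (G.face (G.opp d))
    simp only [Set.mem_union, Set.mem_sdiff, edge_mem_boundary, edge_mem_side,
      Set.mem_compl_iff] at he r1 r2 ⊢
    tauto
  have h3 : G.boundary R ∩ G.side A ⊆ G.boundary A ∩ G.boundary R := by
    intro e he
    obtain ⟨d, rfl⟩ := G.exists_edge e
    have r1 := @hR (G.face d)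
    have r2 := @hR (G.face (G.opp d))
    simp only [Set.mem_inter_iff, edge_mem_boundary, edge_mem_side,
      Set.mem_compl_iff] at he r1 r2 ⊢
    tauto
  have h4 := weight_mono hw h2
  have h5 := weight_union_le hw (G.boundary R \ G.side A) (G.boundary A \ G.boundary R)
  have h6 := weight_inter_add_diff (w := w) (G.boundary A) (G.boundary R)
  have h7 := weight_mono hw h3
  linarith

/-- Any set of faces can be replaced by one outside `A ∪ {b}` with the same boundary away from
`A`. -/
theorem exists_subset_compl {A : Set G.Face} (b : G.Face) (B : Set G.Face) :
    ∃ R ⊆ Aᶜ, b ∉ R ∧ ∀ f ∉ A, ∀ f' ∉ A, ¬ (f ∈ R ↔ f' ∈ R) ↔ ¬ (f ∈ B ↔ f' ∈ B) := by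
  -- Complementing within Aᶜ keeps the boundary away from A, so R can be made to avoid b.
  by_cases hbB : b ∈ B
  · refine ⟨Aᶜ \ B, Set.sdiff_subset, fun h => h.2 hbB, fun f hf f' hf' => ?_⟩
    simp only [Set.mem_sdiff, Set.mem_compl_iff]; tauto
  · refine ⟨Aᶜ ∩ B, Set.inter_subset_left, fun h => hbB h.2, fun f hf f' hf' => ?_⟩
    simp only [Set.mem_inter_iff, Set.mem_compl_iff]; tauto

theorem exists_push_side [Finite D] {w : G.Edge → ℝ} (hw : ∀ e, 0 ≤ w e) {a b : G.Face}
    {A : Set G.Face} (hS : G.IsMinSeparating w a b (G.boundary A)) (ha : a ∈ A) (hb : b ∉ A)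
    (B : Set G.Face) : ∃ R : Set G.Face,
      (∀ e ∉ G.side A, e ∈ G.boundary R ↔ e ∈ G.boundary B) ∧
      G.weight w (G.boundary R ∩ G.side A) ≤ G.weight w (G.boundary R \ G.side A) := by
  obtain ⟨R, h1, h2, h3⟩ := exists_subset_compl b B
  refine ⟨R, fun e he => ?_, weight_boundary_inter_side_le hw hS ha hb h1 h2⟩
  obtain ⟨d, rfl⟩ := G.exists_edge e
  rw [edge_mem_side, not_or] at he
  rw [edge_mem_boundary, edge_mem_boundary, h3 _ he.1 _ he.2]

theorem finite_setOf_nodup_map {α β : Type*} (f : α → β) [Finite α] :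
    {l : List α | (l.map f).Nodup}.Finite := by
  classical
  have := Fintype.ofFinite α
  have h : {l : List α | l.Nodup}.Finite :=
    Set.finite_coe_iff.1 (inferInstanceAs (Finite {l : List α // l.Nodup}))
  exact h.subset fun l hl => hl.of_map

/-- Take a lightest non-null-homologous simple cycle in the side. A closed walk homologous to it can
be pushed into the side; the result is even and nontrivial, hence contains a competitor. -/
theorem exists_isTightCycle_side [Finite D] {w : G.Edge → ℝ} (hw : ∀ e, 0 ≤ w e) {a b : G.Face}
    {A : Set G.Face} (hS : G.IsMinSeparating w a b (G.boundary A)) (ha : a ∈ A) (hb : b ∉ A)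
    {Y : Set G.Edge} (hYA : Y ⊆ G.side A) (hY : G.deg Y = 0) (hn : ¬ G.IsNullHomologous Y) :
    ∃ c, G.IsTightCycle w c ∧ G.edgeSet c ⊆ G.side A ∧ ¬ G.IsNullHomologous (G.edgeSet c) := by
  let Q : Set (List D) := {c | G.IsSimpleCycle c ∧ G.edgeSet c ⊆ G.side A ∧
    ¬ G.IsNullHomologous (G.edgeSet c)}
  have hQf : Q.Finite := (finite_setOf_nodup_map G.edge).subset fun c hc => hc.1.2.2.2
  have hext : ∀ Y ⊆ G.side A, G.deg Y = 0 → ¬ G.IsNullHomologous Y → ∃ c ∈ Q, G.edgeSet c ⊆ Y := by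
    intro Y hYA hY hn
    obtain ⟨c, h1, h2, h3⟩ := exists_isSimpleCycle_of_even_of_not_null hY hn
    exact ⟨c, ⟨h1, h2.trans hYA, h3⟩, h2⟩
  obtain ⟨c, hcQ, -⟩ := hext Y hYA hY hn
  obtain ⟨c, ⟨hc, hcA, hcn⟩, hmin⟩ := Set.exists_min_image Q (G.walkWeight w) hQf ⟨c, hcQ⟩
  refine ⟨c, ⟨hc, fun c' hc' hh => ?_⟩, hcA, hcn⟩
  rw [hc.chain_eq] at hh
  obtain ⟨R, hR, hle⟩ := exists_push hw (exists_push_side hw hS ha hb) hcA hh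
  obtain ⟨c'', hc'', hsub⟩ := hext _ hR
    (by rw [deg_symmDiff, deg_chain_closed hc', deg_boundary, add_zero]) (by
      intro h
      apply hcn
      have h1 := h.symmDiff (⟨R, rfl⟩ : G.IsNullHomologous (G.boundary R))
      rw [symmDiff_symmDiff_cancel_right] at h1
      have h2 := IsNullHomologous.symmDiff hh h1
      rwa [symmDiff_symmDiff_cancel_right] at h2)
  have h1 := hmin _ hc''
  rw [walkWeight_eq hc''.1.2.2.2] at h1
  exact h1.trans ((weight_mono hw hsub).trans (hle.trans (weight_chain_le hw c')))

end EmbeddedGraph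

theorem perm_pow_inv_pow {α : Type*} (f : Equiv.Perm α) (k : ℕ) (x : α) :
    (f ^ k) ((f⁻¹ ^ k) x) = x := by
  rw [inv_pow, ← Equiv.Perm.mul_apply, mul_inv_cancel, Equiv.Perm.one_apply]

theorem perm_inv_pow_pow {α : Type*} (f : Equiv.Perm α) (k : ℕ) (x : α) :
    (f⁻¹ ^ k) ((f ^ k) x) = x := by
  rw [inv_pow, ← Equiv.Perm.mul_apply, inv_mul_cancel, Equiv.Perm.one_apply]

/-! ### Vertices, faces, connectivity and genus of the cut graph -/

namespace EmbeddedGraph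

variable {D : Type*} {G : EmbeddedGraph D}

theorem IsWalk.reverse {u v : G.Vertex} {p : List D} (h : G.IsWalk u p v) :
    G.IsWalk v (p.map G.opp).reverse u := by
  induction p generalizing u with
  | nil => exact h.symm
  | cons d p ih =>
    obtain ⟨rfl, h⟩ := h
    rw [List.map_cons, List.reverse_cons, isWalk_append]
    exact ⟨_, ih h, rfl, G.head_opp d⟩

section CutStructure

variable [Finite D] {X : Set G.Edge}

/-! ### Vertices and faces of the cut graph -/

theorem tail_cutBase {d : D} {n : ℕ} (h : ∀ m, 0 < m → m ≤ n → (G.rot ^ m) d ∉ G.dartsOn X) :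
    (G.cut X).tail (G.cutBase X d) = (G.cut X).tail (Sum.inl ((G.rot ^ (n + 1)) d)) := by
  induction n with
  | zero => rw [zero_add, pow_one, ← cut_rot_base, tail_rot]
  | succ n ih =>
    rw [ih fun m h1 h2 => h m h1 (by omega), pow_succ' G.rot (n + 1), Equiv.Perm.mul_apply,
      ← cut_rot_base, tail_rot, cutBase_of_notMem (h (n + 1) (by omega) le_rfl)]

/-- Turning back from `e` to the previous dart of `s` passes no dart of `X` in between, so it stays
in one sector. The set `s` may exceed the darts of `X`: it is also used with one extra dart, and
with the darts of a larger edge set. -/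
theorem tail_firstReturn {s : Set D} (hs : G.dartsOn X ⊆ s) (e : s) :
    (G.cut X).tail (G.cutBase X (firstReturn G.rot⁻¹ s e)) = (G.cut X).tail (Sum.inl (e : D)) := by
  obtain ⟨n, h1, h2⟩ := firstReturn_spec G.rot⁻¹ s e
  have hback : ∀ k ≤ n + 1, (G.rot ^ k) (firstReturn G.rot⁻¹ s e : D) =
      (G.rot⁻¹ ^ (n + 1 - k)) (e : D) := by
    intro k hk
    rw [h1, ← Nat.sub_add_cancel hk]
    generalize n + 1 - k = j
    rw [Nat.add_sub_cancel, add_comm j k, pow_add, Equiv.Perm.mul_apply, perm_pow_inv_pow]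
  rw [tail_cutBase (n := n), hback _ le_rfl]
  · simp
  · intro m hm1 hm2 hin
    rw [hback m (by omega), show n + 1 - m = (n - m) + 1 by omega] at hin
    exact h2 (n - m) (by omega) (hs hin)

theorem exists_tail_inr {d x : D} (hx : x ∈ G.dartsOn X) (h : G.tail d = G.tail x) :
    ∃ x : G.dartsOn X, (G.cut X).tail (Sum.inl d) = (G.cut X).tail (Sum.inr x) := by
  have hd : d ∈ insert d (G.dartsOn X) := Set.mem_insert _ _
  have h1 := tail_firstReturn (Set.subset_insert d (G.dartsOn X)) ⟨d, hd⟩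
  rcases (firstReturn G.rot⁻¹ (insert d (G.dartsOn X)) ⟨d, hd⟩).2 with h2 | h2
  · have h3 := eq_of_firstReturn_eq_self _ _ _ (Subtype.ext h2) (Set.mem_insert_of_mem d hx)
      (by rw [Equiv.Perm.sameCycle_inv, ← tail_eq_iff]; exact h)
    have hdX : d ∈ G.dartsOn X := (show x = d from h3) ▸ hx
    rw [h2, cutBase_of_mem hdX] at h1
    exact ⟨_, h1.symm⟩
  · rw [cutBase_of_mem h2] at h1
    exact ⟨_, h1.symm⟩

theorem tail_inl_eq {d d' : D} (hd : ∀ x ∈ G.dartsOn X, G.tail x ≠ G.tail d)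
    (h : G.tail d = G.tail d') : (G.cut X).tail (Sum.inl d) = (G.cut X).tail (Sum.inl d') := by
  obtain ⟨k, rfl⟩ := (G.tail_eq_iff.1 h).exists_nat_pow_eq
  clear h
  induction k with
  | zero => rfl
  | succ k ih =>
    rw [ih, pow_succ', Equiv.Perm.mul_apply, ← cut_rot_base, tail_rot, cutBase_of_notMem]
    exact fun hk => hd _ hk (G.tail_rot_pow k d)

theorem mem_of_sameCycle_of_forward {α : Type*} [Finite α] {f : Equiv.Perm α} {s : Set α}
    (hs : ∀ x ∈ s, f x ∈ s) {x y : α} (hx : x ∈ s) (h : f.SameCycle x y) : y ∈ s := by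
  obtain ⟨k, rfl⟩ := h.exists_nat_pow_eq
  clear h
  induction k with
  | zero => exact hx
  | succ k ih => rw [pow_succ', Equiv.Perm.mul_apply]; exact hs _ ih

/-- The set `s` below is the sector that starts at `x`: `inr x`, then the darts after x up to and
including the next dart of X, from which the rotation returns to `inr x`. It holds no other new
dart. -/
theorem tail_inr_injective {x x' : G.dartsOn X}
    (h : (G.cut X).tail (Sum.inr x) = (G.cut X).tail (Sum.inr x')) : x = x' := by
  let s : Set (G.CutDart X) := {y | y = Sum.inr x ∨ ∃ n : ℕ, y = Sum.inl ((G.rot ^ (n + 1)) (x : D)) ∧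
    ∀ m, 0 < m → m ≤ n → (G.rot ^ m) (x : D) ∉ G.dartsOn X}
  have hs : ∀ y ∈ s, (G.cut X).rot y ∈ s := by
    rintro y (rfl | ⟨n, rfl, hn⟩)
    · right
      refine ⟨0, ?_, fun m h1 h2 => absurd h2 (by omega)⟩
      rw [zero_add, pow_one, ← cut_rot_base, cutBase_of_mem x.2]
    · by_cases hd : (G.rot ^ (n + 1)) (x : D) ∈ G.dartsOn X
      · left
        rw [cut_rot_inl_of_mem hd]
        congr 1
        obtain ⟨k, h1, h2⟩ := firstReturn_spec G.rot⁻¹ (G.dartsOn X) ⟨_, hd⟩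
        have hback : ∀ j ≤ n + 1, (G.rot⁻¹ ^ j) ((G.rot ^ (n + 1)) (x : D)) =
            (G.rot ^ (n + 1 - j)) (x : D) := by
          intro j hj
          conv_lhs => rw [← Nat.sub_add_cancel hj]
          rw [add_comm, pow_add, Equiv.Perm.mul_apply, perm_inv_pow_pow]
        have hkn : k = n := by
          by_contra hne
          rcases lt_or_gt_of_ne hne with hlt | hlt
          · have h3 := (firstReturn G.rot⁻¹ (G.dartsOn X) ⟨_, hd⟩).2
            rw [h1, hback _ (by omega)] at h3
            exact hn _ (by omega) (by omega) h3
          · apply h2 n hlt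
            change (G.rot⁻¹ ^ (n + 1)) ((G.rot ^ (n + 1)) (x : D)) ∈ _
            rw [hback _ le_rfl]
            simp
        apply Subtype.ext
        rw [h1, hkn, hback _ le_rfl]
        simp
      · right
        refine ⟨n + 1, ?_, ?_⟩
        · rw [pow_succ' G.rot (n + 1), Equiv.Perm.mul_apply, ← cut_rot_base, cutBase_of_notMem hd]
        · intro m h1 h2
          rcases Nat.lt_or_ge m (n + 1) with h3 | h3
          · exact hn m h1 (by omega)
          · rwa [show m = n + 1 by omega]
  rcases mem_of_sameCycle_of_forward hs (Or.inl rfl) ((G.cut X).tail_eq_iff.1 h) with h1 | ⟨n, h1, -⟩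
  · exact (Sum.inr_injective h1).symm
  · exact absurd h1 (by simp)

theorem tail_cutDartProj {y y' : G.CutDart X} (h : (G.cut X).tail y = (G.cut X).tail y') :
    G.tail (G.cutDartProj X y) = G.tail (G.cutDartProj X y') := by
  refine ((G.cut X).tail_eq_iff.1 h).map_eq (fun y => G.tail (G.cutDartProj X y)) ?_
  rintro (d | d)
  · by_cases hd : d ∈ G.dartsOn X
    · rw [cut_rot_inl_of_mem hd]
      have h1 := firstReturn_sameCycle G.rot⁻¹ (G.dartsOn X) ⟨d, hd⟩
      rw [Equiv.Perm.sameCycle_inv, ← tail_eq_iff] at h1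
      exact h1.symm
    · have := cut_rot_base (X := X) d
      rw [cutBase_of_notMem hd] at this
      rw [this]
      exact G.tail_rot d
  · exact G.tail_rot d

theorem cut_face_eq {y y' : G.CutDart X} (h : (G.cut X).face y = (G.cut X).face y') :
    Sum.elim (fun d => some (G.face d)) (fun _ => none) y =
      Sum.elim (fun d => some (G.face d)) (fun _ => none) y' := by
  refine ((G.cut X).face_eq_iff.1 h).map_eq _ ?_
  rintro (d | d)
  · rw [cut_facePerm_inl]; exact congrArg some (G.face_facePerm d)
  · rw [cut_facePerm_inr]; rfl

theorem cutFace_injective : Function.Injective (G.cutFace X) := by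
  intro f f' h
  obtain ⟨d, rfl⟩ := G.exists_face f
  obtain ⟨d', rfl⟩ := G.exists_face f'
  exact Option.some_injective _ (cut_face_eq (X := X) (y := Sum.inl d) (y' := Sum.inl d') h)

theorem isCutBoundaryFace_iff {f : (G.cut X).Face} :
    G.IsCutBoundaryFace X f ↔ ∃ x : G.dartsOn X, (G.cut X).face (Sum.inr x) = f := by
  constructor
  · intro h
    obtain ⟨y, rfl⟩ := (G.cut X).exists_face f
    rcases y with d | x
    · exact absurd ⟨G.face d, rfl⟩ h
    · exact ⟨x, rfl⟩
  · rintro ⟨x, rfl⟩ ⟨f, hf⟩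
    obtain ⟨d, rfl⟩ := G.exists_face f
    have := cut_face_eq (X := X) (y := Sum.inl d) (y' := Sum.inr x) hf
    simp at this

/-! ### Counting -/

theorem two_mul_card_edge : 2 * Nat.card G.Edge = Nat.card D := by
  classical
  have := Fintype.ofFinite D
  have := Fintype.ofFinite G.Edge
  rw [Nat.card_eq_fintype_card, Nat.card_eq_fintype_card, ← Finset.card_univ (α := D),
    Finset.card_eq_sum_card_fiberwise (f := G.edge) (t := Finset.univ) (by simp)]
  have h : ∀ e ∈ (Finset.univ : Finset G.Edge), ({d | G.edge d = e} : Finset D).card = 2 := by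
    intro e _
    obtain ⟨d, rfl⟩ := G.exists_edge e
    have : ({x | G.edge x = G.edge d} : Finset D) = {d, G.opp d} := by
      ext x
      simp only [Finset.mem_filter, Finset.mem_univ, true_and, Finset.mem_insert,
        Finset.mem_singleton]
      rw [eq_comm, edge_eq_iff]
    rw [this, Finset.card_pair (G.opp_ne d).symm]
  rw [Finset.sum_congr rfl h, Finset.sum_const, Finset.card_univ, smul_eq_mul, mul_comm]

/-- A vertex of the cut graph is either a sector, named by the unique new dart that starts it, or a
vertex of G untouched by `X`. -/
theorem card_cut_vertex : Nat.card (G.cut X).Vertex + (G.tail '' G.dartsOn X).ncard =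
    Nat.card G.Vertex + (G.dartsOn X).ncard := by
  classical
  let rep : G.Vertex → D := fun v => (G.exists_tail v).choose
  have hrep : ∀ v, G.tail (rep v) = v := fun v => (G.exists_tail v).choose_spec
  let f : G.dartsOn X ⊕ ((G.tail '' G.dartsOn X)ᶜ : Set G.Vertex) → (G.cut X).Vertex :=
    Sum.elim (fun x => (G.cut X).tail (Sum.inr x)) fun v => (G.cut X).tail (Sum.inl (rep v))
  have hf : Function.Bijective f := by
    constructor
    · rintro (x | v) (x' | v') h
      · exact congrArg Sum.inl (tail_inr_injective h)
      · have h1 : G.tail (x : D) = G.tail (rep v') := tail_cutDartProj h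
        rw [hrep] at h1
        exact absurd ⟨x, x.2, h1⟩ v'.2
      · have h1 : G.tail (rep v) = G.tail (x' : D) := tail_cutDartProj h
        rw [hrep] at h1
        exact absurd ⟨x', x'.2, h1.symm⟩ v.2
      · have h1 : G.tail (rep v) = G.tail (rep v') := tail_cutDartProj h
        rw [hrep, hrep] at h1
        exact congrArg Sum.inr (Subtype.ext h1)
    · intro u
      obtain ⟨y, rfl⟩ := (G.cut X).exists_tail u
      rcases y with d | x
      · by_cases hd : G.tail d ∈ G.tail '' G.dartsOn X
        · obtain ⟨x, hx, h⟩ := hd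
          obtain ⟨x', hx'⟩ := exists_tail_inr hx h.symm
          exact ⟨Sum.inl x', hx'.symm⟩
        · refine ⟨Sum.inr ⟨G.tail d, hd⟩, tail_inl_eq ?_ (hrep _)⟩
          intro x hx h
          rw [hrep] at h
          exact hd ⟨x, hx, h⟩
      · exact ⟨Sum.inl x, rfl⟩
  have h1 := Nat.card_congr (Equiv.ofBijective f hf)
  rw [Nat.card_sum, Nat.card_coe_set_eq, Nat.card_coe_set_eq] at h1
  have h2 := Set.ncard_add_ncard_compl (G.tail '' G.dartsOn X)
  omega

theorem card_cut_face (hX : (G.dartsOn X).Nonempty)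
    (hf : ∀ x y : G.dartsOn X, (G.cut X).face (Sum.inr x) = (G.cut X).face (Sum.inr y)) :
    Nat.card (G.cut X).Face = Nat.card G.Face + 1 := by
  obtain ⟨x, hx⟩ := hX
  let f : Option G.Face → (G.cut X).Face :=
    fun o => o.elim ((G.cut X).face (Sum.inr ⟨x, hx⟩)) (G.cutFace X)
  have hno : ∀ g, G.cutFace X g ≠ (G.cut X).face (Sum.inr ⟨x, hx⟩) := fun g h =>
    (isCutBoundaryFace_iff.2 ⟨_, rfl⟩ : G.IsCutBoundaryFace X _) ⟨g, h⟩
  have hb : Function.Bijective f := by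
    constructor
    · rintro (_ | g) (_ | g') h
      · rfl
      · exact absurd h.symm (hno g')
      · exact absurd h (hno g)
      · exact congrArg some (cutFace_injective h)
    · intro g
      obtain ⟨y, rfl⟩ := (G.cut X).exists_face g
      rcases y with d | z
      · exact ⟨some (G.face d), rfl⟩
      · exact ⟨none, hf _ _⟩
  rw [← Nat.card_congr (Equiv.ofBijective f hb), Finite.card_option]

/-- The common boundary face links all new darts. The old darts not linked to it would avoid `X` and
form a set closed under rotation and reversal; since G is connected, this set would contain all
darts, those of X included. -/
theorem cut_connected (hG : G.Connected) (hX : (G.dartsOn X).Nonempty)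
    (hf : ∀ x y : G.dartsOn X, (G.cut X).face (Sum.inr x) = (G.cut X).face (Sum.inr y)) :
    (G.cut X).Connected := by
  obtain ⟨z, hz⟩ := hX
  let K : Set (G.cut X).Vertex := {v | ∃ p, (G.cut X).IsWalk v p ((G.cut X).tail (Sum.inr ⟨z, hz⟩))}
  have hK1 : ∀ y, (G.cut X).head y ∈ K → (G.cut X).tail y ∈ K := by
    rintro y ⟨p, hp⟩
    exact ⟨y :: p, rfl, hp⟩
  have hK2 : ∀ y, (G.cut X).tail y ∈ K → (G.cut X).head y ∈ K := by
    intro y hy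
    have := hK1 ((G.cut X).opp y)
    rw [head_opp] at this
    exact this hy
  have hinr : ∀ x : G.dartsOn X, (G.cut X).tail (Sum.inr x) ∈ K := by
    intro x
    have h := ((G.cut X).face_eq_iff.1 (hf x ⟨z, hz⟩)).map_eq (fun y => (G.cut X).tail y ∈ K)
      (fun y => propext (by rw [tail_facePerm]; exact ⟨hK1 y, hK2 y⟩))
    rw [h]
    exact ⟨[], rfl⟩
  let L : Set D := {d | (G.cut X).tail (Sum.inl d) ∉ K}
  have hLX : ∀ d ∈ L, d ∉ G.dartsOn X := by
    intro d hd hdX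
    apply hd
    apply hK1
    change (G.cut X).tail ((G.cut X).opp (Sum.inl d)) ∈ K
    rw [cut_opp_inl, cutBase_of_mem (G.opp_mem_dartsOn X hdX)]
    exact hinr _
  have hLrot : ∀ d ∈ L, G.rot d ∈ L := by
    intro d hd
    change (G.cut X).tail (Sum.inl (G.rot d)) ∉ K
    rw [← cut_rot_base, tail_rot, cutBase_of_notMem (hLX d hd)]
    exact hd
  have hLopp : ∀ d ∈ L, G.opp d ∈ L := by
    intro d hd h
    apply hd
    apply hK1
    change (G.cut X).tail ((G.cut X).opp (Sum.inl d)) ∈ K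
    rwa [cut_opp_inl, cutBase_of_notMem (by rw [opp_mem_dartsOn_iff]; exact hLX d hd)]
  have hLw : ∀ (p : List D) (d : D), d ∈ L → ∀ v d', G.IsWalk (G.tail d) p v → G.tail d' = v →
      d' ∈ L := by
    intro p
    induction p with
    | nil =>
      intro d hd v d' hp h
      exact mem_of_sameCycle_of_forward hLrot hd (G.tail_eq_iff.1 (hp.trans h.symm))
    | cons x p ih =>
      rintro d hd v d' ⟨hx, hp⟩ h
      have hxL : x ∈ L := mem_of_sameCycle_of_forward hLrot hd (G.tail_eq_iff.1 hx.symm)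
      exact ih (G.opp x) (hLopp x hxL) v d' hp h
  have hall : ∀ v, v ∈ K := by
    intro v
    obtain ⟨y, rfl⟩ := (G.cut X).exists_tail v
    rcases y with d | x
    · by_contra hd
      obtain ⟨p, hp⟩ := hG.2 (G.tail d) (G.tail z)
      exact hLX z (hLw p d hd _ z hp rfl) hz
    · exact hinr x
  refine ⟨⟨Sum.inl z⟩, fun u v => ?_⟩
  obtain ⟨p, hp⟩ := hall u
  obtain ⟨q, hq⟩ := hall v
  exact ⟨_, isWalk_append.2 ⟨_, hp, hq.reverse⟩⟩

/-- `hcard` says that the subgraph has n vertices and n + 1 edges. Cutting adds 2(n + 1) - n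
vertices, n + 1 edges and one face, so the Euler characteristic grows by 2. -/
theorem cut_hasGenus {g : ℕ} (hG : G.HasGenus (g + 1)) (hX : (G.dartsOn X).Nonempty)
    (hf : ∀ x y : G.dartsOn X, (G.cut X).face (Sum.inr x) = (G.cut X).face (Sum.inr y))
    (hcard : (G.dartsOn X).ncard = 2 * (G.tail '' G.dartsOn X).ncard + 2) :
    (G.cut X).HasGenus g := by
  refine ⟨cut_connected hG.1 hX hf, ?_⟩
  have h0 := hG.2
  have h1 := card_cut_vertex (X := X)
  have h2 := card_cut_face hX hf
  have h3 := two_mul_card_edge (G := G)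
  have h4 := two_mul_card_edge (G := G.cut X)
  rw [Nat.card_sum, Nat.card_coe_set_eq] at h4
  push_cast at h0
  omega

end CutStructure

end EmbeddedGraph

/-! ### Cutting along a cycle and a path joining its two sides -/

namespace EmbeddedGraph

variable {D : Type*} {G : EmbeddedGraph D}

/-! ### Directed paths as sets of darts -/

/-- `Q` is the set of darts of a simple path with first dart `s` and last dart `t`. -/
structure DiPath (G : EmbeddedGraph D) (Q : Set D) (s t : D) : Prop where
  first_mem : s ∈ Q
  last_mem : t ∈ Q
  opp_notMem : ∀ d ∈ Q, G.opp d ∉ Q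
  tail_inj : Set.InjOn G.tail Q
  head_inj : Set.InjOn G.head Q
  head_ne : ∀ d ∈ Q, G.head d ≠ G.tail s
  tail_ne : ∀ d ∈ Q, G.tail d ≠ G.head t
  next : ∀ d ∈ Q, d ≠ t → ∃ d' ∈ Q, G.head d = G.tail d'
  from_first : ∀ d ∈ Q, Relation.ReflTransGen (G.Step Q) s d
  to_last : ∀ d ∈ Q, Relation.ReflTransGen (G.Step Q) d t

theorem DiPath.prev {Q : Set D} {s t : D} (h : G.DiPath Q s t) :
    ∀ d ∈ Q, d ≠ s → ∃ d' ∈ Q, G.head d' = G.tail d := by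
  intro d hd hne
  rcases Relation.ReflTransGen.cases_tail (h.from_first d hd) with h1 | ⟨x, -, hx⟩
  · exact absurd h1 hne
  · exact ⟨x, hx.1, hx.2.2⟩

theorem DiPath.reverse {Q : Set D} {s t : D} (h : G.DiPath Q s t) :
    G.DiPath {d | G.opp d ∈ Q} (G.opp t) (G.opp s) := by
  have hmem : ∀ d, d ∈ Q → G.opp d ∈ {d | G.opp d ∈ Q} := fun d hd => by
    change G.opp (G.opp d) ∈ Q; rwa [G.opp_opp]
  refine ⟨hmem _ h.last_mem, hmem _ h.first_mem, fun d hd => h.opp_notMem _ hd, ?_, ?_, ?_, ?_,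
    ?_, ?_, ?_⟩
  · intro d hd d' hd' he
    exact G.opp.injective (h.head_inj hd hd' (by rw [head_opp, head_opp, he]))
  · intro d hd d' hd' he
    exact G.opp.injective (h.tail_inj hd hd' he)
  · intro d hd
    exact h.tail_ne _ hd
  · intro d hd
    rw [head_opp, ← head_opp G d]
    exact h.head_ne _ hd
  · intro d hd hne
    obtain ⟨d', h1, h2⟩ := h.prev _ hd (fun he => hne (by rw [← he, G.opp_opp]))
    exact ⟨G.opp d', hmem _ h1, h2.symm⟩
  · intro d hd
    have := step_reverse hmem (h.to_last _ hd)
    rwa [G.opp_opp] at this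
  · intro d hd
    have := step_reverse hmem (h.from_first _ hd)
    rwa [G.opp_opp] at this

theorem DiPath.induction {Q : Set D} {s t : D} (h : G.DiPath Q s t) {p : D → Prop} (hp : p s)
    (hs : ∀ d ∈ Q, ∀ d' ∈ Q, G.head d = G.tail d' → p d → p d') : ∀ d ∈ Q, p d := by
  intro d hd
  have := h.from_first d hd
  clear hd
  induction this with
  | refl => exact hp
  | tail _ h ih => exact hs _ h.1 _ h.2.1 h.2.2 ih

theorem IsPath.diPath {u v : G.Vertex} {x : D} {p : List D} (h : G.IsPath u (x :: p) v) :
    ∃ t, G.DiPath {d | d ∈ x :: p} x t ∧ G.tail x = u ∧ G.head t = v := by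
  obtain ⟨l, hl, hlv, -⟩ := h.1.step_to_last (M := Set.univ) (by simp) (List.mem_cons_self (a := x))
  have hE := h.nodup_edge
  obtain ⟨hw, hn⟩ := h
  have hh : ((x :: p).map G.head).Nodup := (List.nodup_cons.1 hn).2
  have hu : u ∉ (x :: p).map G.head := (List.nodup_cons.1 hn).1
  have htn : ((x :: p).map G.tail ++ [v]).Nodup := by rw [hw.map_tail_append]; exact hn
  rw [List.nodup_append] at htn
  have hlm : l ∈ x :: p := List.mem_of_getLast? hl
  refine ⟨l, ⟨List.mem_cons_self, hlm, ?_, ?_, ?_, ?_, ?_, ?_, ?_, ?_⟩, hw.1, hlv⟩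
  · intro d hd hd'
    exact G.opp_ne d (List.inj_on_of_nodup_map hE hd' hd (G.edge_opp d))
  · intro d hd d' hd' he; exact List.inj_on_of_nodup_map htn.1 hd hd' he
  · intro d hd d' hd' he; exact List.inj_on_of_nodup_map hh hd hd' he
  · intro d hd he
    exact hu (List.mem_map.2 ⟨d, hd, he.trans hw.1⟩)
  · intro d hd he
    exact htn.2.2 _ (List.mem_map_of_mem hd) v (by simp) (by rw [he, hlv])
  · intro d hd hne
    rcases hw.head_eq_or_next hd with h1 | h1
    · exact absurd (List.inj_on_of_nodup_map hh hd hlm (h1.trans hlv.symm)) hne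
    · exact h1
  · intro d hd
    exact hw.step_from_first (fun _ h => h) hd
  · intro d hd
    obtain ⟨l', h1, -, h3⟩ := hw.step_to_last (M := {d | d ∈ x :: p}) (fun _ h => h) hd
    rw [hl] at h1
    cases h1
    exact h3

/-! ### A cycle together with a path that joins its two sides -/

/-- `M` is a directed cycle with edge set `X`, and `Q` is a directed path of the graph cut along `X`
that leads from the boundary face along `M` to the boundary face along the reversal of `M` and
meets these faces only in its ends. -/
structure IsHandle [Finite D] (G : EmbeddedGraph D) (M : Set D) (X : Set G.Edge)
    (Q : Set (G.CutDart X)) (s t : D) : Prop where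
  cycle : G.DiCycle M
  mem_dartsOn : ∀ d, d ∈ G.dartsOn X ↔ d ∈ M ∨ G.opp d ∈ M
  path : (G.cut X).DiPath Q (Sum.inl s) (Sum.inl t)
  off : ∀ y ∈ Q, ∃ d, d ∉ G.dartsOn X ∧ y = Sum.inl d
  start : ∃ x : G.dartsOn X, (x : D) ∈ M ∧ (G.cut X).tail (Sum.inl s) = (G.cut X).tail (Sum.inr x)
  finish : ∃ x : G.dartsOn X, G.opp x ∈ M ∧
    (G.cut X).head (Sum.inl t) = (G.cut X).tail (Sum.inr x)
  eq_first : ∀ y ∈ Q, ∀ x : G.dartsOn X, (G.cut X).tail y = (G.cut X).tail (Sum.inr x) → y = Sum.inl s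
  eq_last : ∀ y ∈ Q, ∀ x : G.dartsOn X, (G.cut X).head y = (G.cut X).tail (Sum.inr x) → y = Sum.inl t

section Handle

variable [Finite D] {M : Set D} {X : Set G.Edge} {Q : Set (G.CutDart X)} {s t : D}

theorem cut_opp_inl_of_notMem {d : D} (h : d ∉ G.dartsOn X) :
    (G.cut X).opp (Sum.inl d) = Sum.inl (G.opp d) := by
  rw [cut_opp_inl, cutBase_of_notMem (by rwa [opp_mem_dartsOn_iff])]

theorem IsHandle.notMem (h : G.IsHandle M X Q s t) {d : D} (hd : Sum.inl d ∈ Q) :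
    d ∉ G.dartsOn X := by
  obtain ⟨d', h1, h2⟩ := h.off _ hd
  cases h2
  exact h1

theorem IsHandle.opp_mem_iff (h : G.IsHandle M X Q s t) {d : D} :
    (G.cut X).opp (Sum.inl d) ∈ Q ↔ Sum.inl (G.opp d) ∈ Q := by
  by_cases hd : d ∈ G.dartsOn X
  · refine iff_of_false (fun h' => ?_) fun h' => h.notMem h' (opp_mem_dartsOn_iff.2 hd)
    rw [cut_opp_inl, cutBase_of_mem (G.opp_mem_dartsOn X hd)] at h'
    obtain ⟨_, -, h2⟩ := h.off _ h'
    cases h2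
  · rw [cut_opp_inl_of_notMem hd]

theorem IsHandle.reverse (h : G.IsHandle M X Q s t) :
    G.IsHandle {d | G.opp d ∈ M} X {y | (G.cut X).opp y ∈ Q} (G.opp t) (G.opp s) := by
  have hs := h.notMem h.path.first_mem
  have ht := h.notMem h.path.last_mem
  refine ⟨h.cycle.reverse, ?_, ?_, ?_, ?_, ?_, ?_, ?_⟩
  · intro d
    rw [h.mem_dartsOn]
    simp only [Set.mem_ofPred_eq, G.opp_opp]
    exact or_comm
  · rw [← cut_opp_inl_of_notMem hs, ← cut_opp_inl_of_notMem ht]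
    exact h.path.reverse
  · intro y hy
    obtain ⟨d, h1, h2⟩ := h.off _ hy
    refine ⟨G.opp d, by rwa [opp_mem_dartsOn_iff], ?_⟩
    rw [← cut_opp_inl_of_notMem h1, ← h2, (G.cut X).opp_opp]
  · obtain ⟨x, h1, h2⟩ := h.finish
    exact ⟨x, h1, by rw [← cut_opp_inl_of_notMem ht]; exact h2⟩
  · obtain ⟨x, h1, h2⟩ := h.start
    refine ⟨x, by simpa only [Set.mem_ofPred_eq, G.opp_opp], ?_⟩
    rw [← cut_opp_inl_of_notMem hs, head_opp, h2]
  · intro y hy x hyx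
    have := h.eq_last _ hy x (by rw [head_opp, hyx])
    rw [← cut_opp_inl_of_notMem ht, ← this, (G.cut X).opp_opp]
  · intro y hy x hyx
    have := h.eq_first _ hy x hyx
    rw [← cut_opp_inl_of_notMem hs, ← this, (G.cut X).opp_opp]

/-- `Z` consists of the edges of the cycle and of the path. -/
def HandleEdges (G : EmbeddedGraph D) (X : Set G.Edge) (Q : Set (G.CutDart X)) (Z : Set G.Edge) :
    Prop :=
  ∀ d, d ∈ G.dartsOn Z ↔ d ∈ G.dartsOn X ∨ Sum.inl d ∈ Q ∨ Sum.inl (G.opp d) ∈ Q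

theorem IsHandle.handleEdges_reverse (h : G.IsHandle M X Q s t) {Z : Set G.Edge}
    (hZ : G.HandleEdges X Q Z) : G.HandleEdges X {y | (G.cut X).opp y ∈ Q} Z := by
  intro d
  rw [hZ, Set.mem_ofPred_eq, Set.mem_ofPred_eq, h.opp_mem_iff, h.opp_mem_iff, G.opp_opp]
  rw [or_comm (a := Sum.inl d ∈ Q)]

variable {Z : Set G.Edge}

/-- Along a boundary face of the graph cut along `Z`, a dart `d` is followed by the dart of `Z` that
precedes its reversal around the head of `d`. -/
theorem face_cutBase {d : D} (hd : d ∈ G.dartsOn Z) :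
    (G.cut Z).face (G.cutBase Z d) = (G.cut Z).face (G.cutBase Z
      (firstReturn G.rot⁻¹ (G.dartsOn Z) ⟨G.opp d, G.opp_mem_dartsOn Z hd⟩)) := by
  rw [cutBase_of_mem hd, cutBase_of_mem (firstReturn G.rot⁻¹ (G.dartsOn Z) _).2,
    ← face_facePerm, cut_facePerm_inr]

/-- In a sector along the copy of `M`, the only darts of `Z` are the cycle dart that starts it and
possibly the first dart of the path. The last dart of the path ends on the other copy. -/
theorem IsHandle.eq_of_tail (h : G.IsHandle M X Q s t) (hZ : G.HandleEdges X Q Z) {e : D}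
    (he : e ∈ G.dartsOn Z) {x : G.dartsOn X} (hx : (x : D) ∈ M)
    (hex : (G.cut X).tail (G.cutBase X e) = (G.cut X).tail (Sum.inr x)) : e = x ∨ e = s := by
  rcases (hZ e).1 he with h1 | h1 | h1
  · rw [cutBase_of_mem h1] at hex
    exact Or.inl (congrArg Subtype.val (tail_inr_injective hex))
  · rw [cutBase_of_notMem (h.notMem h1)] at hex
    exact Or.inr (Sum.inl_injective (h.eq_first _ h1 x hex))
  · have he' := h.notMem h1
    have he : e ∉ G.dartsOn X := fun h' => he' (opp_mem_dartsOn_iff.2 h')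
    rw [cutBase_of_notMem he] at hex
    have h2 : (G.cut X).head (Sum.inl (G.opp e)) = (G.cut X).tail (Sum.inl e) := by
      rw [← tail_opp, cut_opp_inl_of_notMem he', G.opp_opp]
    have h3 := h.eq_last _ h1 x (h2.trans hex)
    obtain ⟨x', h4, h5⟩ := h.finish
    rw [← h3, h2, hex] at h5
    obtain rfl := tail_inr_injective h5
    exact absurd h4 (h.cycle.opp_notMem _ hx)

theorem IsHandle.tail_opp_cycle (h : G.IsHandle M X Q s t) {c c' : D} (hc : c ∈ M) (hc' : c' ∈ M)
    (hcc : G.head c = G.tail c') : (G.cut X).tail (Sum.inl (G.opp c)) =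
      (G.cut X).tail (Sum.inr ⟨c', (h.mem_dartsOn c').2 (Or.inl hc')⟩) := by
  have hcX : G.opp c ∈ G.dartsOn X := opp_mem_dartsOn_iff.2 ((h.mem_dartsOn c).2 (Or.inl hc))
  have h1 := tail_firstReturn (X := X) subset_rfl ⟨G.opp c, hcX⟩
  rw [h.cycle.firstReturn_eq h.mem_dartsOn hc hc' hcc hcX,
    cutBase_of_mem ((h.mem_dartsOn c').2 (Or.inl hc'))] at h1
  exact h1.symm

theorem IsHandle.dartsOn_subset (hZ : G.HandleEdges X Q Z) : G.dartsOn X ⊆ G.dartsOn Z :=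
  fun d hd => (hZ d).2 (Or.inl hd)

theorem IsHandle.firstReturn_cycle (h : G.IsHandle M X Q s t) (hZ : G.HandleEdges X Q Z) {c c' : D}
    (hc : c ∈ M) (hc' : c' ∈ M) (hcc : G.head c = G.tail c') (hcZ : G.opp c ∈ G.dartsOn Z) :
    (firstReturn G.rot⁻¹ (G.dartsOn Z) ⟨G.opp c, hcZ⟩ : D) = c' ∨
      (firstReturn G.rot⁻¹ (G.dartsOn Z) ⟨G.opp c, hcZ⟩ : D) = s := by
  have h1 := tail_firstReturn (IsHandle.dartsOn_subset hZ) ⟨G.opp c, hcZ⟩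
  exact h.eq_of_tail hZ (firstReturn G.rot⁻¹ (G.dartsOn Z) ⟨G.opp c, hcZ⟩).2
    (x := ⟨c', (h.mem_dartsOn c').2 (Or.inl hc')⟩) hc' (h1.trans (h.tail_opp_cycle hc hc' hcc))

theorem IsHandle.firstReturn_first (h : G.IsHandle M X Q s t) (hZ : G.HandleEdges X Q Z)
    {x : G.dartsOn X} (hx : (x : D) ∈ M)
    (hsx : (G.cut X).tail (Sum.inl s) = (G.cut X).tail (Sum.inr x)) (hs : s ∈ G.dartsOn Z) :
    (firstReturn G.rot⁻¹ (G.dartsOn Z) ⟨s, hs⟩ : D) = x := by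
  have h1 := tail_firstReturn (IsHandle.dartsOn_subset hZ) ⟨s, hs⟩
  rcases h.eq_of_tail hZ (firstReturn G.rot⁻¹ (G.dartsOn Z) ⟨s, hs⟩).2 hx (h1.trans hsx) with h2 | h2
  · exact h2
  · have h3 : G.tail s = G.tail (x : D) := tail_cutDartProj hsx
    have h4 := eq_of_firstReturn_eq_self _ _ _ (Subtype.ext h2) (IsHandle.dartsOn_subset hZ x.2)
      (by rw [Equiv.Perm.sameCycle_inv, ← tail_eq_iff]; exact h3)
    exact absurd ((show (x : D) = s from h4) ▸ x.2) (h.notMem h.path.first_mem)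

theorem IsHandle.firstReturn_path (h : G.IsHandle M X Q s t) (hZ : G.HandleEdges X Q Z) {d d' : D}
    (hd : Sum.inl d ∈ Q) (hd' : Sum.inl d' ∈ Q)
    (hdd : (G.cut X).head (Sum.inl d) = (G.cut X).tail (Sum.inl d')) (hdZ : G.opp d ∈ G.dartsOn Z) :
    (firstReturn G.rot⁻¹ (G.dartsOn Z) ⟨G.opp d, hdZ⟩ : D) = d' := by
  have h1 := tail_firstReturn (IsHandle.dartsOn_subset hZ) ⟨G.opp d, hdZ⟩
  have hdX := h.notMem hd
  have hh : (G.cut X).tail (Sum.inl (G.opp d)) = (G.cut X).head (Sum.inl d) := by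
    rw [← cut_opp_inl_of_notMem hdX, tail_opp]
  change _ = (G.cut X).tail (Sum.inl (G.opp d)) at h1
  rcases (hZ _).1 (firstReturn G.rot⁻¹ (G.dartsOn Z) ⟨G.opp d, hdZ⟩).2 with h2 | h2 | h2
  · rw [cutBase_of_mem h2] at h1
    have h3 := h.eq_first _ hd' _ ((hdd.symm.trans hh.symm).trans h1.symm)
    rw [h3] at hdd
    exact absurd hdd (h.path.head_ne _ hd)
  · rw [cutBase_of_notMem (h.notMem h2)] at h1
    exact Sum.inl_injective (h.path.tail_inj h2 hd' ((h1.trans hh).trans hdd))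
  · have h4 := h.notMem h2
    rw [cutBase_of_notMem (fun h' => h4 (opp_mem_dartsOn_iff.2 h'))] at h1
    have h5 := h.path.head_inj h2 hd (by
      rw [← tail_opp, cut_opp_inl_of_notMem h4, G.opp_opp, h1, hh])
    have h6 : (firstReturn G.rot⁻¹ (G.dartsOn Z) ⟨G.opp d, hdZ⟩ : D) = G.opp d := by
      have h8 := congrArg G.opp (Sum.inl_injective h5)
      rwa [G.opp_opp] at h8
    have h7 := eq_of_firstReturn_eq_self _ _ _ (Subtype.ext h6) ((hZ d').2 (Or.inr (Or.inl hd')))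
      (by
        rw [Equiv.Perm.sameCycle_inv, ← tail_eq_iff]
        exact tail_cutDartProj (X := X) (y := Sum.inl (G.opp d)) (y' := Sum.inl d') (hh.trans hdd))
    have h8 : d' = G.opp d := h7
    rw [h8, ← cut_opp_inl_of_notMem hdX] at hd'
    exact absurd hd' (h.path.opp_notMem _ hd)

theorem IsHandle.face_path (h : G.IsHandle M X Q s t) (hZ : G.HandleEdges X Q Z) {d : D}
    (hd : Sum.inl d ∈ Q) :
    (G.cut Z).face (G.cutBase Z d) = (G.cut Z).face (G.cutBase Z s) := by
  have key : ∀ y ∈ Q, ∀ d, y = Sum.inl d →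
      (G.cut Z).face (G.cutBase Z d) = (G.cut Z).face (G.cutBase Z s) := by
    refine h.path.induction ?_ ?_
    · intro d hd; cases hd; rfl
    · intro y hy y' hy' hyy ih d' hd'
      obtain ⟨d, -, rfl⟩ := h.off _ hy
      subst hd'
      have hdZ : d ∈ G.dartsOn Z := (hZ d).2 (Or.inr (Or.inl hy))
      rw [← ih d rfl, face_cutBase hdZ, h.firstReturn_path hZ hy hy' hyy]
  exact key _ hd d rfl

/-- The boundary face runs once around the copy of `M` from `x`, the cycle dart at the start of the
path, turns into the path at `s`, and comes back along the reversal of `s` to `x`. -/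
theorem IsHandle.face_cycle (h : G.IsHandle M X Q s t) (hZ : G.HandleEdges X Q Z) :
    (∀ c ∈ M, (G.cut Z).face (G.cutBase Z c) = (G.cut Z).face (G.cutBase Z s)) ∧
      (G.cut Z).face (G.cutBase Z (G.opp s)) = (G.cut Z).face (G.cutBase Z s) := by
  obtain ⟨x, hx, hsx⟩ := h.start
  have hsZ : s ∈ G.dartsOn Z := (hZ s).2 (Or.inr (Or.inl h.path.first_mem))
  have hosZ : G.opp s ∈ G.dartsOn Z := opp_mem_dartsOn_iff.2 hsZ
  have hMZ : ∀ c ∈ M, c ∈ G.dartsOn Z := fun c hc =>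
    (hZ c).2 (Or.inl ((h.mem_dartsOn c).2 (Or.inl hc)))
  have hfs := h.firstReturn_first hZ hx hsx hsZ
  have hstep : ∀ c ∈ M, ∀ c' ∈ M, G.head c = G.tail c' → c' ≠ x →
      (G.cut Z).face (G.cutBase Z c) = (G.cut Z).face (G.cutBase Z c') := by
    intro c hc c' hc' hcc hne
    rw [face_cutBase (hMZ c hc)]
    rcases h.firstReturn_cycle hZ hc hc' hcc (G.opp_mem_dartsOn Z (hMZ c hc)) with h1 | h1
    · rw [h1]
    · have h2 := tail_firstReturn (IsHandle.dartsOn_subset hZ)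
        ⟨G.opp c, G.opp_mem_dartsOn Z (hMZ c hc)⟩
      rw [h1, cutBase_of_notMem (h.notMem h.path.first_mem), hsx] at h2
      have h3 := tail_inr_injective (h2.trans (h.tail_opp_cycle hc hc' hcc))
      exact absurd (congrArg Subtype.val h3).symm hne
  have hall : ∀ c ∈ M, (G.cut Z).face (G.cutBase Z c) = (G.cut Z).face (G.cutBase Z x) := by
    refine h.cycle.induction hx rfl ?_
    -- The step into `x` needs no adjacency: there the face leaves for the path, but the claim for
    -- `x` is trivial.
    intro c hc c' hc' hcc ih
    by_cases hne : c' = x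
    · rw [hne]
    · rw [← hstep c hc c' hc' hcc hne, ih]
  have hpre : (G.cut Z).face (G.cutBase Z x) = (G.cut Z).face (G.cutBase Z s) := by
    obtain ⟨c, hc, hcx⟩ := h.cycle.prev _ hx
    rw [← hall c hc, face_cutBase (hMZ c hc)]
    have hocZ := G.opp_mem_dartsOn Z (hMZ c hc)
    rcases h.firstReturn_cycle hZ hc hx hcx hocZ with h1 | h1
    · have h2 := (firstReturn G.rot⁻¹ (G.dartsOn Z)).injective
        (Subtype.ext (h1.trans hfs.symm) : firstReturn G.rot⁻¹ (G.dartsOn Z) ⟨G.opp c, hocZ⟩ =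
          firstReturn G.rot⁻¹ (G.dartsOn Z) ⟨s, hsZ⟩)
      have h3 : G.opp c = s := congrArg Subtype.val h2
      exact absurd (opp_mem_dartsOn_iff.2 ((h.mem_dartsOn c).2 (Or.inl hc)))
        (h3 ▸ h.notMem h.path.first_mem)
    · rw [h1]
  refine ⟨fun c hc => (hall c hc).trans hpre, ?_⟩
  rw [face_cutBase hosZ, ← hpre, ← hfs]
  congr 3
  simp only [G.opp_opp]

/-- `face_cycle` and `face_path` cover one copy of the cycle and one side of the path. The reversed
handle covers the rest, and the reversal of `s` lies on both parts. -/
theorem IsHandle.face_eq (h : G.IsHandle M X Q s t) (hZ : G.HandleEdges X Q Z)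
    (x y : G.dartsOn Z) : (G.cut Z).face (Sum.inr x) = (G.cut Z).face (Sum.inr y) := by
  have hr := h.reverse
  have hZr := h.handleEdges_reverse hZ
  have h1 : (G.cut Z).face (G.cutBase Z (G.opp t)) = (G.cut Z).face (G.cutBase Z s) := by
    rw [← (h.face_cycle hZ).2]
    refine (hr.face_path hZr ?_).symm
    rw [Set.mem_ofPred_eq, h.opp_mem_iff, G.opp_opp]
    exact h.path.first_mem
  have key : ∀ d ∈ G.dartsOn Z,
      (G.cut Z).face (G.cutBase Z d) = (G.cut Z).face (G.cutBase Z s) := by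
    intro d hd
    rcases (hZ d).1 hd with h2 | h2 | h2
    · rcases (h.mem_dartsOn d).1 h2 with h3 | h3
      · exact (h.face_cycle hZ).1 d h3
      · exact ((hr.face_cycle hZr).1 d h3).trans h1
    · exact h.face_path hZ h2
    · refine (hr.face_path hZr ?_).trans h1
      rwa [Set.mem_ofPred_eq, h.opp_mem_iff]
  have h2 := (key x x.2).trans (key y y.2).symm
  rwa [cutBase_of_mem x.2, cutBase_of_mem y.2] at h2

/-- The cycle has as many vertices as edges, and the path, with both ends on the cycle, adds one
vertex fewer than it adds edges. -/
theorem IsHandle.ncard_dartsOn (h : G.IsHandle M X Q s t) (hZ : G.HandleEdges X Q Z) :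
    (G.dartsOn Z).ncard = 2 * (G.tail '' G.dartsOn Z).ncard + 2 := by
  let Q' : Set D := {d | Sum.inl d ∈ Q}
  have hoppcard : ∀ s : Set D, ({d | G.opp d ∈ s} : Set D).ncard = s.ncard := by
    intro s
    rw [← Set.ncard_image_of_injective s G.opp.injective]
    congr 1
    ext d
    constructor
    · intro h; exact ⟨_, h, G.opp_opp d⟩
    · rintro ⟨x, hx, rfl⟩
      change G.opp (G.opp x) ∈ s
      rwa [G.opp_opp]
  have hQo : ∀ d ∈ Q', G.opp d ∉ Q' := by
    intro d hd hd'
    refine h.path.opp_notMem _ hd ?_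
    rw [cut_opp_inl_of_notMem (h.notMem hd)]; exact hd'
  have hMX : ∀ d ∈ M ∪ {d | G.opp d ∈ M}, d ∈ G.dartsOn X := fun d hd => (h.mem_dartsOn d).2 hd
  have hQX : ∀ d ∈ Q' ∪ {d | G.opp d ∈ Q'}, d ∉ G.dartsOn X := by
    rintro d (hd | hd) hX
    · exact h.notMem hd hX
    · exact h.notMem hd (opp_mem_dartsOn_iff.2 hX)
  have hdM : Disjoint M {d | G.opp d ∈ M} := Set.disjoint_left.2 fun d hd => h.cycle.opp_notMem d hd
  have hdQ : Disjoint Q' {d | G.opp d ∈ Q'} := Set.disjoint_left.2 fun d hd => hQo d hd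
  have e1 : G.dartsOn Z = (M ∪ {d | G.opp d ∈ M}) ∪ (Q' ∪ {d | G.opp d ∈ Q'}) := by
    ext d
    rw [hZ d, h.mem_dartsOn d]
    rfl
  have c1 : (G.dartsOn Z).ncard = (M.ncard + M.ncard) + (Q'.ncard + Q'.ncard) := by
    rw [e1, Set.ncard_union_eq (Set.disjoint_left.2 fun d h1 h2 => hQX d h2 (hMX d h1)),
      Set.ncard_union_eq hdM, Set.ncard_union_eq hdQ, hoppcard, hoppcard]
  have hsQ : s ∈ Q' := h.path.first_mem
  have hproj : ∀ d ∈ Q' \ {s}, G.tail d ∉ G.tail '' M := by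
    rintro d ⟨hd, hne⟩ ⟨c, hc, hcd⟩
    obtain ⟨x, hx⟩ := exists_tail_inr (X := X) ((h.mem_dartsOn c).2 (Or.inl hc)) hcd.symm
    exact hne (Sum.inl_injective (h.eq_first _ hd x hx))
  have htX : ∀ x ∈ G.dartsOn X, G.tail x ∈ G.tail '' M := by
    intro x hx
    rcases (h.mem_dartsOn x).1 hx with h1 | h1
    · exact ⟨x, h1, rfl⟩
    · obtain ⟨d, h2, h3⟩ := h.cycle.next _ h1
      exact ⟨d, h2, by rw [← h3, head_opp]⟩
  have htQ : ∀ d ∈ Q', G.tail d ∈ G.tail '' M ∪ G.tail '' (Q' \ {s}) := by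
    intro d hd
    by_cases hds : d = s
    · left
      obtain ⟨x, hx, hsx⟩ := h.start
      exact ⟨x, hx, by rw [hds]; exact (tail_cutDartProj hsx).symm⟩
    · exact Or.inr ⟨d, ⟨hd, hds⟩, rfl⟩
  have e2 : G.tail '' G.dartsOn Z = G.tail '' M ∪ G.tail '' (Q' \ {s}) := by
    apply Set.Subset.antisymm
    · rintro _ ⟨d, hd, rfl⟩
      rcases (hZ d).1 hd with h1 | h1 | h1
      · exact Or.inl (htX d h1)
      · exact htQ d h1
      · have h1X := h.notMem h1
        have hh : (G.cut X).head (Sum.inl (G.opp d)) = (G.cut X).tail (Sum.inl d) := by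
          rw [← tail_opp, cut_opp_inl_of_notMem h1X, G.opp_opp]
        by_cases hdt : G.opp d = t
        · obtain ⟨x, hx, htx⟩ := h.finish
          rw [← hdt, hh] at htx
          have h2 : G.tail d = G.tail (x : D) := tail_cutDartProj htx
          rw [h2]
          exact Or.inl (htX _ x.2)
        · obtain ⟨y, hy, hy'⟩ := h.path.next _ h1 (fun h' => hdt (Sum.inl_injective h'))
          obtain ⟨d', -, rfl⟩ := h.off _ hy
          rw [hh] at hy'
          have h2 : G.tail d = G.tail d' := tail_cutDartProj hy'
          rw [h2]
          exact htQ d' hy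
    · rw [← Set.image_union]
      refine Set.image_mono ?_
      rintro d (hd | hd)
      · exact (hZ d).2 (Or.inl ((h.mem_dartsOn d).2 (Or.inl hd)))
      · exact (hZ d).2 (Or.inr (Or.inl hd.1))
  have hinj : Set.InjOn G.tail (Q' \ {s}) := by
    intro d hd d' hd' he
    refine Sum.inl_injective (h.path.tail_inj hd.1 hd'.1 (tail_inl_eq ?_ he))
    intro x hx hxd
    exact hproj d hd (hxd ▸ htX x hx)
  have c2 : (G.tail '' G.dartsOn Z).ncard + 1 = M.ncard + Q'.ncard := by
    rw [e2, Set.ncard_union_eq, h.cycle.tail_inj.ncard_image,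
      hinj.ncard_image, add_assoc, Set.ncard_sdiff_singleton_add_one hsQ]
    rw [Set.disjoint_left]
    rintro v h1 ⟨d, hd, rfl⟩
    exact hproj d hd h1
  omega

end Handle

end EmbeddedGraph

/-! ### The tight cycle-path pair on one side of a separating cycle -/

namespace EmbeddedGraph

variable {D : Type*} {G : EmbeddedGraph D} [Finite D]

/-! ### Joining the two copies of a cycle on one side of a separating cycle -/

/-- Cutting inside the side of `A` keeps the outer copy of the rim of `A` connected. -/
theorem tail_opp_rim {A : Set G.Face} (hA : G.DiCycle (G.rim A)) {X : Set G.Edge}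
    (hX : X ⊆ G.side A) {x y : D} (hx : x ∈ G.rim A) (hy : y ∈ G.rim A)
    (hxy : G.head x = G.tail y) :
    (G.cut X).head (Sum.inl (G.opp y)) = (G.cut X).tail (Sum.inl (G.opp x)) := by
  classical
  have hex : ∃ m, G.face (G.opp ((G.rot ^ (m + 1)) y)) ∈ A := by
    have h0 : (G.rot ^ orderOf G.rot) y = y := by rw [pow_orderOf_eq_one]; rfl
    have hpos := orderOf_pos G.rot
    obtain ⟨n, hn⟩ : ∃ n, orderOf G.rot = n + 1 := ⟨_, (Nat.sub_add_cancel hpos).symm⟩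
    rw [hn] at h0
    rcases n with _ | n
    · exfalso
      rw [zero_add, pow_one] at h0
      have := G.face_rot y
      rw [h0] at this
      exact hy.2 (this ▸ hy.1)
    · refine ⟨n, ?_⟩
      rw [← face_rot, ← Equiv.Perm.mul_apply, ← pow_succ', h0]
      exact hy.1
  -- Rotate from `y` to the first dart with A on its other side. The sectors passed lie outside A,
  -- so no dart of `X` is met strictly in between, and the dart reached is the reversal of the
  -- unique rim dart that enters, namely `x`.
  obtain ⟨n, hn, hmin⟩ : ∃ n, G.face (G.opp ((G.rot ^ (n + 1)) y)) ∈ A ∧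
      ∀ m < n, G.face (G.opp ((G.rot ^ (m + 1)) y)) ∉ A :=
    ⟨Nat.find hex, Nat.find_spec hex, fun m hm => Nat.find_min hex hm⟩
  have hout : ∀ m ≤ n, G.face ((G.rot ^ (m + 1)) y) ∉ A := by
    intro m hm
    rw [pow_succ', Equiv.Perm.mul_apply, face_rot]
    rcases m with _ | m
    · exact hy.2
    · exact hmin m (by omega)
  have hz : G.opp ((G.rot ^ (n + 1)) y) = x := by
    refine hA.head_inj ⟨hn, by rw [G.opp_opp]; exact hout n le_rfl⟩ hx ?_
    rw [head_opp, tail_rot_pow, hxy]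
  rw [← tail_opp, cut_opp_inl, G.opp_opp, tail_cutBase (n := n), ← hz, G.opp_opp]
  intro m h1 h2 hm
  obtain ⟨m, rfl⟩ := Nat.exists_eq_add_of_lt h1
  rw [zero_add] at hm h2
  rcases edge_mem_side.1 (hX hm) with h3 | h3
  · exact hout m (by omega) h3
  · exact hmin m (by omega) h3

/-- Otherwise let `K` be what the copy along `M` reaches within the side of A. The outer copy of the
rim lies wholly in K or wholly outside it. Take the faces of A with corners in K, together with all
faces outside A if the outer rim is in K. Their boundary is exactly `X`: only across an edge of the
cycle does membership in K change. So X would be null-homologous. -/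
theorem exists_walk_side {A : Set G.Face} (hA : G.DiCycle (G.rim A)) {X : Set G.Edge}
    (hX : X ⊆ G.side A) (hn : ¬ G.IsNullHomologous X) {M : Set D}
    (hMX : ∀ d, d ∈ G.dartsOn X ↔ d ∈ M ∨ G.opp d ∈ M) :
    ∃ x x' : G.dartsOn X, (x : D) ∈ M ∧ G.opp x' ∈ M ∧ ∃ p,
      (G.cut X).IsWalk ((G.cut X).tail (Sum.inr x)) p ((G.cut X).tail (Sum.inr x')) ∧
      (G.cut X).edgeSet p ⊆ G.cutEdgeProj X ⁻¹' G.side A := by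
  by_contra! hcon
  let K : Set (G.cut X).Vertex := {v | ∃ x : G.dartsOn X, (x : D) ∈ M ∧ ∃ p,
    (G.cut X).IsWalk ((G.cut X).tail (Sum.inr x)) p v ∧
      (G.cut X).edgeSet p ⊆ G.cutEdgeProj X ⁻¹' G.side A}
  have hK1 : ∀ y, G.edge (G.cutDartProj X y) ∈ G.side A → (G.cut X).tail y ∈ K →
      (G.cut X).head y ∈ K := by
    rintro y hy ⟨x, hx, p, hp, hpE⟩
    refine ⟨x, hx, p ++ [y], isWalk_append.2 ⟨_, hp, rfl, rfl⟩, ?_⟩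
    intro e he
    obtain ⟨z, hz, rfl⟩ := (G.cut X).mem_edgeSet.1 he
    rcases List.mem_append.1 hz with h | h
    · exact hpE ((G.cut X).mem_edgeSet.2 ⟨z, h, rfl⟩)
    · rw [List.mem_singleton.1 h]; exact hy
  have hK : ∀ y, G.edge (G.cutDartProj X y) ∈ G.side A →
      ((G.cut X).tail y ∈ K ↔ (G.cut X).head y ∈ K) := by
    intro y hy
    refine ⟨hK1 y hy, fun h => ?_⟩
    have := hK1 ((G.cut X).opp y) (by rw [cutDartProj_opp, edge_opp]; exact hy) h
    rwa [head_opp] at this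
  have hin : ∀ x : G.dartsOn X, (x : D) ∈ M → (G.cut X).tail (Sum.inr x) ∈ K :=
    fun x hx => ⟨x, hx, [], rfl, by simp [edgeSet_nil]⟩
  have hout : ∀ x : G.dartsOn X, G.opp x ∈ M → (G.cut X).tail (Sum.inr x) ∉ K := by
    rintro x hx ⟨x', hx', p, hp, hpE⟩
    exact hcon x' x hx' hx p hp hpE
  have hrimside : ∀ n ∈ G.rim A, G.edge (G.opp n) ∈ G.side A := fun n hn =>
    edge_mem_side.2 (Or.inr (by rw [G.opp_opp]; exact hn.1))
  obtain ⟨n₀, hn₀⟩ := hA.nonempty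
  have hrim : ∀ n ∈ G.rim A, ((G.cut X).tail (Sum.inl (G.opp n)) ∈ K ↔
      (G.cut X).tail (Sum.inl (G.opp n₀)) ∈ K) := by
    refine hA.induction hn₀ Iff.rfl ?_
    intro x hx y hy hxy ih
    rw [← ih, ← tail_opp_rim hA hX hx hy hxy]
    exact hK _ (hrimside y hy)
  let p : D → Prop := fun d => (G.face d ∈ A ∧ (G.cut X).tail (Sum.inl d) ∈ K) ∨
    (G.face d ∉ A ∧ (G.cut X).tail (Sum.inl (G.opp n₀)) ∈ K)
  have hp : ∀ d, p (G.facePerm d) ↔ p d := by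
    intro d
    simp only [p, face_facePerm]
    by_cases hd : G.face d ∈ A
    · have h1 : (G.cut X).tail (Sum.inl (G.facePerm d)) = (G.cut X).head (Sum.inl d) := by
        rw [← cut_facePerm_inl, tail_facePerm]
      rw [h1, ← hK (Sum.inl d) (edge_mem_side.2 (Or.inl hd))]
    · simp only [hd, false_and]
  refine hn ⟨G.faceSet p, edgeSet_ext fun d => ?_⟩
  rw [edge_mem_boundary, face_mem_faceSet hp, face_mem_faceSet hp]
  by_cases hd : d ∈ G.dartsOn X
  · refine iff_of_true hd ?_
    have key : ∀ c ∈ M, p (G.opp c) ∧ ¬ p c := by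
      intro c hc
      have hcX : c ∈ G.dartsOn X := (hMX c).2 (Or.inl hc)
      have hocX := G.opp_mem_dartsOn X hcX
      have h1 : (G.cut X).tail (Sum.inl (G.opp c)) ∈ K := by
        rw [hK (Sum.inl (G.opp c)) (hX hocX), ← tail_opp, cut_opp_inl, G.opp_opp,
          cutBase_of_mem hcX]
        exact hin _ hc
      have h2 : (G.cut X).tail (Sum.inl c) ∉ K := by
        rw [hK (Sum.inl c) (hX hcX), ← tail_opp, cut_opp_inl, cutBase_of_mem hocX]
        exact hout _ (by simpa only [G.opp_opp])
      have hs := edge_mem_side.1 (hX hcX)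
      constructor
      · by_cases hf : G.face (G.opp c) ∈ A
        · exact Or.inl ⟨hf, h1⟩
        · exact Or.inr ⟨hf, (hrim c ⟨hs.resolve_right hf, hf⟩).1 h1⟩
      · rintro (h | h)
        · exact h2 h.2
        · have h3 := (hrim (G.opp c) ⟨hs.resolve_left h.1, by rw [G.opp_opp]; exact h.1⟩).2 h.2
          rw [G.opp_opp] at h3
          exact h2 h3
    rcases (hMX d).1 hd with h | h
    · have := key d h; tauto
    · have := key _ h
      rw [G.opp_opp] at this
      tauto
  · refine iff_of_false hd (not_not.2 ?_)
    have hd' : (G.cut X).head (Sum.inl d) = (G.cut X).tail (Sum.inl (G.opp d)) := by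
      rw [← tail_opp, cut_opp_inl_of_notMem hd]
    have hhead := hK (Sum.inl d)
    rw [hd'] at hhead
    simp only [p]
    by_cases hf : G.face d ∈ A <;> by_cases hf' : G.face (G.opp d) ∈ A <;>
      simp only [hf, hf', true_and, false_and, not_true_eq_false, not_false_eq_true, or_false,
        false_or]
    · exact hhead (edge_mem_side.2 (Or.inl hf))
    · exact (hhead (edge_mem_side.2 (Or.inl hf))).trans (hrim d ⟨hf, hf'⟩)
    · have h := hrim (G.opp d) ⟨hf', by rwa [G.opp_opp]⟩
      rw [G.opp_opp] at h
      exact h.symm.trans (hhead (edge_mem_side.2 (Or.inr hf')))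

/-- A face set outside A, taken over to the cut graph without any boundary face, contains the old
face of at most one copy of each edge of `X`. Its boundary therefore projects injectively into the
boundary in G, and the exchange inequality carries over. -/
theorem exists_push_cut {w : G.Edge → ℝ} (hw : ∀ e, 0 ≤ w e) {a b : G.Face}
    {A : Set G.Face} (hS : G.IsMinSeparating w a b (G.boundary A)) (ha : a ∈ A) (hb : b ∉ A)
    {X : Set G.Edge} (hX : X ⊆ G.side A) (B : Set (G.cut X).Face) : ∃ R : Set (G.cut X).Face,
      (∀ e ∉ G.cutEdgeProj X ⁻¹' G.side A,
        e ∈ (G.cut X).boundary R ↔ e ∈ (G.cut X).boundary B) ∧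
      (G.cut X).weight (w ∘ G.cutEdgeProj X)
          ((G.cut X).boundary R ∩ G.cutEdgeProj X ⁻¹' G.side A) ≤
        (G.cut X).weight (w ∘ G.cutEdgeProj X)
          ((G.cut X).boundary R \ G.cutEdgeProj X ⁻¹' G.side A) := by
  obtain ⟨R, hRA, hbR, hR⟩ := exists_subset_compl (A := A) b (G.cutFace X ⁻¹' B)
  have hpre : G.cutFace X ⁻¹' (G.cutFace X '' R) = R := Set.preimage_image_eq R cutFace_injective
  have hin : ∀ d, d ∈ G.dartsOn X → ((G.cut X).edge (Sum.inl d) ∈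
      (G.cut X).boundary (G.cutFace X '' R) ↔ G.face d ∈ R) := by
    intro d hd
    rw [cut_edge_mem_boundary_of_mem hd]
    have h1 : (G.cut X).face (Sum.inr ⟨G.opp d, G.opp_mem_dartsOn X hd⟩) ∉ G.cutFace X '' R := by
      rintro ⟨f, -, hf⟩
      exact (isCutBoundaryFace_iff.2 ⟨_, rfl⟩ : G.IsCutBoundaryFace X _) ⟨f, hf⟩
    have h2 : (G.cut X).face (Sum.inl d) ∈ G.cutFace X '' R ↔ G.face d ∈ R := by
      conv_rhs => rw [← hpre]
      rfl
    rw [h2]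
    tauto
  have hbd : ∀ d, (G.cut X).edge (Sum.inl d) ∈ (G.cut X).boundary (G.cutFace X '' R) →
      G.edge d ∈ G.boundary R := by
    intro d h
    by_cases hd : d ∈ G.dartsOn X
    · have h1 := (hin d hd).1 h
      have h2 := (edge_mem_side.1 (hX hd)).resolve_left (hRA h1)
      exact edge_mem_boundary_of_rim ⟨h1, fun h3 => hRA h3 h2⟩
    · rw [cutFace_mem_boundary hd, hpre] at h
      exact h
  have hinj : Set.InjOn (G.cutEdgeProj X) ((G.cut X).boundary (G.cutFace X '' R)) := by
    intro e he e' he' h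
    obtain ⟨d, rfl⟩ := exists_cut_edge e
    obtain ⟨d', rfl⟩ := exists_cut_edge e'
    rcases G.edge_eq_iff.1 (show G.edge d = G.edge d' from h) with rfl | rfl
    · rfl
    · by_cases hd : d ∈ G.dartsOn X
      · have h1 := (hin d hd).1 he
        have h2 := (hin _ (opp_mem_dartsOn_iff.2 hd)).1 he'
        exact absurd ((edge_mem_side.1 (hX hd)).resolve_left (hRA h1)) (hRA h2)
      · rw [← edge_opp, cut_opp_inl_of_notMem hd]
  refine ⟨G.cutFace X '' R, ?_, ?_⟩
  · intro e he
    obtain ⟨d, rfl⟩ := exists_cut_edge e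
    have he' : G.edge d ∉ G.side A := he
    have hd : d ∉ G.dartsOn X := fun h => he' (hX h)
    rw [edge_mem_side, not_or] at he'
    rw [cutFace_mem_boundary hd, cutFace_mem_boundary hd, hpre, edge_mem_boundary,
      edge_mem_boundary, hR _ he'.1 _ he'.2]
  · rw [← weight_image_of_injOn (hinj.mono Set.inter_subset_left)]
    refine le_trans (weight_mono hw ?_) ((weight_boundary_inter_side_le hw hS ha hb hRA hbR).trans
      ((weight_mono hw ?_).trans (weight_image_le hw (G.cutEdgeProj X) _)))
    · rintro _ ⟨e, ⟨he, heA⟩, rfl⟩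
      obtain ⟨d, rfl⟩ := exists_cut_edge e
      exact ⟨hbd d he, heA⟩
    · rintro e ⟨he, heA⟩
      obtain ⟨d, rfl⟩ := G.exists_edge e
      have hd : d ∉ G.dartsOn X := fun h => heA (hX h)
      exact ⟨(G.cut X).edge (Sum.inl d), ⟨by rwa [cutFace_mem_boundary hd, hpre], heA⟩, rfl⟩

/-! ### The cheapest path between the two copies of a cycle -/

section SidePath

variable {M : Set D} {X : Set G.Edge}

/-- `p` is a simple path in the edges of `E` from the copy of the cycle `M` along `M` to the copy
along the reversal of `M`. -/
def IsSidePath (G : EmbeddedGraph D) (M : Set D) (X : Set G.Edge) (E : Set (G.cut X).Edge)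
    (p : List (G.CutDart X)) : Prop :=
  ∃ x x' : G.dartsOn X, (x : D) ∈ M ∧ G.opp x' ∈ M ∧
    (G.cut X).IsPath ((G.cut X).tail (Sum.inr x)) p ((G.cut X).tail (Sum.inr x')) ∧
    (G.cut X).edgeSet p ⊆ E

theorem exists_min_sidePath {E : Set (G.cut X).Edge} {w : (G.cut X).Edge → ℝ} (hw : ∀ e, 0 ≤ w e)
    (hne : ∃ p, G.IsSidePath M X E p) :
    ∃ p, G.IsSidePath M X E p ∧
      (∀ q, G.IsSidePath M X E q → (G.cut X).walkWeight w p ≤ (G.cut X).walkWeight w q) ∧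
      ∀ q, G.IsSidePath M X E q → q.Sublist p → q = p := by
  have hfin : {p | G.IsSidePath M X E p}.Finite :=
    (finite_setOf_nodup_map (G.cut X).edge).subset fun p ⟨_, _, _, _, h, _⟩ => h.nodup_edge
  -- Weights may vanish, so length breaks ties: this excludes proper sublists of equal weight.
  obtain ⟨p, hp, hmin⟩ := Set.exists_min_image _
    (fun p => toLex ((G.cut X).walkWeight w p, p.length)) hfin hne
  refine ⟨p, hp, fun q hq => ?_, fun q hq hqp => ?_⟩
  · rcases Prod.Lex.toLex_le_toLex.1 (hmin q hq) with h | h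
    · exact h.le
    · exact h.1.le
  · have h1 := walkWeight_mono hw hqp
    rcases Prod.Lex.toLex_le_toLex.1 (hmin q hq) with h | h
    · exact absurd h (not_lt.2 h1)
    · exact hqp.eq_of_length_le h.2

theorem IsPath.append_left {u v : G.Vertex} {p q : List D} (h : G.IsPath u (p ++ q) v) :
    ∃ x, G.IsPath u p x ∧ G.IsWalk x q v := by
  obtain ⟨x, h1, h2⟩ := isWalk_append.1 h.1
  refine ⟨x, ⟨h1, ?_⟩, h2⟩
  have := h.2
  rw [List.map_append, ← List.cons_append] at this
  exact (List.nodup_append.1 this).1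

theorem IsPath.append_right {u v : G.Vertex} {p q : List D} (h : G.IsPath u (p ++ q) v) :
    ∃ x, G.IsWalk u p x ∧ G.IsPath x q v := by
  induction p generalizing u with
  | nil => exact ⟨u, rfl, h⟩
  | cons d p ih =>
    obtain ⟨⟨hd, h1⟩, h2⟩ := h
    obtain ⟨x, h3, h4⟩ := ih ⟨h1, (List.nodup_cons.1 h2).2⟩
    exact ⟨x, ⟨hd, h3⟩, h4⟩

theorem edgeSet_mono {p q : List D} (h : p.Sublist q) : G.edgeSet p ⊆ G.edgeSet q := by
  intro e he
  obtain ⟨d, hd, rfl⟩ := G.mem_edgeSet.1 he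
  exact G.mem_edgeSet.2 ⟨d, h.subset hd, rfl⟩

/-- A copy of an edge of the cycle joins two vertices of the same copy of the cycle. -/
theorem exists_ends_of_mem (hM : G.DiCycle M)
    (hMX : ∀ d, d ∈ G.dartsOn X ↔ d ∈ M ∨ G.opp d ∈ M) (y : G.CutDart X)
    (hy : G.cutDartProj X y ∈ G.dartsOn X) :
    ∃ z z' : G.dartsOn X, (G.cut X).tail y = (G.cut X).tail (Sum.inr z) ∧
      (G.cut X).head y = (G.cut X).tail (Sum.inr z') ∧ ((z : D) ∈ M ↔ (z' : D) ∈ M) := by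
  have key : ∀ d (hd : d ∈ G.dartsOn X), ∃ z : G.dartsOn X,
      (G.cut X).tail (Sum.inl d) = (G.cut X).tail (Sum.inr z) ∧ ((z : D) ∈ M ↔ G.opp d ∈ M) := by
    intro d hd
    have h1 := tail_firstReturn (X := X) subset_rfl ⟨d, hd⟩
    have h2 := hM.firstReturn_opp_mem_iff hMX ⟨G.opp d, G.opp_mem_dartsOn X hd⟩
    simp only [G.opp_opp] at h2
    rw [cutBase_of_mem (firstReturn G.rot⁻¹ (G.dartsOn X) ⟨d, hd⟩).2] at h1
    exact ⟨_, h1.symm, h2⟩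
  rcases y with d | ⟨d, hd⟩
  · change d ∈ G.dartsOn X at hy
    obtain ⟨z, h1, h2⟩ := key d hy
    refine ⟨z, ⟨G.opp d, G.opp_mem_dartsOn X hy⟩, h1, ?_, h2⟩
    rw [← tail_opp, cut_opp_inl, cutBase_of_mem (G.opp_mem_dartsOn X hy)]
  · obtain ⟨z, h1, h2⟩ := key (G.opp d) (G.opp_mem_dartsOn X hd)
    rw [G.opp_opp] at h2
    exact ⟨⟨d, hd⟩, z, rfl, h1, h2.symm⟩

/-- A path that meets a copy of the cycle before its end or after its start has a proper suffix or
prefix, depending on the copy, that still joins the two copies. -/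
theorem IsSidePath.isHandle {E : Set (G.cut X).Edge} (hM : G.DiCycle M)
    (hMX : ∀ d, d ∈ G.dartsOn X ↔ d ∈ M ∨ G.opp d ∈ M) {p : List (G.CutDart X)}
    (hp : G.IsSidePath M X E p) (hmin : ∀ q, G.IsSidePath M X E q → q.Sublist p → q = p) :
    ∃ s t, G.IsHandle M X {y | y ∈ p} s t := by
  obtain ⟨x, x', hx, hx', hpath, hpE⟩ := hp
  rcases p with _ | ⟨y₀, p⟩
  · obtain rfl := tail_inr_injective hpath.1
    exact absurd hx' (hM.opp_notMem _ hx)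
  obtain ⟨l, hdi, hy₀, hl⟩ := hpath.diPath
  have hcases : ∀ z : G.dartsOn X, (z : D) ∈ M ∨ G.opp z ∈ M := fun z => (hMX z).1 z.2
  have hfirst : ∀ y ∈ y₀ :: p, ∀ z : G.dartsOn X,
      (G.cut X).tail y = (G.cut X).tail (Sum.inr z) → y = y₀ := by
    intro y hy z hyz
    obtain ⟨p₁, p₂, hsplit⟩ := List.append_of_mem hy
    rcases hcases z with hz | hz
    · rw [hsplit] at hpath
      obtain ⟨u, -, h1⟩ := hpath.append_right
      have hsub : (y :: p₂).Sublist (y₀ :: p) := by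
        rw [hsplit]; exact List.sublist_append_right _ _
      have hu : (G.cut X).tail y = u := h1.1.1
      have h2 := hmin (y :: p₂) ⟨z, x', hz, hx', by rw [← hyz, hu]; exact h1,
        (edgeSet_mono hsub).trans hpE⟩ hsub
      exact (List.cons.inj h2).1
    · rw [hsplit] at hpath
      obtain ⟨u, h1, h3⟩ := hpath.append_left
      have hsub : p₁.Sublist (y₀ :: p) := by
        rw [hsplit]; exact List.sublist_append_left _ _
      have hu : (G.cut X).tail y = u := h3.1
      have h2 := hmin p₁ ⟨x, z, hx, hz, by rw [← hyz, hu]; exact h1,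
        (edgeSet_mono hsub).trans hpE⟩ hsub
      rw [h2] at hsplit
      have := congrArg List.length hsplit
      simp at this
  have hlast : ∀ y ∈ y₀ :: p, ∀ z : G.dartsOn X,
      (G.cut X).head y = (G.cut X).tail (Sum.inr z) → y = l := by
    intro y hy z hyz
    obtain ⟨p₁, p₂, hsplit⟩ := List.append_of_mem hy
    rcases hcases z with hz | hz
    · rw [hsplit, List.append_cons p₁ y p₂] at hpath
      obtain ⟨u, h3, h1⟩ := hpath.append_right
      have hsub : p₂.Sublist (y₀ :: p) := by
        rw [hsplit]; exact (List.sublist_cons_self _ _).trans (List.sublist_append_right _ _)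
      obtain ⟨_, -, -, hu⟩ := isWalk_append.1 h3
      have h2 := hmin p₂ ⟨z, x', hz, hx', by rw [← hyz, show _ = u from hu]; exact h1,
        (edgeSet_mono hsub).trans hpE⟩ hsub
      rw [h2] at hsplit
      have := congrArg List.length hsplit
      simp at this
      omega
    · rw [hsplit, List.append_cons p₁ y p₂] at hpath
      obtain ⟨u, h1, h3⟩ := hpath.append_left
      have hsub : (p₁ ++ [y]).Sublist (y₀ :: p) := by
        rw [hsplit, List.append_cons p₁ y p₂]; exact List.sublist_append_left _ _
      obtain ⟨_, -, -, hu⟩ := isWalk_append.1 h1.1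
      have h2 := hmin _ ⟨x, z, hx, hz, by rw [← hyz, show _ = u from hu]; exact h1,
        (edgeSet_mono hsub).trans hpE⟩ hsub
      rw [← h2, List.append_cons p₁ y p₂] at hsplit
      have h4 : p₂ = [] := by simpa using congrArg List.length hsplit
      rw [h4] at h3
      have hux : u = _ := h3
      refine hdi.head_inj hy hdi.last_mem ?_
      rw [hl, ← hux]
      exact hu
  have hoff : ∀ y ∈ y₀ :: p, ∃ d, d ∉ G.dartsOn X ∧ y = Sum.inl d := by
    intro y hy
    -- A copy of a cycle edge has both ends on the same copy of the cycle. As a path dart it would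
    -- be both first and last, and then the path would not change copies.
    by_cases hyX : G.cutDartProj X y ∈ G.dartsOn X
    · exfalso
      obtain ⟨z, z', h1, h2, h3⟩ := exists_ends_of_mem hM hMX y hyX
      have h4 := hfirst y hy z h1
      have h5 := hlast y hy z' h2
      rw [h4, hy₀] at h1
      rw [h5, hl] at h2
      obtain rfl := tail_inr_injective h1
      obtain rfl := tail_inr_injective h2
      exact hM.opp_notMem _ (h3.1 hx) hx'
    · rcases y with d | d
      · exact ⟨d, hyX, rfl⟩
      · exact absurd d.2 hyX
  obtain ⟨s, -, rfl⟩ := hoff y₀ (by simp)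
  obtain ⟨t, -, rfl⟩ := hoff l hdi.last_mem
  exact ⟨s, t, hM, hMX, hdi, hoff, ⟨x, hx, hy₀⟩, ⟨x', hx', hl⟩, hfirst, hlast⟩

end SidePath

/-! ### The dichotomy -/

theorem IsMinSeparatingInCut.symm {w : G.Edge → ℝ} {X : Set G.Edge} {a b : G.Face}
    {S : Set G.Edge} (h : G.IsMinSeparatingInCut w X a b S) : G.IsMinSeparatingInCut w X b a S := by
  obtain ⟨S', h1, h2⟩ := h
  exact ⟨S', h1, h2.symm⟩

theorem exists_tight_pair {w : G.Edge → ℝ} (hw : ∀ e, 0 ≤ w e) {g : ℕ} (hG : G.HasGenus (g + 1))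
    {a b : G.Face} {A : Set G.Face} (hS : G.IsMinSeparating w a b (G.boundary A)) (ha : a ∈ A)
    (hb : b ∉ A) (hA : G.DiCycle (G.rim A)) {Y : Set G.Edge} (hYA : Y ⊆ G.side A)
    (hY : G.deg Y = 0) (hn : ¬ G.IsNullHomologous Y) :
    ∃ (C : List D) (P : List (G.CutDart (G.edgeSet C))), G.IsTightCyclePathPair w C P ∧
      ¬ G.Crosses (G.edgeSet C) (G.boundary A) ∧
      ¬ G.Crosses (G.cutWalkEdgeSet (G.edgeSet C) P) (G.boundary A) ∧
      G.IsMinSeparatingInCut w (G.edgeSet C ∪ G.cutWalkEdgeSet (G.edgeSet C) P) a b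
        (G.boundary A) := by
  obtain ⟨C, hCt, hCA, hCn⟩ := exists_isTightCycle_side hw hS ha hb hYA hY hn
  have hM := hCt.1.diCycle
  have hMX := mem_dartsOn_edgeSet (G := G) (c := C)
  generalize hXdef : G.edgeSet C = X at hCA hCn hMX
  obtain ⟨x, x', hx, hx', p, hp, hpE⟩ := exists_walk_side hA hCA hCn hMX
  obtain ⟨q, hq, hqp⟩ := hp.exists_isPath
  have hw' : ∀ e, 0 ≤ (w ∘ G.cutEdgeProj X) e := fun e => hw _
  obtain ⟨P, hP, hPw, hPs⟩ := exists_min_sidePath (M := {d | d ∈ C}) (w := w ∘ G.cutEdgeProj X) hw'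
    ⟨q, x, x', hx, hx', hq, (edgeSet_mono hqp).trans hpE⟩
  obtain ⟨s, t, hH⟩ := hP.isHandle hM hMX hPs
  obtain ⟨x, x', hx, hx', hpath, hPE⟩ := hP
  subst hXdef
  have hZ : G.HandleEdges (G.edgeSet C) {y | y ∈ P}
      (G.edgeSet C ∪ G.cutWalkEdgeSet (G.edgeSet C) P) := by
    intro d
    refine or_congr Iff.rfl ?_
    constructor
    · rintro ⟨e, he, hed⟩
      obtain ⟨y, hy, rfl⟩ := (G.cut (G.edgeSet C)).mem_edgeSet.1 he
      obtain ⟨d', -, rfl⟩ := hH.off y hy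
      rcases G.edge_eq_iff.1 (show G.edge d' = G.edge d from hed) with rfl | rfl
      · exact Or.inl hy
      · right; rw [G.opp_opp]; exact hy
    · rintro (h | h)
      · exact ⟨_, (G.cut (G.edgeSet C)).mem_edgeSet.2 ⟨_, h, rfl⟩, rfl⟩
      · exact ⟨_, (G.cut (G.edgeSet C)).mem_edgeSet.2 ⟨_, h, rfl⟩, G.edge_opp d⟩
  have hPA : G.cutWalkEdgeSet (G.edgeSet C) P ⊆ G.side A := by
    rintro _ ⟨e, he, rfl⟩
    exact hPE he
  have hface := hH.face_eq hZ
  have hne : (G.dartsOn (G.edgeSet C ∪ G.cutWalkEdgeSet (G.edgeSet C) P)).Nonempty :=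
    ⟨x, Or.inl x.2⟩
  refine ⟨C, P, ⟨hCt, ⟨(G.cut (G.edgeSet C)).face (Sum.inr x), (G.cut (G.edgeSet C)).face (Sum.inr x'),
    _, _, isCutBoundaryFace_iff.2 ⟨_, rfl⟩, isCutBoundaryFace_iff.2 ⟨_, rfl⟩, ?_, ⟨_, rfl, rfl⟩,
    ⟨_, rfl, rfl⟩, hpath, ?_⟩, ⟨g, hG, cut_hasGenus hG hne hface (hH.ncard_dartsOn hZ)⟩, ?_⟩,
    not_crosses_of_side hA hCA, not_crosses_of_side hA hPA,
    isMinSeparatingInCut_of_side hw hS ha hb (Set.union_subset hCA hPA) hface⟩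
  · intro hff
    -- An invariant of faces that tells the two boundary faces apart.
    let r : G.CutDart (G.edgeSet C) → Prop := Sum.elim (fun _ => False) fun z => (z : D) ∈ C
    have h1 := ((G.cut (G.edgeSet C)).face_eq_iff.1 hff).map_eq r (by
      rintro (d | d)
      · rw [cut_facePerm_inl]; rfl
      · rw [cut_facePerm_inr]
        exact propext (hM.firstReturn_opp_mem_iff hMX d))
    have h2 : (x' : D) ∈ C := (iff_of_eq h1).1 hx
    exact hM.opp_notMem _ h2 hx'
  · intro q hq hh
    -- Pushing a homologous walk into the side keeps its odd vertices, so the result contains a path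
    -- with the same ends, a competitor in the choice of `P`.
    obtain ⟨R, hR, hle⟩ := exists_push hw' (exists_push_cut hw hS ha hb hCA)
      (((G.cut (G.edgeSet C)).chain_subset P).trans hPE) hh
    obtain ⟨p', hp', hsub⟩ := exists_isPath_of_deg (G := G.cut (G.edgeSet C))
      (Y := symmDiff ((G.cut (G.edgeSet C)).chain q) ((G.cut (G.edgeSet C)).boundary R))
      (by rw [deg_symmDiff, deg_boundary, add_zero, deg_chain hq])
    have h1 := hPw p' ⟨x, x', hx, hx', hp', hsub.trans hR⟩
    rw [walkWeight_eq hp'.nodup_edge] at h1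
    exact h1.trans ((weight_mono hw' hsub).trans (hle.trans (weight_chain_le hw' q)))
  · refine ⟨_, isCutBoundaryFace_iff.2 ⟨⟨x, Or.inl x.2⟩, rfl⟩, ?_⟩
    intro f hf
    obtain ⟨z, rfl⟩ := isCutBoundaryFace_iff.1 hf
    exact hface _ _

/-- If no edge had A on exactly one side, membership in A would be constant along every walk and
hence on all faces. -/
theorem boundary_nonempty (hG : G.Connected) {a b : G.Face} {A : Set G.Face} (ha : a ∈ A)
    (hb : b ∉ A) : (G.boundary A).Nonempty := by
  by_contra hne
  rw [Set.not_nonempty_iff_eq_empty] at hne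
  have hopp : ∀ d, G.face d ∈ A ↔ G.face (G.opp d) ∈ A := by
    intro d
    have : G.edge d ∉ G.boundary A := by rw [hne]; exact Set.notMem_empty _
    rwa [edge_mem_boundary, not_not] at this
  have htail : ∀ d d', G.tail d = G.tail d' → (G.face d ∈ A ↔ G.face d' ∈ A) := fun d d' h =>
    face_mem_iff_of_tail_eq (fun x _ => by rw [hne]; exact Set.notMem_empty _) h rfl
  have hwalk : ∀ (p : List D) (d d' : D), G.IsWalk (G.tail d) p (G.tail d') →
      (G.face d ∈ A ↔ G.face d' ∈ A) := by
    intro p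
    induction p with
    | nil => intro d d' h; exact htail d d' h
    | cons x p ih =>
      rintro d d' ⟨hx, h⟩
      rw [← htail x d hx, hopp x]
      exact ih (G.opp x) d' h
  obtain ⟨d, rfl⟩ := G.exists_face a
  obtain ⟨d', rfl⟩ := G.exists_face b
  obtain ⟨p, hp⟩ := hG.2 (G.tail d) (G.tail d')
  exact hb ((hwalk p d d' hp).1 ha)

end EmbeddedGraph

/-! ### The main theorem -/

theorem mainTheorem5 {D : Type*} [Finite D] (G : EmbeddedGraph D)
    (w : G.Edge → ℝ) (hw : ∀ e, 0 ≤ w e)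
    (g : ℕ) (hG : G.HasGenus g) (hg : 1 ≤ g)
    (a b : G.Face) (S : Set G.Edge) (hS : G.IsMinSeparating w a b S) :
    (∃ C : List D, G.IsTightCycle w C ∧ G.edgeSet C ⊂ S ∧
      G.IsMinSeparatingInCut w (G.edgeSet C) a b (S \ G.edgeSet C)) ∨
    (∃ (C : List D) (P : List (G.CutDart (G.edgeSet C))),
      G.IsTightCyclePathPair w C P ∧
      ¬ G.Crosses (G.edgeSet C) S ∧
      ¬ G.Crosses (G.cutWalkEdgeSet (G.edgeSet C) P) S ∧
      G.IsMinSeparatingInCut w (G.edgeSet C ∪ G.cutWalkEdgeSet (G.edgeSet C) P) a b S) := by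
  obtain ⟨A, ha, hb, rfl⟩ := hS.1
  obtain ⟨c, hc, hcA, hcS | ⟨hcS, hle⟩⟩ :=
    EmbeddedGraph.exists_cycle_of_boundary hw (EmbeddedGraph.boundary_nonempty hG.1 ha hb)
  · right
    obtain ⟨g, rfl⟩ : ∃ k, g = k + 1 := ⟨g - 1, by omega⟩
    have hrim : {d | d ∈ c} = G.rim A := Set.Subset.antisymm hcA fun d hd =>
      EmbeddedGraph.mem_of_edge_mem_edgeSet hcA hd
        (hcS ▸ EmbeddedGraph.edge_mem_boundary_of_rim hd)
    have hA : G.DiCycle (G.rim A) := hrim ▸ hc.diCycle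
    obtain ⟨Y, hY, hn⟩ := EmbeddedGraph.exists_even_not_null (G := G)
      (by have := hG.2; push_cast at this; omega) hG.1.1
    rcases EmbeddedGraph.exists_even_side_not_null hA hY hn with ⟨Y, h1, h2, h3⟩ | ⟨Y, h1, h2, h3⟩
    · exact EmbeddedGraph.exists_tight_pair hw hG hS ha hb hA h1 h2 h3
    -- The nontrivial even subgraph lies on the other side: pass to the complement of A, which
    -- reverses the rim and exchanges a and b.
    · have hA' : G.DiCycle (G.rim Aᶜ) := by
        rw [EmbeddedGraph.rim_compl]; exact hA.reverse
      obtain ⟨C, P, h4, h5, h6, h7⟩ := EmbeddedGraph.exists_tight_pair hw hG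
        (a := b) (b := a) (A := Aᶜ) (by rw [EmbeddedGraph.boundary_compl]; exact hS.symm) hb
        (fun h => h ha) hA' h1 h2 h3
      rw [EmbeddedGraph.boundary_compl] at h5 h6 h7
      exact ⟨C, P, h4, h5, h6, h7.symm⟩
  · left
    exact ⟨c, EmbeddedGraph.isTightCycle_of_light hw hS hc hcS.subset hle, hcS,
      EmbeddedGraph.isMinSeparatingInCut_diff hw hS ha hb hc hcA⟩
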